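/- Let $s,t\in\mathbb R\setminus\{0\}$, $\alpha>0$, put $\kappa^2=\tfrac12(2+1/s^2)$, $a=\sqrt3\,\kappa|t|/\alpha$, and let $\lambda\in\mathbb R^3$ satisfy $4\kappa^2=\alpha^2(1+\kappa^2)|\lambda|^2$. Let $H_5$ be the simply connected Lie group with left-invariant coframe $e^i$, $$de^1=\dots=de^4=0,\quad de^5=\tfrac ts(e^{13}+e^{24}),\quad de^6=-2t(e^{12}-e^{34})-\tfrac ts(e^{14}-e^{23}),$$ and coordinates $x^1,\dots,x^4$ with $e^i=dx^i$ $(i\le4)$. There is a Weierstrass function $\wp$ with periods $2\tau_+>0$ and $2\tau_-\in i\mathbb R_{>0}$ that solves $\wp'^2=4\wp(\wp-a)(\wp+a)$. For every such $\wp$, its real slice $u(x^1)=\wp(x^1)$ is real and positive for $x^1\notin2\tau_+\mathbb Z$, and $f=\tfrac12\ln(\alpha^2\wp(x^1))$ is smooth there. On the set $U=\{x^1\notin 2\tau_+\mathbb Z\}\subset H_5$ let $\bar e^i=e^fe^i$ $(i\le4)$, $\bar e^5=e^5$, $\bar e^6=e^6$, let $\bar g$ be the metric with orthonormal coframe $\bar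 e^i$ and dual frame $\bar e_i$, let $J\bar e_1=-\bar e_2$, $J\bar e_3=-\bar e_4$, $J\bar e_5=-\bar e_6$, $J^2=-1$, $\bar F=\bar e^{12}+\bar e^{34}+\bar e^{56}=\bar g(\cdot,J\cdot)$, $H=\bar T=-d\bar F(J\cdot,J\cdot,J\cdot)$, $\nabla^\pm=\nabla^{\bar g}\pm\frac12H$ (that is, $\bar g(\nabla^\pm_XY,Z)=\bar g(\nabla^{\bar g}_XY,Z)\pm\frac12H(X,Y,Z)$), and let $A_\lambda$ be the metric connection on the tangent bundle with connection forms $\omega^1_2=-\omega^3_4=-\lambda_1\bar e^6$, $\omega^1_3=\omega^2_4=-\lambda_2\bar e^6$, $\omega^1_4=-\omega^2_3=-\lambda_3\bar e^6$ (skew-symmetric, the others zero), where $\nabla_X\bar e_j=\sum_i\omega^i_j(X)\bar e_i$. Write $\Omega^i_j=d\omega^i_j+\sum_k\omega^i_k\wedge\omega^k_j$ and $8\pi^2p_1=\sum_{i<j}\Omega^i_j\wedge\Omega^i_j$. Put $\alpha'=-\alpha^2<0$. There are lattices (discrete cocompact subgroups) $\Gamma\subset H_5$ with $x^1(\Gamma)=2\tau_+\mathbb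 Z$; if $s\in\mathbb Q$, there is one whose image in $\mathbb R^4$ is $(2\tau_+\mathbb Z)^4$. For every lattice $\Gamma$ with $x^1(\Gamma)=2\tau_+\mathbb Z$ all these objects are $\Gamma$-invariant and descend to $M^6=\Gamma\backslash U$, the nilmanifold $\Gamma\backslash H_5$ without the singular hypersurface of $f$; $U\to M^6$ is a covering map onto a Hausdorff space, and: 1. $(\bar g,J)$ is Hermitian with integrable $J$, and $\nabla^+$ preserves $\bar g$ and $J$. 2. $(M^6,\bar g,J,\nabla^-,A_\lambda)$ solves the Strominger system with dilaton $f$, flux $H=\bar T$ and parameter $\alpha'<0$: there is a smooth nowhere vanishing spinor field $\epsilon$ on $M^6$ with $(JX)\cdot\epsilon=iX\cdot\epsilon$ and $\nabla^+\epsilon=0$, $(2df-H)\cdot\epsilon=0$, $F^{A_\lambda}\cdot\epsilon=0$ (Clifford relations $X\cdot Y+Y\cdot X=2\bar g(X,Y)$), and $dH=\frac{\alpha'}4\,8\pi^2\big(p_1(\nabla^-)-p_1(A_\lambda)\big)$. Moreover $A_\lambda$ is an $SU(3)$-instanton: $F^{A_\lambda}(JX,JY)=F^{A_\lambda}(X,Y)$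 and $\sum_kF^{A_\lambda}(\bar e_k,J\bar e_k)=0$. 3. $f$ is not constant, $H\ne0$, and $A_\lambda$ is not flat. 4. The heterotic equations of motion hold up to first order in $\alpha'$: $\delta(e^{-2f}H)=0$ and $\delta^{\nabla^+}(e^{-2f}F^{A_\lambda})=0$, and $$Ric^{\bar g}(X,Y)-\tfrac14\langle i_XH,i_YH\rangle+2(\nabla^{\bar g})^2f(X,Y)-\tfrac{\alpha'}4\big[\langle i_XF^{A_\lambda},i_YF^{A_\lambda}\rangle-\langle i_XR^-,i_YR^-\rangle\big]=\alpha'^2Q(X,Y),$$ where $Q$ is the following contraction of curvatures, in which $\alpha'$ does not occur explicitly: with $P=8\pi^2(p_1(\nabla^-)-p_1(A_\lambda))$ and $R^-(X,Y,\bar e_k,\bar e_l)=(\Omega^-)^l_k(X,Y)$, $$Q(X,Y)=-\tfrac1{128}\sum_{k,l}\Big[R^-(X,JY,\bar e_k,\bar e_l)\sum_aP(\bar e_k,\bar e_l,\bar e_a,J\bar e_a)+2\sum_aR^-(X,\bar e_a,\bar e_k,\bar e_l)\big(P(\bar e_k,\bar e_l,Y,\bar e_a)-P(\bar e_k,\bar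 e_l,JY,J\bar e_a)\big)\Big].$$ (Here $\langle i_XH,i_YH\rangle=\sum_{a,b}H(X,\bar e_a,\bar e_b)H(Y,\bar e_a,\bar e_b)$ and $\langle i_XR,i_YR\rangle=\sum_{i<j}\sum_a\Omega^i_j(X,\bar e_a)\Omega^i_j(Y,\bar e_a)$.) 5. $\bar g$ is complete on $M^6$. The image $\Lambda$ of $\Gamma$ in $\mathbb R^4$ and the intersection of $\Gamma$ with the centre $\mathbb R^2$ of $H_5$ are lattices, and $\bar g=\alpha^2\bar g_H+(e^5)^2+(e^6)^2$ with $\bar g_H=u(x^1)\sum_{i\le4}(dx^i)^2$. The metric $\bar g_H$ on the torus $\Lambda\backslash\mathbb R^4$ minus the hypersurface $S=\{x^1\in2\tau_+\mathbb Z\}$ is conformally compact and asymptotically hyperbolic with conformal infinity the flat 3-torus $\Lambda\backslash S$: there are a continuous $\rho\ge0$ on the torus vanishing exactly on $S$, near each point of $S$ of the form $|r|$ with $r$ smooth, and a smooth metric $g_c$ on the torus with $g_c=\rho^2\bar g_H$ off $S$, $|dr|_{g_c}=1$ on $S$, and $g_c$ restricted to $S$ a constant multiple of the Euclidean metric. 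-/

import Mathlib

open scoped ContDiff Kronecker Topology ENNReal

noncomputable section

namespace Het

/-! ### Differential forms on `ℝ⁶` -/

/-- Coordinate space `ℝ⁶`, with coordinates `x 0, …, x 5` (written `x¹, …, x⁶` on paper). -/
abbrev V6 := Fin 6 → ℝ

/-- A differential 1-form, as a field of linear functionals. -/
abbrev OneForm := V6 → (V6 →L[ℝ] ℝ)

/-- A differential `k`-form. -/
abbrev Form (k : ℕ) := V6 → (V6 [⋀^Fin k]→L[ℝ] ℝ)

/-- The decomposable form `α₀ ∧ … ∧ α_{k-1}`, i.e. `(v₀, …, v_{k-1}) ↦ det (α_j (v_i))`. -/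
def wedge {k : ℕ} (α : Fin k → (V6 →L[ℝ] ℝ)) : V6 [⋀^Fin k]→L[ℝ] ℝ :=
  { (Matrix.detRowAlternating (R := ℝ) (n := Fin k)).compLinearMap
      (LinearMap.pi fun j => (α j : V6 →ₗ[ℝ] ℝ)) with
    cont := by
      change Continuous fun v : Fin k → V6 => Matrix.det (fun i j => α j (v i))
      exact Continuous.matrix_det (by fun_prop) }

theorem wedge_apply {k : ℕ} (α : Fin k → (V6 →L[ℝ] ℝ)) (v : Fin k → V6) :
    wedge α v = (Matrix.of fun i j => α j (v i)).det := rfl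

/-- Exterior derivative of a 1-form. -/
def d1 (α : OneForm) : Form 2 :=
  extDeriv fun y => ContinuousAlternatingMap.ofSubsingleton ℝ V6 ℝ (0 : Fin 1) (α y)

/-- The wedge product of two alternating 2-forms, evaluated on four vectors. -/
def wedge22 (α β : V6 [⋀^Fin 2]→L[ℝ] ℝ) (v : Fin 4 → V6) : ℝ :=
  α ![v 0, v 1] * β ![v 2, v 3] - α ![v 0, v 2] * β ![v 1, v 3] + α ![v 0, v 3] * β ![v 1, v 2]
    + α ![v 1, v 2] * β ![v 0, v 3] - α ![v 1, v 3] * β ![v 0, v 2] + α ![v 2, v 3] * β ![v 0, v 1]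

/-! ### Hermitian geometry of a global orthonormal frame

All tensors are attached to a global frame `vec` with dual coframe `co`; the Riemannian metric is
the one for which the frame is orthonormal. -/

/-- A global frame of `ℝ⁶` together with its dual coframe. -/
structure Frame where
  co : Fin 6 → OneForm
  vec : Fin 6 → V6 → V6
  dual : ∀ x i j, co i x (vec j x) = if i = j then 1 else 0

/-- Connection 1-forms: `θ i j` is `ω^i_j`, where `∇_X e_j = ∑ i, ω^i_j(X) e_i`. -/
abbrev Conn := Fin 6 → Fin 6 → OneForm

namespace Frame

variable (B : Frame)

/-- The metric `g = ∑ (e^i)²`. -/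
def metric (x v w : V6) : ℝ := ∑ i, B.co i x v * B.co i x w

/-- The almost complex structure: `J e₁ = -e₂, J e₂ = e₁`, and likewise for the pairs
`(e₃, e₄)` and `(e₅, e₆)`. -/
def J (x : V6) : V6 →L[ℝ] V6 :=
  (B.co 1 x).smulRight (B.vec 0 x) - (B.co 0 x).smulRight (B.vec 1 x)
    + ((B.co 3 x).smulRight (B.vec 2 x) - (B.co 2 x).smulRight (B.vec 3 x))
    + ((B.co 5 x).smulRight (B.vec 4 x) - (B.co 4 x).smulRight (B.vec 5 x))

/-- The Kähler form `F = e¹² + e³⁴ + e⁵⁶`. -/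
def kahler : Form 2 := fun x =>
  wedge ![B.co 0 x, B.co 1 x] + wedge ![B.co 2 x, B.co 3 x] + wedge ![B.co 4 x, B.co 5 x]

/-- The flux (torsion 3-form) `H = T = d^c F`, `d^c F(X,Y,Z) = -dF(JX,JY,JZ)`. -/
def flux : Form 3 := fun x =>
  -(extDeriv B.kahler x).compContinuousLinearMap (B.J x)

/-- Levi-Civita connection 1-forms, by Koszul's formula in an orthonormal frame. -/
def leviCivita : Conn := fun i j x =>
  ∑ k, ((1 / 2 : ℝ) *
    (d1 (B.co i) x ![B.vec j x, B.vec k x] - d1 (B.co k) x ![B.vec i x, B.vec j x]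
      + d1 (B.co j) x ![B.vec k x, B.vec i x])) • B.co k x

/-- The connection `∇^g + (c/2) H`, that is
`g(∇_X Y, Z) = g(∇^g_X Y, Z) + (c/2) H(X, Y, Z)`. -/
def torsionConn (c : ℝ) : Conn := fun i j x =>
  B.leviCivita i j x +
    ∑ k, (c / 2 * B.flux x ![B.vec k x, B.vec j x, B.vec i x]) • B.co k x

/-- `∇⁺ = ∇^g + H/2`. -/
def nablaPlus : Conn := B.torsionConn 1

/-- `∇⁻ = ∇^g - H/2`. -/
def nablaMinus : Conn := B.torsionConn (-1)

end Frame

/-- Curvature 2-forms `Ω^i_j = dω^i_j + ω^i_k ∧ ω^k_j`. -/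
def curvature (θ : Conn) (i j : Fin 6) : Form 2 := fun x =>
  d1 (θ i j) x + ∑ k, wedge ![θ i k x, θ k j x]

/-- The first Pontrjagin form, `8π² p₁(∇) = ∑_{i<j} Ω^i_j ∧ Ω^i_j`, evaluated on four vectors. -/
def p1 (θ : Conn) (x : V6) (v : Fin 4 → V6) : ℝ :=
  (8 * Real.pi ^ 2)⁻¹ *
    ∑ i, ∑ j ∈ Finset.Ioi i, wedge22 (curvature θ i j x) (curvature θ i j x) v

/-! ### Spinors -/

/-- Spinors in dimension six. -/
abbrev Spinor := (Fin 2 × Fin 2) × Fin 2 → ℂ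

def σ₁ : Matrix (Fin 2) (Fin 2) ℂ := !![0, 1; 1, 0]
def σ₂ : Matrix (Fin 2) (Fin 2) ℂ := !![0, -Complex.I; Complex.I, 0]
def σ₃ : Matrix (Fin 2) (Fin 2) ℂ := !![1, 0; 0, -1]

/-- Gamma matrices, `γ_i γ_j + γ_j γ_i = 2 δ_ij`. -/
def gamma : Fin 6 → Matrix ((Fin 2 × Fin 2) × Fin 2) ((Fin 2 × Fin 2) × Fin 2) ℂ :=
  ![(σ₁ ⊗ₖ 1) ⊗ₖ 1, (σ₂ ⊗ₖ 1) ⊗ₖ 1, (σ₃ ⊗ₖ σ₁) ⊗ₖ 1, (σ₃ ⊗ₖ σ₂) ⊗ₖ 1,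
    (σ₃ ⊗ₖ σ₃) ⊗ₖ σ₁, (σ₃ ⊗ₖ σ₃) ⊗ₖ σ₂]

theorem gamma_clifford (i j : Fin 6) :
    gamma i * gamma j + gamma j * gamma i = if i = j then 2 else 0 := by
  have h11 : σ₁ * σ₁ = 1 := by ext a b; fin_cases a <;> fin_cases b <;> simp [σ₁]
  have h22 : σ₂ * σ₂ = 1 := by ext a b; fin_cases a <;> fin_cases b <;> simp [σ₂]
  have h33 : σ₃ * σ₃ = 1 := by ext a b; fin_cases a <;> fin_cases b <;> simp [σ₃]
  have h21 : σ₂ * σ₁ = (-1 : ℂ) • (σ₁ * σ₂) := by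
    ext a b; fin_cases a <;> fin_cases b <;> simp [σ₁, σ₂]
  have h31 : σ₃ * σ₁ = (-1 : ℂ) • (σ₁ * σ₃) := by
    ext a b; fin_cases a <;> fin_cases b <;> simp [σ₁, σ₃]
  have h32 : σ₃ * σ₂ = (-1 : ℂ) • (σ₂ * σ₃) := by
    ext a b; fin_cases a <;> fin_cases b <;> simp [σ₂, σ₃]
  fin_cases i <;> fin_cases j <;>
    simp [gamma, ← Matrix.mul_kronecker_mul, h11, h22, h33, h21, h31, h32, one_add_one_eq_two,
      -neg_smul, Matrix.smul_kronecker, Matrix.kronecker_smul] <;> simp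

/-- Covariant derivative of a spinor field, `∇_v ε = dε(v) + ¼ ∑ ω_{ij}(v) γ_i γ_j ε`. -/
def spinNabla (θ : Conn) (ε : V6 → Spinor) (x v : V6) : Spinor :=
  fderiv ℝ ε x v + (1 / 4 : ℂ) • ∑ i, ∑ j, (θ i j x v : ℂ) • (gamma i * gamma j).mulVec (ε x)

/-- Clifford action of an alternating `k`-form on a spinor at `x`,
`(1/k!) ∑ α(e_{i₁}, …, e_{i_k}) γ_{i₁} ⋯ γ_{i_k} ε`. -/
def Frame.clifford (B : Frame) {k : ℕ} (x : V6) (α : V6 [⋀^Fin k]→L[ℝ] ℝ) (ε : Spinor) : Spinor :=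
  ((k.factorial : ℂ)⁻¹ • ∑ I : Fin k → Fin 6,
    (α (fun a => B.vec (I a) x) : ℂ) • (List.ofFn fun a => gamma (I a)).prod).mulVec ε

/-- Clifford multiplication by a tangent vector. -/
def Frame.cliffordVec (B : Frame) (x v : V6) (ε : Spinor) : Spinor :=
  (∑ i, (B.co i x v : ℂ) • gamma i).mulVec ε

/-! ### The Strominger system and the equations of motion -/

namespace Frame

variable (B : Frame)

/-- `(g, J, F)` is a Hermitian structure with integrable `J` on the open set `U`. -/
structure IsHermitian (U : Set V6) : Prop where
  pos : ∀ x ∈ U, ∀ v, v ≠ 0 → 0 < B.metric x v v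
  sq : ∀ x ∈ U, ∀ v, B.J x (B.J x v) = -v
  compat : ∀ x ∈ U, ∀ v w, B.metric x (B.J x v) (B.J x w) = B.metric x v w
  kahler_eq : ∀ x ∈ U, ∀ v w, B.kahler x ![v, w] = B.metric x v (B.J x w)
  /-- The Nijenhuis tensor vanishes. -/
  integrable : ∀ X Y : V6 → V6, ContDiffOn ℝ ∞ X U → ContDiffOn ℝ ∞ Y U → ∀ x ∈ U,
    VectorField.lieBracket ℝ (fun y => B.J y (X y)) (fun y => B.J y (Y y)) x
      - B.J x (VectorField.lieBracket ℝ (fun y => B.J y (X y)) Y x)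
      - B.J x (VectorField.lieBracket ℝ X (fun y => B.J y (Y y)) x)
      - VectorField.lieBracket ℝ X Y x = 0

/-- The connection `θ` preserves the metric and `J`
(the components of `J` in the frame are constant). -/
def IsHermitianConn (U : Set V6) (θ : Conn) : Prop :=
  ∀ x ∈ U, ∀ v : V6,
    (∀ i j, θ i j x v = -θ j i x v) ∧
    ∀ i j, ∑ k, (θ i k x v * B.co k x (B.J x (B.vec j x))
      - B.co i x (B.J x (B.vec k x)) * θ k j x v) = 0

/-- `SU(3)`-instanton: `Ω(JE_k, JE_l) = Ω(E_k, E_l)` and `∑ Ω(E_k, JE_k) = 0`. -/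
def IsInstanton (U : Set V6) (θ : Conn) : Prop :=
  ∀ x ∈ U, ∀ i j,
    (∀ v w, curvature θ i j x ![B.J x v, B.J x w] = curvature θ i j x ![v, w]) ∧
    ∑ k, curvature θ i j x ![B.vec k x, B.J x (B.vec k x)] = 0

/-- The Killing spinor equations for the nowhere vanishing spinor field `ε` on `U`:
`∇⁺ε = 0`, `(2dφ - H)·ε = 0`, `F^A·ε = 0`. -/
structure IsKillingSpinor (U : Set V6) (φ : V6 → ℝ) (A : Conn) (ε : V6 → Spinor) : Prop where
  smooth : ContDiffOn ℝ ∞ ε U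
  ne_zero : ∀ x ∈ U, ε x ≠ 0
  gravitino : ∀ x ∈ U, ∀ v, spinNabla B.nablaPlus ε x v = 0
  dilatino : ∀ x ∈ U,
    B.clifford x ((2 : ℝ) • ContinuousAlternatingMap.ofSubsingleton ℝ V6 ℝ (0 : Fin 1)
      (fderiv ℝ φ x)) (ε x) - B.clifford x (B.flux x) (ε x) = 0
  gaugino : ∀ x ∈ U, ∀ i j, B.clifford x (curvature A i j x) (ε x) = 0

/-- Anomaly cancellation `dH = (α'/4) 8π² (p₁(∇) - p₁(A))`. -/
def Anomaly (U : Set V6) (θ A : Conn) (α' : ℝ) : Prop :=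
  ∀ x ∈ U, ∀ v : Fin 4 → V6,
    extDeriv B.flux x v = α' / 4 * (8 * Real.pi ^ 2) * (p1 θ x v - p1 A x v)

/-- The derivative of a function along the `i`-th frame vector. -/
def dir (i : Fin 6) (h : V6 → ℝ) (x : V6) : ℝ := fderiv ℝ h x (B.vec i x)

/-- The Ricci tensor `Ric(X,Y) = ∑ g(R(e_i, X)Y, e_i)` of the metric. -/
def ricci (x X Y : V6) : ℝ :=
  ∑ i, ∑ k, curvature B.leviCivita i k x ![B.vec i x, X] * B.co k x Y

/-- The Hessian `(∇^g)²φ(X,Y)`. -/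
def hessian (φ : V6 → ℝ) (x X Y : V6) : ℝ :=
  ∑ i, ∑ j, B.co i x X * B.co j x Y *
    (B.dir i (B.dir j φ) x - ∑ l, B.leviCivita l j x (B.vec i x) * B.dir l φ x)

/-- `⟨i_X H, i_Y H⟩`. -/
def fluxInner (x X Y : V6) : ℝ :=
  ∑ a, ∑ b, B.flux x ![X, B.vec a x, B.vec b x] * B.flux x ![Y, B.vec a x, B.vec b x]

/-- `⟨i_X R, i_Y R⟩` for the curvature of a metric connection; the trace over the
skew-symmetric endomorphism indices is `∑_{i<j}`, as in the Pontrjagin form. -/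
def curvInner (θ : Conn) (x X Y : V6) : ℝ :=
  ∑ i, ∑ j ∈ Finset.Ioi i, ∑ a,
    curvature θ i j x ![X, B.vec a x] * curvature θ i j x ![Y, B.vec a x]

/-- Left-hand side of the Einstein equation of motion,
`Ric - ¼⟨i_X H, i_Y H⟩ + 2∇²φ - (α'/4)(⟨i_X F^A, i_Y F^A⟩ - ⟨i_X R, i_Y R⟩)`, `R = R⁻`. -/
def einstein (φ : V6 → ℝ) (A : Conn) (α' : ℝ) (x X Y : V6) : ℝ :=
  B.ricci x X Y - 1 / 4 * B.fluxInner x X Y + 2 * B.hessian φ x X Y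
    - α' / 4 * (B.curvInner A x X Y - B.curvInner B.nablaMinus x X Y)

/-- The 4-form `P = 8π² (p₁(∇⁻) - p₁(A)) = Tr(R ∧ R) - Tr(F^A ∧ F^A)`. -/
def anomalyForm (A : Conn) (x : V6) (v : Fin 4 → V6) : ℝ :=
  8 * Real.pi ^ 2 * (p1 B.nablaMinus x v - p1 A x v)

/-- The coefficient of `α'²` left over in the Einstein equation: a contraction of the curvature
`R⁻(X,Y,e_k,e_l) = Ω^l_k(X,Y)` with the 4-form `P`, in which `α'` does not occur,
`-(1/128) ∑_{k,l} ( R⁻(X,JY,e_k,e_l) ∑_a P(e_k,e_l,e_a,Je_a)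
  + 2 ∑_a R⁻(X,e_a,e_k,e_l) (P(e_k,e_l,Y,e_a) - P(e_k,e_l,JY,Je_a)) )`. -/
def secondOrder (A : Conn) (x X Y : V6) : ℝ :=
  -(1 / 128) * ∑ k, ∑ l,
    (curvature B.nablaMinus l k x ![X, B.J x Y] *
        ∑ a, B.anomalyForm A x ![B.vec k x, B.vec l x, B.vec a x, B.J x (B.vec a x)]
      + 2 * ∑ a, curvature B.nablaMinus l k x ![X, B.vec a x] *
        (B.anomalyForm A x ![B.vec k x, B.vec l x, Y, B.vec a x]
          - B.anomalyForm A x ![B.vec k x, B.vec l x, B.J x Y, B.J x (B.vec a x)]))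

/-- The codifferential `-Tr ∇^g ξ` of a 3-form, on `(e_a, e_b)`. -/
def codiff3 (ξ : Form 3) (x : V6) (a b : Fin 6) : ℝ :=
  -∑ k, (B.dir k (fun y => ξ y ![B.vec k y, B.vec a y, B.vec b y]) x
    - ∑ l, (B.leviCivita l k x (B.vec k x) * ξ x ![B.vec l x, B.vec a x, B.vec b x]
      + B.leviCivita l a x (B.vec k x) * ξ x ![B.vec k x, B.vec l x, B.vec b x]
      + B.leviCivita l b x (B.vec k x) * ξ x ![B.vec k x, B.vec a x, B.vec l x]))

/-- `-Tr ∇⁺ Φ` on `e_a` for an endomorphism-valued 2-form `Φ`, with `∇⁺` acting on the form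
indices and the gauge connection `A` on the endomorphism indices `i j`. -/
def codiffGauge (A : Conn) (Φ : Fin 6 → Fin 6 → Form 2) (x : V6) (i j a : Fin 6) : ℝ :=
  -∑ k, (B.dir k (fun y => Φ i j y ![B.vec k y, B.vec a y]) x
    - ∑ l, (B.nablaPlus l k x (B.vec k x) * Φ i j x ![B.vec l x, B.vec a x]
      + B.nablaPlus l a x (B.vec k x) * Φ i j x ![B.vec k x, B.vec l x])
    + ∑ l, (A i l x (B.vec k x) * Φ l j x ![B.vec k x, B.vec a x]
      - Φ i l x ![B.vec k x, B.vec a x] * A l j x (B.vec k x)))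

/-- The heterotic equations of motion up to first order in `α'`: the equations for the flux and
for the gauge field hold, and the Einstein equation holds up to the term `α'² • secondOrder`. -/
structure SolvesMotionFirstOrder (U : Set V6) (φ : V6 → ℝ) (A : Conn) (α' : ℝ) : Prop where
  einstein : ∀ x ∈ U, ∀ X Y, B.einstein φ A α' x X Y = α' ^ 2 * B.secondOrder A x X Y
  flux : ∀ x ∈ U, ∀ a b, B.codiff3 (fun y => Real.exp (-2 * φ y) • B.flux y) x a b = 0
  gauge : ∀ x ∈ U, ∀ i j a,
    B.codiffGauge A (fun i j y => Real.exp (-2 * φ y) • curvature A i j y) x i j a = 0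

end Frame

/-! ### The group `H₅`, its coframes and the instanton -/

/-- The multiplication of `H₅`. -/
def h5Mul (s t : ℝ) (x y : V6) : V6 :=
  ![x 0 + y 0, x 1 + y 1, x 2 + y 2, x 3 + y 3,
    x 4 + y 4 - t / s * (x 0 * y 2 + x 1 * y 3),
    x 5 + y 5 + 2 * t * (x 0 * y 1 - x 2 * y 3) + t / s * (x 0 * y 3 - x 1 * y 2)]

/-- The simply connected Lie group `H₅ = ℝ⁶` with the multiplication `h5Mul`. -/
def H5 (_s _t : ℝ) : Type := Fin 6 → ℝ

instance (s t : ℝ) : TopologicalSpace (H5 s t) := inferInstanceAs (TopologicalSpace (Fin 6 → ℝ))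

instance (s t : ℝ) : Group (H5 s t) where
  mul x y := h5Mul s t x y
  one := (0 : V6)
  inv x := (![-x 0, -x 1, -x 2, -x 3,
    -x 4 - t / s * (x 0 * x 2 + x 1 * x 3),
    -x 5 + 2 * t * (x 0 * x 1 - x 2 * x 3) + t / s * (x 0 * x 3 - x 1 * x 2)] : V6)
  mul_assoc x y z := by
    change h5Mul s t (h5Mul s t x y) z = h5Mul s t x (h5Mul s t y z)
    funext i; fin_cases i <;> simp [h5Mul] <;> ring
  one_mul x := by
    change h5Mul s t 0 x = x
    funext i; fin_cases i <;> simp [h5Mul]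
  mul_one x := by
    change h5Mul s t x 0 = x
    funext i; fin_cases i <;> simp [h5Mul]
  inv_mul_cancel x := by
    change h5Mul s t _ x = 0
    funext i; fin_cases i <;> simp [h5Mul] <;> ring

/-- The coordinate 1-form `dx^i`. -/
abbrev dx (i : Fin 6) : V6 →L[ℝ] ℝ := ContinuousLinearMap.proj i

/-- The left-invariant coframe `e¹, …, e⁶` of `H₅`. -/
def e (s t : ℝ) : Fin 6 → OneForm :=
  ![fun _ => dx 0, fun _ => dx 1, fun _ => dx 2, fun _ => dx 3,
    fun x => dx 4 + (t / s) • (x 0 • dx 2 + x 1 • dx 3),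
    fun x => dx 5 - (2 * t) • (x 0 • dx 1 - x 2 • dx 3) - (t / s) • (x 0 • dx 3 - x 1 • dx 2)]

theorem d1_apply {α : OneForm} {x : V6} (h : DifferentiableAt ℝ α x) (v : Fin 2 → V6) :
    d1 α x v = fderiv ℝ α x (v 0) (v 1) - fderiv ℝ α x (v 1) (v 0) := by
  have h' : fderiv ℝ (fun y => ContinuousAlternatingMap.ofSubsingleton ℝ V6 ℝ (0 : Fin 1) (α y)) x
      = ((ContinuousAlternatingMap.ofSubsingletonLIE (𝕜 := ℝ) (E := V6) (F := ℝ)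
          (0 : Fin 1)).toContinuousLinearEquiv :
          (V6 →L[ℝ] ℝ) →L[ℝ] V6 [⋀^Fin 1]→L[ℝ] ℝ).comp (fderiv ℝ α x) :=
    (((ContinuousAlternatingMap.ofSubsingletonLIE (𝕜 := ℝ) (E := V6) (F := ℝ)
      (0 : Fin 1)).toContinuousLinearEquiv.hasFDerivAt).comp x h.hasFDerivAt).fderiv
  rw [d1, extDeriv, ContinuousAlternatingMap.alternatizeUncurryFin_apply, h']
  simp [Fin.sum_univ_two, Fin.removeNth, sub_eq_add_neg]

/-- The structure equations of `𝔥₅`: `de¹ = ⋯ = de⁴ = 0`, `de⁵ = (t/s)(e¹³ + e²⁴)`,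
`de⁶ = -2t(e¹² - e³⁴) - (t/s)(e¹⁴ - e²³)`. -/
theorem e_structure (s t : ℝ) (x : V6) :
    d1 (e s t 0) x = 0 ∧ d1 (e s t 1) x = 0 ∧ d1 (e s t 2) x = 0 ∧ d1 (e s t 3) x = 0 ∧
    d1 (e s t 4) x =
      (t / s) • (wedge ![e s t 0 x, e s t 2 x] + wedge ![e s t 1 x, e s t 3 x]) ∧
    d1 (e s t 5) x =
      -(2 * t) • (wedge ![e s t 0 x, e s t 1 x] - wedge ![e s t 2 x, e s t 3 x])
        - (t / s) • (wedge ![e s t 0 x, e s t 3 x] - wedge ![e s t 1 x, e s t 2 x]) := by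
  have hc (i : Fin 6) (y : V6) : HasFDerivAt (fun z : V6 => z i) (dx i) y :=
    (ContinuousLinearMap.proj i : V6 →L[ℝ] ℝ).hasFDerivAt
  have hw (α β : V6 →L[ℝ] ℝ) (v : Fin 2 → V6) :
      wedge ![α, β] v = α (v 0) * β (v 1) - α (v 1) * β (v 0) := by
    rw [wedge_apply, Matrix.det_fin_two]
    simp; ring
  have h4 : HasFDerivAt (e s t 4) _ x :=
    ((((hc 0 x).smul_const (dx 2)).add ((hc 1 x).smul_const (dx 3))).const_smul (t / s)).const_add
      (dx 4)
  have h5 : HasFDerivAt (e s t 5) _ x :=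
    ((((((hc 0 x).smul_const (dx 1)).sub ((hc 2 x).smul_const (dx 3))).const_smul
      (2 * t)).const_sub (dx 5))).sub
      ((((hc 0 x).smul_const (dx 3)).sub ((hc 1 x).smul_const (dx 2))).const_smul (t / s))
  refine ⟨?_, ?_, ?_, ?_, ?_, ?_⟩
  · ext v; rw [d1_apply (α := e s t 0) (differentiableAt_const _)]; simp [e]
  · ext v; rw [d1_apply (α := e s t 1) (differentiableAt_const _)]; simp [e]
  · ext v; rw [d1_apply (α := e s t 2) (differentiableAt_const _)]; simp [e]
  · ext v; rw [d1_apply (α := e s t 3) (differentiableAt_const _)]; simp [e]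
  · ext v; rw [d1_apply h4.differentiableAt, h4.fderiv]
    simp [hw, e]; ring
  · ext v; rw [d1_apply h5.differentiableAt, h5.fderiv]
    simp [hw, e]; ring

/-- The frame dual to `e`. -/
def eVec (s t : ℝ) (x : V6) : Fin 6 → V6 :=
  ![![1, 0, 0, 0, 0, 0],
    ![0, 1, 0, 0, 0, 2 * t * x 0],
    ![0, 0, 1, 0, -(t / s) * x 0, -(t / s) * x 1],
    ![0, 0, 0, 1, -(t / s) * x 1, -(2 * t) * x 2 + t / s * x 0],
    ![0, 0, 0, 0, 1, 0],
    ![0, 0, 0, 0, 0, 1]]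

/-- The conformal weight of the `i`-th coframe element: `e^f` for `i ≤ 4`, else `1`. -/
def weight (f : V6 → ℝ) (i : Fin 6) (x : V6) : ℝ := if i < 4 then Real.exp (f x) else 1

/-- The rescaled coframe `ē^i = e^f e^i` (`i ≤ 4`), `ē⁵ = e⁵`, `ē⁶ = e⁶` with its dual frame. -/
def barFrame (s t : ℝ) (f : V6 → ℝ) : Frame where
  co i x := weight f i x • e s t i x
  vec i x := (weight f i x)⁻¹ • eVec s t x i
  dual x i j := by
    have hf : Real.exp (f x) ≠ 0 := Real.exp_ne_zero _
    fin_cases i <;> fin_cases j <;> simp [weight, e, eVec, hf] <;> ring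

/-- The coefficients of the connection `A_λ`. -/
def instantonMatrix (l : Fin 3 → ℝ) : Matrix (Fin 6) (Fin 6) ℝ :=
  !![0, -l 0, -l 1, -l 2, 0, 0;
     l 0, 0, l 2, -l 1, 0, 0;
     l 1, -l 2, 0, l 0, 0, 0;
     l 2, l 1, -l 0, 0, 0, 0;
     0, 0, 0, 0, 0, 0;
     0, 0, 0, 0, 0, 0]

/-- The connection `A_λ`, whose connection 1-forms in the frame `B` are multiples of `ē⁶`. -/
def instanton (B : Frame) (l : Fin 3 → ℝ) : Conn := fun i j x => instantonMatrix l i j • B.co 5 x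

/-! ### The dilaton -/

/-- `κ² = ½ (2 + 1/s²)`. -/
def kappaSq (s : ℝ) : ℝ := 1 / 2 * (2 + 1 / s ^ 2)

/-- `a = κ |t| √3 / α`. -/
def aParam (s t α : ℝ) : ℝ := √(kappaSq s) * |t| * √3 / α

/-- `L` is the period pair `(2τ₊, 2τ₋)` with `τ₊ > 0` real and `τ₋` on the positive imaginary axis,
whose `℘`-function solves `℘'² = 4 ℘ (℘ - a) (℘ + a)`. -/
structure IsPeriodPairFor (L : PeriodPair) (a : ℝ) : Prop where
  re_pos : 0 < L.ω₁.re
  im_eq : L.ω₁.im = 0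
  re_eq : L.ω₂.re = 0
  im_pos : 0 < L.ω₂.im
  ode : ∀ z : ℂ, z ∉ L.lattice →
    deriv L.weierstrassP z ^ 2 =
      4 * L.weierstrassP z * (L.weierstrassP z - a) * (L.weierstrassP z + a)

/-- The real slice `u(x) = ℘(x)`, `x ∈ ℝ`. -/
def realSlice (L : PeriodPair) (x : ℝ) : ℝ := (L.weierstrassP (x : ℂ)).re

/-- The dilaton `f = ½ ln (α² ℘(x¹))`. -/
def dilaton (α : ℝ) (L : PeriodPair) (x : V6) : ℝ := 1 / 2 * Real.log (α ^ 2 * realSlice L (x 0))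

/-- The points of `H₅` that are not over the poles `x¹ ∈ 2τ₊ℤ` of the real slice. -/
def regular (L : PeriodPair) : Set V6 := {x | ∀ n : ℤ, x 0 ≠ n * L.ω₁.re}

/-- The frame `ē` of the background, for the dilaton `f = dilaton α L`. -/
abbrev backFrame (s t α : ℝ) (L : PeriodPair) : Frame := barFrame s t (dilaton α L)

/-- The instanton `A_λ` of the background. -/
abbrev backInstanton (s t α : ℝ) (L : PeriodPair) (l : Fin 3 → ℝ) : Conn :=
  instanton (backFrame s t α L) l

/-! ### Lattices and the nilmanifold -/

section Lattice

variable {s t : ℝ}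

/-- The nilmanifold `Γ \ H₅`. -/
abbrev Nilmanifold (Γ : Subgroup (H5 s t)) : Type := MulAction.orbitRel.Quotient Γ (H5 s t)

/-- `Γ` is a discrete cocompact subgroup of `H₅`. -/
def IsLattice (Γ : Subgroup (H5 s t)) : Prop :=
  DiscreteTopology Γ ∧ CompactSpace (Nilmanifold Γ)

/-- The lattice `Γ` has period `2τ₊` in the variable `x¹`: its image under `x¹` is `2τ₊ℤ`. -/
def HasPeriod (Γ : Subgroup (H5 s t)) (L : PeriodPair) : Prop :=
  (fun a : H5 s t => (a : V6) 0) '' (Γ : Set (H5 s t)) = {r | ∃ n : ℤ, r = n * L.ω₁.re}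

/-- The image of `Γ` in `ℝ⁴ = H₅ / centre`. -/
def baseLattice (Γ : Subgroup (H5 s t)) : AddSubgroup (Fin 4 → ℝ) where
  carrier := {v | ∃ a ∈ Γ, v = ![(a : V6) 0, (a : V6) 1, (a : V6) 2, (a : V6) 3]}
  zero_mem' := ⟨1, Γ.one_mem, by
    funext i; fin_cases i <;> rfl⟩
  add_mem' := by
    rintro _ _ ⟨a, ha, rfl⟩ ⟨b, hb, rfl⟩
    refine ⟨a * b, Γ.mul_mem ha hb, ?_⟩
    funext i; fin_cases i <;> rfl
  neg_mem' := by
    rintro _ ⟨a, ha, rfl⟩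
    refine ⟨a⁻¹, Γ.inv_mem ha, ?_⟩
    funext i; fin_cases i <;> rfl

/-- The central element `(0, 0, 0, 0, w)` of `H₅`. -/
def central (s t : ℝ) (w : Fin 2 → ℝ) : H5 s t := (![0, 0, 0, 0, w 0, w 1] : V6)

/-- The intersection of `Γ` with the centre `ℝ²` of `H₅`. -/
def fibreLattice (Γ : Subgroup (H5 s t)) : AddSubgroup (Fin 2 → ℝ) where
  carrier := {w | central s t w ∈ Γ}
  zero_mem' := by
    have h : central s t 0 = 1 := by
      funext i; fin_cases i <;> rfl
    simpa only [Set.mem_ofPred_eq, h] using Γ.one_mem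
  add_mem' := by
    intro a b ha hb
    have h : central s t (a + b) = central s t a * central s t b := by
      change _ = h5Mul s t _ _
      funext i; fin_cases i <;> simp [h5Mul, central]
    simpa only [Set.mem_ofPred_eq, h] using Γ.mul_mem ha hb
  neg_mem' := by
    intro a ha
    have h : central s t (-a) = (central s t a)⁻¹ := by
      refine eq_inv_of_mul_eq_one_left ?_
      change h5Mul s t _ _ = (0 : V6)
      funext i; fin_cases i <;> simp [h5Mul, central]
    simpa only [Set.mem_ofPred_eq, h] using Γ.inv_mem ha

/-- The vectors of `Λ ⊆ ℝ⁴` tangent to the hyperplane `x¹ = 0`, as a subgroup of `ℝ³`. -/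
def boundaryLattice (Λ : AddSubgroup (Fin 4 → ℝ)) : AddSubgroup (Fin 3 → ℝ) where
  carrier := {w | (![0, w 0, w 1, w 2] : Fin 4 → ℝ) ∈ Λ}
  zero_mem' := by
    have h : (![0, (0 : Fin 3 → ℝ) 0, (0 : Fin 3 → ℝ) 1, (0 : Fin 3 → ℝ) 2] : Fin 4 → ℝ) = 0 := by
      funext i; fin_cases i <;> rfl
    simpa only [Set.mem_ofPred_eq, h] using Λ.zero_mem
  add_mem' := by
    intro a b ha hb
    have h : (![0, (a + b) 0, (a + b) 1, (a + b) 2] : Fin 4 → ℝ) =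
        ![0, a 0, a 1, a 2] + ![0, b 0, b 1, b 2] := by
      funext i; fin_cases i <;> simp
    simpa only [Set.mem_ofPred_eq, h] using Λ.add_mem ha hb
  neg_mem' := by
    intro a ha
    have h : (![0, (-a) 0, (-a) 1, (-a) 2] : Fin 4 → ℝ) = -![0, a 0, a 1, a 2] := by
      funext i; fin_cases i <;> simp
    simpa only [Set.mem_ofPred_eq, h] using Λ.neg_mem ha

/-- A discrete cocompact subgroup of `ℝⁿ`, i.e. one whose quotient is a flat `n`-torus. -/
def IsTorusLattice {n : ℕ} (Λ : AddSubgroup (Fin n → ℝ)) : Prop :=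
  DiscreteTopology Λ ∧ CompactSpace ((Fin n → ℝ) ⧸ Λ)

/-- The manifold `M⁶`: the nilmanifold `Γ \ H₅` without the singular set of the dilaton. -/
def M (Γ : Subgroup (H5 s t)) (L : PeriodPair) : Set (Nilmanifold Γ) :=
  (fun x : H5 s t => (Quotient.mk _ x : Nilmanifold Γ)) '' (regular L : Set V6)

/-- The projection of the regular points of `H₅` onto `M⁶`. -/
def proj (Γ : Subgroup (H5 s t)) (L : PeriodPair) :
    {x : H5 s t // x ∈ (regular L : Set V6)} → M Γ L :=
  fun x => ⟨Quotient.mk _ x.1, x.1, x.2, rfl⟩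

/-- The coframe `B.co` on `regular L` is invariant under the left translations by `Γ`, so that it
and all tensor fields and connections built from it descend to `M⁶`. -/
def CoframeDescends (Γ : Subgroup (H5 s t)) (L : PeriodPair) (B : Frame) : Prop :=
  ∀ a ∈ Γ, ∀ x ∈ regular L, h5Mul s t a x ∈ regular L ∧
    ∀ i v, B.co i (h5Mul s t a x) (fderiv ℝ (h5Mul s t a) x v) = B.co i x v

/-- The function `h` on `regular L` is invariant under `Γ`, i.e. it is a function on `M⁶`. -/
def Descends {X : Type*} (Γ : Subgroup (H5 s t)) (L : PeriodPair) (h : V6 → X) : Prop :=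
  ∀ a ∈ Γ, ∀ x ∈ regular L, h (h5Mul s t a x) = h x

/-- The Riemannian distance on `M⁶` of the metric of `B`: the infimum of the lengths of
`C¹` curves, which are the projections of `C¹` curves in `regular L`. -/
def riemDist (Γ : Subgroup (H5 s t)) (L : PeriodPair) (B : Frame) (p q : M Γ L) : ℝ≥0∞ :=
  ⨅ γ : {γ : ℝ → V6 // ContDiffOn ℝ 1 γ (Set.Icc 0 1) ∧
      ∃ h : ∀ τ ∈ Set.Icc (0 : ℝ) 1, γ τ ∈ regular L,
        proj Γ L ⟨γ 0, h 0 (by simp)⟩ = p ∧ proj Γ L ⟨γ 1, h 1 (by simp)⟩ = q},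
    ∫⁻ τ in Set.Icc (0 : ℝ) 1, ENNReal.ofReal
      √(B.metric (γ.1 τ) (derivWithin γ.1 (Set.Icc 0 1) τ) (derivWithin γ.1 (Set.Icc 0 1) τ))

/-- Completeness of the Riemannian manifold `M⁶`: Cauchy sequences converge. -/
def IsCompleteMetric (Γ : Subgroup (H5 s t)) (L : PeriodPair) (B : Frame) : Prop :=
  ∀ p : ℕ → M Γ L,
    (∀ δ : ℝ≥0∞, 0 < δ → ∃ N, ∀ m ≥ N, ∀ n ≥ N, riemDist Γ L B (p m) (p n) < δ) →
    ∃ q, Filter.Tendsto (fun n => riemDist Γ L B (p n) q) Filter.atTop (𝓝 0)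

end Lattice

/-! ### Conformal compactness -/

/-- The Euclidean inner product of `ℝ⁴`. -/
def euclid4 : (Fin 4 → ℝ) →L[ℝ] (Fin 4 → ℝ) →L[ℝ] ℝ :=
  ∑ i, (ContinuousLinearMap.proj i : (Fin 4 → ℝ) →L[ℝ] ℝ).smulRight
    (ContinuousLinearMap.proj i : (Fin 4 → ℝ) →L[ℝ] ℝ)

/-- The metric `ḡ_H = u(x¹) ((dx¹)² + ⋯ + (dx⁴)²)` on the base. -/
def baseMetric (L : PeriodPair) (x : Fin 4 → ℝ) : (Fin 4 → ℝ) →L[ℝ] (Fin 4 → ℝ) →L[ℝ] ℝ :=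
  realSlice L (x 0) • euclid4

/-- The hyperplanes `x¹ ∈ cℤ` in `ℝ⁴`. -/
def walls (c : ℝ) : Set (Fin 4 → ℝ) := {x | ∃ n : ℤ, x 0 = n * c}

/-- The metric `g`, defined off the hyperplanes `S = walls c`, is a conformally compact
asymptotically hyperbolic metric on the complement of the image of `S` in the torus `Λ \ ℝ⁴`,
whose conformal infinity is the flat 3-torus `Λ \ S`: there are a boundary defining function `ρ`
(locally the absolute value of a smooth function `r` with `dr ≠ 0` along `S`) and a smooth metric
`gc` on the torus with `gc = ρ² g` off `S` and `|dr|_gc = 1` on `S`, which is flat on `S`. -/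
def IsConformallyCompactAH (Λ : AddSubgroup (Fin 4 → ℝ)) (c : ℝ)
    (g : (Fin 4 → ℝ) → (Fin 4 → ℝ) →L[ℝ] (Fin 4 → ℝ) →L[ℝ] ℝ) : Prop :=
  IsTorusLattice Λ ∧ IsTorusLattice (boundaryLattice Λ) ∧
  (∀ a ∈ Λ, ∀ x, (a + x ∈ walls c ↔ x ∈ walls c) ∧ (x ∉ walls c → g (a + x) = g x)) ∧
  (∀ x ∉ walls c, ∀ v, v ≠ 0 → 0 < g x v v) ∧ ContDiffOn ℝ ∞ g (walls c)ᶜ ∧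
  ∃ (ρ : (Fin 4 → ℝ) → ℝ) (gc : (Fin 4 → ℝ) → (Fin 4 → ℝ) →L[ℝ] (Fin 4 → ℝ) →L[ℝ] ℝ),
    Continuous ρ ∧ ContDiff ℝ ∞ gc ∧
    (∀ a ∈ Λ, ∀ x, ρ (a + x) = ρ x ∧ gc (a + x) = gc x) ∧
    (∀ x, 0 ≤ ρ x ∧ (ρ x = 0 ↔ x ∈ walls c)) ∧
    (∀ x v w, gc x v w = gc x w v) ∧ (∀ x v, v ≠ 0 → 0 < gc x v v) ∧
    (∀ x ∉ walls c, gc x = ρ x ^ 2 • g x) ∧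
    (∀ p ∈ walls c, ∃ r : (Fin 4 → ℝ) → ℝ, ContDiffAt ℝ ∞ r p ∧
      (∀ᶠ x in 𝓝 p, ρ x = |r x|) ∧
      ∃ n : Fin 4 → ℝ, (∀ w, gc p n w = fderiv ℝ r p w) ∧ gc p n n = 1) ∧
    ∃ b : ℝ, 0 < b ∧ ∀ p ∈ walls c, ∀ v w : Fin 4 → ℝ, v 0 = 0 → w 0 = 0 →
      gc p v w = b * euclid4 v w

end Het

end

open scoped ContDiff Kronecker Topology ENNReal

noncomputable section

namespace Het

/-! ### Existence of the Weierstrass function -/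

/-! The geometry is that of a torus fibration over `ℝ⁴` whose curvature forms `de⁵`, `de⁶` are
anti-self-dual, hence of type (1,1) and primitive; rescaling the base conformally does not disturb
this. Therefore `J` is integrable. The forms `ē⁵`, `ē⁶` are `∇⁺`-parallel and the rest of `∇⁺` takes
values in the anti-self-dual `su(2) ⊂ su(3)`, so the constant spinor `vacuum` is parallel. All
connection forms of `A_λ` are multiples of `ē⁶`, so its curvature is a constant matrix times the
anti-self-dual form `dē⁶`, and it is an instanton.

Everything else is controlled by three functions: `p = ē₁(f)`, `A = t e^{-2f}` and `B = (t/s)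
e^{-2f}`. The connections are linear in them and the curvatures quadratic. They satisfy a closed
system of ordinary differential equations along `ē₁` with first integral `p² + 3A² + (3/2)B² = 1/α²`
(`IsDilaton`). This first integral lowers the degree of quartic expressions: `8π² p₁(∇⁻)` is `12(p²
+ 2A² + B²)(2p² + 6A² + 3B²) ē¹²³⁴`, its last factor is `2/α²`, and with the choice of `|λ|` the
anomaly equation becomes an identity between quadratic forms (`IsDilaton.anomalyForm_eq`). The
Einstein equation is compared component by component (`IsDilaton.einstein_eq`). Its remainder arises
because `∇⁻` is not an instanton: the pair symmetry between the curvatures of `∇⁺` and `∇⁻` fails by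
`dH = (α'/4) P`.

For `f = ½ ln(α² u)` the first integral is exactly `u'² = 4u(u - a)(u + a)`
(`IsPeriodPairFor.isDilaton`). A square lattice, for which `g₃ = 0`, supplies a `℘`-function with
this equation. On the real axis it stays above `a`, because it tends to `+∞` at the poles and the
cubic is negative on `(0, a)`.

The first integral also gives `|df| ≤ 1/α`. So `f` is bounded along Cauchy sequences, which cannot
reach the poles; with compactness of the nilmanifold this gives completeness
(`IsPeriodPairFor.isCompleteMetric`). The double pole of `℘` makes `1/√℘` a defining function of the
walls, and the compactified metric is the flat one. For the lattices, commutators of lifts fill out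
the centre (`span_fibreLattice`), so base and fibre are tori. For arbitrary `s` a lattice exists
after a rotation that gives each central direction a single structure constant. -/

/-- The square period pair `(c, ic)`. -/
def squarePair (c : ℝ) (hc : c ≠ 0) : PeriodPair where
  ω₁ := c
  ω₂ := c * Complex.I
  indep := by
    rw [LinearIndependent.pair_iff]
    intro a b h
    have h1 := congrArg Complex.re h
    have h2 := congrArg Complex.im h
    simp [hc] at h1 h2
    exact ⟨h1, h2⟩

theorem squarePair_G (c : ℝ) (hc : c ≠ 0) (n : ℕ) :
    (squarePair c hc).G n =
      ((c : ℂ) ^ n)⁻¹ * ∑' x : ℤ × ℤ, (((x.1 : ℂ) + x.2 * Complex.I) ^ n)⁻¹ := by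
  rw [PeriodPair.G, ← (squarePair c hc).latticeEquivProd.symm.toEquiv.tsum_eq, ← tsum_mul_left]
  refine tsum_congr fun x => ?_
  have h := (squarePair c hc).latticeEquiv_symm_apply x
  simp only [LinearEquiv.coe_toEquiv]
  rw [h, ← mul_inv, ← mul_pow]
  congr 2
  simp [squarePair]
  ring

/-- Multiplication by `i` permutes the Gaussian integers and `i⁶ = -1`, so the sum equals its own
negative. -/
theorem squarePair_G_six (c : ℝ) (hc : c ≠ 0) : (squarePair c hc).G 6 = 0 := by
  rw [squarePair_G]
  have h : ∑' x : ℤ × ℤ, (((x.1 : ℂ) + x.2 * Complex.I) ^ 6)⁻¹ =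
      -∑' x : ℤ × ℤ, (((x.1 : ℂ) + x.2 * Complex.I) ^ 6)⁻¹ := by
    let r : ℤ × ℤ ≃ ℤ × ℤ :=
      { toFun := fun x => (-x.2, x.1)
        invFun := fun x => (x.2, -x.1)
        left_inv := fun x => by simp
        right_inv := fun x => by simp }
    conv_lhs => rw [← r.tsum_eq]
    rw [← tsum_neg]
    refine tsum_congr fun x => ?_
    have h1 : (((r x).1 : ℤ) : ℂ) + ((r x).2 : ℤ) * Complex.I =
        Complex.I * ((x.1 : ℂ) + x.2 * Complex.I) := by
      simp only [r, Equiv.coe_fn_mk, Int.cast_neg]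
      linear_combination (-(x.2 : ℂ)) * Complex.I_sq
    have h2 : Complex.I ^ 6 = -1 := by
      rw [show (6 : ℕ) = 2 * 3 by norm_num, pow_mul, Complex.I_sq]; norm_num
    rw [h1, mul_pow, h2, neg_one_mul, inv_neg]
  rw [self_eq_neg.mp h, mul_zero]

/-- The Eisenstein sum of weight four over the Gaussian integers is positive. -/
theorem exists_gaussian_eisenstein_four : ∃ K : ℝ, 0 < K ∧
    ∑' x : ℤ × ℤ, (((x.1 : ℂ) + x.2 * Complex.I) ^ 4)⁻¹ = K := by
  -- The `q`-expansion at `τ = i`, where `q = e^{-2π}` is real and positive: every term is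
  -- nonnegative and the constant term `2ζ(4)` is positive.
  have h := tsum_eisSummand_eq_tsum_sigma_mul_cexp_pow (k := 4) (by norm_num)
    (by decide) UpperHalfPlane.I
  have hr : ∑' v, EisensteinSeries.eisSummand (4 : ℕ) v UpperHalfPlane.I =
      ∑' x : ℤ × ℤ, (((x.1 : ℂ) + x.2 * Complex.I) ^ 4)⁻¹ := by
    rw [← ((finTwoArrowEquiv ℤ).symm.tsum_eq), ← (Equiv.prodComm ℤ ℤ).tsum_eq]
    refine tsum_congr fun x => ?_
    simp [EisensteinSeries.eisSummand, zpow_neg, add_comm]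
  have hz : riemannZeta (4 : ℕ) = ((Real.pi ^ 4 / 90 : ℝ) : ℂ) := by
    have := riemannZeta_four
    push_cast
    simpa using this
  have hexp : ∀ n : ℕ+, ((ArithmeticFunction.sigma (4 - 1) n : ℕ) : ℂ) *
      Complex.exp (2 * Real.pi * Complex.I * (UpperHalfPlane.I : UpperHalfPlane)) ^ (n : ℕ) =
      (((ArithmeticFunction.sigma (4 - 1) n : ℕ) * Real.exp (-(2 * Real.pi)) ^ (n : ℕ) : ℝ) : ℂ) := by
    intro n
    push_cast
    congr 3
    linear_combination (2 * Real.pi : ℂ) * Complex.I_sq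
  rw [← hr, h, hz, tsum_congr hexp, ← Complex.ofReal_tsum]
  refine ⟨2 * (Real.pi ^ 4 / 90) + 2 * ((2 * Real.pi) ^ 4 / 6) * ∑' n : ℕ+,
    ((ArithmeticFunction.sigma (4 - 1) n : ℕ) * Real.exp (-(2 * Real.pi)) ^ (n : ℕ) : ℝ), ?_, ?_⟩
  · have : 0 ≤ ∑' n : ℕ+,
        ((ArithmeticFunction.sigma (4 - 1) n : ℕ) * Real.exp (-(2 * Real.pi)) ^ (n : ℕ) : ℝ) :=
      tsum_nonneg fun n => by positivity
    have := Real.pi_pos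
    positivity
  · have hI : (-2 * (Real.pi : ℂ) * Complex.I) ^ 4 = (2 * Real.pi) ^ 4 := by
      linear_combination (16 * (Real.pi : ℂ) ^ 4) * Complex.I_pow_four
    push_cast
    rw [hI]
    norm_num [Nat.factorial]

/-- On the square lattice `g₃ = 0`, so the cubic is the required one when `g₂ = 4a²`. Since `g₂ =
60K/c⁴`, this forces `c⁴ = 15K/a²`. -/
theorem exists_isPeriodPairFor {a : ℝ} (ha : 0 < a) : ∃ L : PeriodPair, IsPeriodPairFor L a := by
  obtain ⟨K, hK, hsum⟩ := exists_gaussian_eisenstein_four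
  set c := √√(15 * K / a ^ 2) with hc
  have hpos : 0 < 15 * K / a ^ 2 := by positivity
  have hc0 : 0 < c := Real.sqrt_pos.mpr (Real.sqrt_pos.mpr hpos)
  have hc4 : c ^ 4 = 15 * K / a ^ 2 := by
    rw [show c ^ 4 = (c ^ 2) ^ 2 by ring, hc, Real.sq_sqrt (Real.sqrt_nonneg _),
      Real.sq_sqrt hpos.le]
  refine ⟨squarePair c hc0.ne', ?_, ?_, ?_, ?_, ?_⟩
  · simpa [squarePair] using hc0
  · simp [squarePair]
  · simp [squarePair]
  · simpa [squarePair] using hc0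
  · intro z hz
    rw [PeriodPair.deriv_weierstrassP, PeriodPair.derivWeierstrassP_sq _ _ hz, PeriodPair.g₂,
      PeriodPair.g₃, squarePair_G_six, squarePair_G, hsum, ← Complex.ofReal_pow, hc4]
    have ha' : (a : ℂ) ≠ 0 := by exact_mod_cast ha.ne'
    have hK' : (K : ℂ) ≠ 0 := by exact_mod_cast hK.ne'
    push_cast
    field_simp
    ring

/-! ### The real slice of the Weierstrass function -/

namespace IsPeriodPairFor

variable {L : PeriodPair} {a : ℝ}

theorem ofReal_re_ω₁ (hL : IsPeriodPairFor L a) : ((L.ω₁.re : ℝ) : ℂ) = L.ω₁ :=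
  Complex.ext (by simp) (by simp [hL.im_eq])

theorem conj_mem_lattice (hL : IsPeriodPairFor L a) {z : ℂ} (hz : z ∈ L.lattice) :
    (starRingEnd ℂ) z ∈ L.lattice := by
  obtain ⟨m, n, rfl⟩ := PeriodPair.mem_lattice.mp hz
  have h1 : (starRingEnd ℂ) L.ω₁ = L.ω₁ := Complex.ext (by simp) (by simp [hL.im_eq])
  have h2 : (starRingEnd ℂ) L.ω₂ = -L.ω₂ := Complex.ext (by simp [hL.re_eq]) (by simp)
  refine PeriodPair.mem_lattice.mpr ⟨m, -n, ?_⟩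
  simp [h1, h2]

theorem ofReal_mem_lattice (hL : IsPeriodPairFor L a) {r : ℝ} :
    (r : ℂ) ∈ L.lattice ↔ ∃ n : ℤ, r = n * L.ω₁.re := by
  rw [PeriodPair.mem_lattice]
  constructor
  · rintro ⟨m, n, h⟩
    have h1 := congrArg Complex.re h
    simp [hL.re_eq] at h1
    exact ⟨m, h1.symm⟩
  · rintro ⟨n, rfl⟩
    refine ⟨n, 0, ?_⟩
    rw [← hL.ofReal_re_ω₁]
    simp

theorem ofReal_notMem_lattice (hL : IsPeriodPairFor L a) {r : ℝ} (hr : ∀ n : ℤ, r ≠ n * L.ω₁.re) :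
    (r : ℂ) ∉ L.lattice := fun h => by
  obtain ⟨n, hn⟩ := hL.ofReal_mem_lattice.mp h
  exact hr n hn

/-- The lattice is stable under conjugation because `ω₁` is real and `ω₂` imaginary, so conjugation
only permutes the terms of the series. -/
theorem weierstrassP_conj (hL : IsPeriodPairFor L a) (z : ℂ) :
    L.weierstrassP ((starRingEnd ℂ) z) = (starRingEnd ℂ) (L.weierstrassP z) := by
  let c : L.lattice ≃ L.lattice :=
    { toFun := fun l => ⟨(starRingEnd ℂ) l, hL.conj_mem_lattice l.2⟩
      invFun := fun l => ⟨(starRingEnd ℂ) l, hL.conj_mem_lattice l.2⟩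
      left_inv := fun l => by simp
      right_inv := fun l => by simp }
  rw [PeriodPair.weierstrassP, PeriodPair.weierstrassP, Complex.conj_tsum, ← c.tsum_eq]
  refine tsum_congr fun l => ?_
  simp [c]

theorem weierstrassP_ofReal (hL : IsPeriodPairFor L a) (r : ℝ) :
    L.weierstrassP r = (realSlice L r : ℂ) := by
  have h := hL.weierstrassP_conj r
  rw [Complex.conj_ofReal] at h
  exact (Complex.conj_eq_iff_re.mp h.symm).symm

theorem realSlice_add_period (hL : IsPeriodPairFor L a) (r : ℝ) (n : ℤ) :
    realSlice L (n * L.ω₁.re + r) = realSlice L r := by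
  have hm : ((n * L.ω₁.re : ℝ) : ℂ) ∈ L.lattice := hL.ofReal_mem_lattice.mpr ⟨n, rfl⟩
  have h := L.weierstrassP_add_coe r ⟨_, hm⟩
  simp only [realSlice]
  rw [← h, add_comm, Complex.ofReal_add]

theorem eventually_notMem_lattice (hL : IsPeriodPairFor L a) {r : ℝ}
    (hr : ∀ n : ℤ, r ≠ n * L.ω₁.re) : ∀ᶠ y in 𝓝 r, ∀ n : ℤ, y ≠ n * L.ω₁.re := by
  have h : ∀ᶠ y : ℝ in 𝓝 r, (y : ℂ) ∉ L.lattice :=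
    Complex.continuous_ofReal.continuousAt.eventually
      (L.isClosed_lattice.isOpen_compl.mem_nhds (hL.ofReal_notMem_lattice hr))
  filter_upwards [h] with y hy n hn
  exact hy (hL.ofReal_mem_lattice.mpr ⟨n, hn⟩)

end IsPeriodPairFor

/-- The derivative of the real slice. -/
def realSliceDeriv (L : PeriodPair) (x : ℝ) : ℝ := (L.derivWeierstrassP (x : ℂ)).re

theorem hasDerivAt_weierstrassP (L : PeriodPair) {z : ℂ} (hz : z ∉ L.lattice) :
    HasDerivAt L.weierstrassP (L.derivWeierstrassP z) z := by
  have h := (L.differentiableOn_weierstrassP.differentiableAt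
    (L.isClosed_lattice.isOpen_compl.mem_nhds hz)).hasDerivAt
  rwa [L.deriv_weierstrassP] at h

/-- The triple pole excludes it: otherwise `z³` times the part of `℘'` regular at `0` would be
identically `2` near `0`, yet it tends to `0`. -/
theorem not_eqOn_derivWeierstrassP_zero (L : PeriodPair) :
    ¬ Set.EqOn L.derivWeierstrassP 0 (L.lattice : Set ℂ)ᶜ := by
  intro h
  have h1 : ∀ᶠ z in 𝓝[≠] (0 : ℂ), L.derivWeierstrassPExcept 0 z * z ^ 3 = 2 := by
    filter_upwards [self_mem_nhdsWithin, mem_nhdsWithin_of_mem_nhds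
      (L.compl_lattice_sdiff_singleton_mem_nhds 0)] with z hz hz'
    have hz0 : z ≠ 0 := hz
    have hzL : z ∉ L.lattice := fun hm => hz' ⟨hm, hz0⟩
    have h2 := L.derivWeierstrassPExcept_sub 0 z
    rw [h hzL] at h2
    simp only [ZeroMemClass.coe_zero, sub_zero, Pi.zero_apply] at h2
    rw [sub_eq_zero.mp h2]
    field_simp
  have hc : Filter.Tendsto (fun z => L.derivWeierstrassPExcept 0 z * z ^ 3) (𝓝[≠] 0) (𝓝 0) := by
    have : ContinuousAt (fun z => L.derivWeierstrassPExcept 0 z * z ^ 3) 0 :=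
      (L.analyticAt_derivWeierstrassPExcept 0).continuousAt.mul (by fun_prop)
    simpa [ContinuousAt] using this.tendsto.mono_left nhdsWithin_le_nhds
  have h2 := tendsto_nhds_unique (hc.congr' h1) tendsto_const_nhds
  norm_num at h2

namespace IsPeriodPairFor

variable {L : PeriodPair} {a : ℝ}

/-- Differentiating the cubic equation gives the claim multiplied by `℘'`. The factor cancels off
the zeros of `℘'`; these are isolated, and both sides are continuous. -/
theorem deriv_derivWeierstrassP (hL : IsPeriodPairFor L a) {z : ℂ} (hz : z ∉ L.lattice) :
    deriv L.derivWeierstrassP z = 6 * L.weierstrassP z ^ 2 - 2 * a ^ 2 := by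
  have hopen := L.isClosed_lattice.isOpen_compl
  have hA := L.analyticOnNhd_derivWeierstrassP
  have hmul : ∀ w ∉ L.lattice, L.derivWeierstrassP w * deriv L.derivWeierstrassP w =
      L.derivWeierstrassP w * (6 * L.weierstrassP w ^ 2 - 2 * a ^ 2) := by
    intro w hw
    have h1 := (hasDerivAt_weierstrassP L hw)
    have h2 := (hA w hw).differentiableAt.hasDerivAt
    have h3 : (fun y => L.derivWeierstrassP y ^ 2) =ᶠ[𝓝 w]
        fun y => 4 * (L.weierstrassP y * (L.weierstrassP y * L.weierstrassP y)) -
          4 * a ^ 2 * L.weierstrassP y := by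
      filter_upwards [hopen.mem_nhds hw] with y hy
      have := hL.ode y hy
      rw [L.deriv_weierstrassP] at this
      rw [this]; ring
    have h4 := (h2.fun_pow 2).congr_of_eventuallyEq h3.symm
    have h5 := ((h1.fun_mul (h1.fun_mul h1)).const_mul 4).fun_sub (h1.const_mul (4 * (a : ℂ) ^ 2))
    have h6 := h4.unique h5
    simp only [Nat.cast_ofNat, Nat.reduceSub, pow_one] at h6
    linear_combination h6 / 2
  rcases (hA z hz).eventually_eq_zero_or_eventually_ne_zero with h | h
  · refine absurd ?_ (not_eqOn_derivWeierstrassP_zero L)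
    refine hA.eqOn_zero_of_preconnected_of_eventuallyEq_zero ?_ hz h
    -- The complement of the countable lattice is connected, so the identity theorem turns local
    -- vanishing of `℘'` into global vanishing.
    refine (Set.Countable.isConnected_compl_of_one_lt_rank ?_ ?_).isPreconnected
    · simp
    · have : Countable L.lattice := L.latticeEquivProd.toEquiv.countable_iff.mpr inferInstance
      exact Set.to_countable _
  · have h1 : ContinuousAt (deriv L.derivWeierstrassP) z := (hA z hz).deriv.continuousAt
    have h2 : ContinuousAt (fun w => 6 * L.weierstrassP w ^ 2 - 2 * (a : ℂ) ^ 2) z := by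
      have := (hasDerivAt_weierstrassP L hz).continuousAt
      fun_prop
    refine tendsto_nhds_unique (h1.tendsto.mono_left nhdsWithin_le_nhds)
      ((h2.tendsto.mono_left nhdsWithin_le_nhds).congr' ?_) (l := 𝓝[≠] z)
    filter_upwards [h, mem_nhdsWithin_of_mem_nhds (hopen.mem_nhds hz)] with w hw hw'
    exact (mul_left_cancel₀ hw (hmul w hw')).symm

theorem hasDerivAt_realSlice (hL : IsPeriodPairFor L a) {r : ℝ}
    (hr : ∀ n : ℤ, r ≠ n * L.ω₁.re) : HasDerivAt (realSlice L) (realSliceDeriv L r) r :=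
  (hasDerivAt_weierstrassP L (hL.ofReal_notMem_lattice hr)).real_of_complex

theorem derivWeierstrassP_ofReal (hL : IsPeriodPairFor L a) {r : ℝ}
    (hr : ∀ n : ℤ, r ≠ n * L.ω₁.re) : L.derivWeierstrassP r = (realSliceDeriv L r : ℂ) := by
  have h1 := (hasDerivAt_weierstrassP L (hL.ofReal_notMem_lattice hr)).comp_ofReal
  have h2 := (hL.hasDerivAt_realSlice hr).ofReal_comp
  have h3 : (fun y : ℝ => ((realSlice L y : ℝ) : ℂ)) = fun y : ℝ => L.weierstrassP y :=
    funext fun y => (hL.weierstrassP_ofReal y).symm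
  rw [h3] at h2
  exact h1.unique h2

theorem realSliceDeriv_sq (hL : IsPeriodPairFor L a) {r : ℝ}
    (hr : ∀ n : ℤ, r ≠ n * L.ω₁.re) :
    realSliceDeriv L r ^ 2 = 4 * realSlice L r * (realSlice L r - a) * (realSlice L r + a) := by
  have h := hL.ode r (hL.ofReal_notMem_lattice hr)
  rw [L.deriv_weierstrassP, hL.derivWeierstrassP_ofReal hr, hL.weierstrassP_ofReal] at h
  exact_mod_cast h

theorem hasDerivAt_realSliceDeriv (hL : IsPeriodPairFor L a) {r : ℝ}
    (hr : ∀ n : ℤ, r ≠ n * L.ω₁.re) :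
    HasDerivAt (realSliceDeriv L) (6 * realSlice L r ^ 2 - 2 * a ^ 2) r := by
  have hz := hL.ofReal_notMem_lattice hr
  have h := ((L.analyticOnNhd_derivWeierstrassP _ hz).differentiableAt.hasDerivAt).real_of_complex
  rw [hL.deriv_derivWeierstrassP hz, hL.weierstrassP_ofReal,
    show 6 * (realSlice L r : ℂ) ^ 2 - 2 * (a : ℂ) ^ 2 =
      ((6 * realSlice L r ^ 2 - 2 * a ^ 2 : ℝ) : ℂ) by push_cast; ring, Complex.ofReal_re] at h
  exact h

theorem contDiffAt_realSlice (hL : IsPeriodPairFor L a) {r : ℝ}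
    (hr : ∀ n : ℤ, r ≠ n * L.ω₁.re) : ContDiffAt ℝ ∞ (realSlice L) r := by
  have h := (L.analyticOnNhd_weierstrassP _ (hL.ofReal_notMem_lattice hr)).contDiffAt (n := ∞)
  have h1 : ContDiffAt ℝ ∞ L.weierstrassP (r : ℂ) := h.restrict_scalars ℝ
  exact Complex.reCLM.contDiff.contDiffAt.comp r
    (h1.comp r Complex.ofRealCLM.contDiff.contDiffAt)

end IsPeriodPairFor

/-- Near the pole `0` the real slice is `x⁻²` times a smooth function with value `1` at `0`. -/
theorem exists_realSlice_mul_sq (L : PeriodPair) : ∃ h : ℝ → ℝ, ContDiffAt ℝ ∞ h 0 ∧ h 0 = 1 ∧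
    ∀ x ≠ 0, realSlice L x * x ^ 2 = h x := by
  refine ⟨fun x => ((x : ℂ) ^ 2 * L.weierstrassPExcept 0 x + 1).re, ?_, by simp, ?_⟩
  · have h1 : ContDiffAt ℝ ∞ (fun z : ℂ => z ^ 2 * L.weierstrassPExcept 0 z + 1) ((0 : ℝ) : ℂ) := by
      have h2 : ContDiffAt ℂ ∞ (L.weierstrassPExcept 0) ((0 : ℝ) : ℂ) := by
        simpa using (L.analyticAt_weierstrassPExcept 0).contDiffAt (n := ∞)
      have h3 : ContDiffAt ℂ ∞ (fun z : ℂ => z ^ 2 * L.weierstrassPExcept 0 z + 1) ((0 : ℝ) : ℂ) :=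
        (contDiffAt_id.pow 2 |>.mul h2).add contDiffAt_const
      exact h3.restrict_scalars ℝ
    exact Complex.reCLM.contDiff.contDiffAt.comp (0 : ℝ)
      (h1.comp (0 : ℝ) Complex.ofRealCLM.contDiff.contDiffAt)
  · intro x hx
    have h := L.ite_eq_one_sub_sq_mul_weierstrassP 0 (zero_mem _) x
    rw [if_neg (by exact_mod_cast hx)] at h
    simp only [sub_zero, ne_eq, OfNat.ofNat_ne_zero, not_false_eq_true, zero_pow, div_zero] at h
    simp only
    rw [← h, realSlice, ← Complex.ofReal_pow, Complex.re_ofReal_mul, mul_comm]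

theorem tendsto_realSlice_zero (L : PeriodPair) :
    Filter.Tendsto (realSlice L) (𝓝[≠] 0) Filter.atTop := by
  obtain ⟨h, hc, h0, hx⟩ := exists_realSlice_mul_sq L
  have h1 : Filter.Tendsto h (𝓝[≠] 0) (𝓝 1) := by
    simpa [h0] using hc.continuousAt.tendsto.mono_left nhdsWithin_le_nhds
  have h2 : Filter.Tendsto (fun x : ℝ => (x ^ 2)⁻¹) (𝓝[≠] 0) Filter.atTop := by
    refine Filter.Tendsto.inv_tendsto_nhdsGT_zero (f := fun x : ℝ => x ^ 2) ?_
    refine tendsto_nhdsWithin_iff.mpr ⟨?_, ?_⟩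
    · have : ContinuousAt (fun x : ℝ => x ^ 2) 0 := by fun_prop
      simpa [ContinuousAt] using this.tendsto.mono_left nhdsWithin_le_nhds
    · filter_upwards [self_mem_nhdsWithin] with x hx
      have hx' : x ≠ 0 := hx
      exact Set.mem_Ioi.mpr (by positivity)
  refine (h1.pos_mul_atTop one_pos h2).congr' ?_
  filter_upwards [self_mem_nhdsWithin] with x hx'
  have hx0 : x ≠ 0 := hx'
  rw [← hx x hx0]
  field_simp

namespace IsPeriodPairFor

variable {L : PeriodPair} {a : ℝ}

/-- Every point off the poles is a translate of a point of the first period interval. -/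
theorem exists_translate_mem_Ioo (hL : IsPeriodPairFor L a) {r : ℝ}
    (hr : ∀ n : ℤ, r ≠ n * L.ω₁.re) :
    ∃ n : ℤ, ∃ r₀ ∈ Set.Ioo 0 L.ω₁.re, r = n * L.ω₁.re + r₀ := by
  have hω := hL.re_pos
  refine ⟨⌊r / L.ω₁.re⌋, r - ⌊r / L.ω₁.re⌋ * L.ω₁.re, ⟨?_, ?_⟩, by ring⟩
  · have h1 := (le_div_iff₀ hω).mp (Int.floor_le (r / L.ω₁.re))
    exact sub_pos.mpr (lt_of_le_of_ne h1 (hr _).symm)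
  · have h1 := (div_lt_iff₀ hω).mp (Int.lt_floor_add_one (r / L.ω₁.re))
    linarith

theorem ne_of_mem_Ioo (hL : IsPeriodPairFor L a) {r : ℝ} (hr : r ∈ Set.Ioo 0 L.ω₁.re) (n : ℤ) :
    r ≠ n * L.ω₁.re := by
  have hω := hL.re_pos
  rintro rfl
  have h1 : (0 : ℝ) < n := pos_of_mul_pos_left hr.1 hω.le
  have h2 : (n : ℝ) < 1 := by
    by_contra h
    nlinarith [hr.2, not_lt.mp h]
  have h3 : 0 < n := by exact_mod_cast h1
  have h4 : n < 1 := by exact_mod_cast h2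
  omega

/-- Since `u(u - a)(u + a) = u'²/4 ≥ 0`, the values of `u` lie in `[-a, 0] ∪ [a, ∞)`. On the
connected period interval `u` is large near `0`, so it stays in the upper component: a passage to
the lower one would attain `a/2`. -/
theorem le_realSlice (hL : IsPeriodPairFor L a) (ha : 0 < a) {r : ℝ}
    (hr : ∀ n : ℤ, r ≠ n * L.ω₁.re) : a ≤ realSlice L r := by
  have hω := hL.re_pos
  have key : ∀ x, (∀ n : ℤ, x ≠ n * L.ω₁.re) →
      0 ≤ realSlice L x * (realSlice L x - a) * (realSlice L x + a) := fun x hx => by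
    nlinarith [hL.realSliceDeriv_sq hx, sq_nonneg (realSliceDeriv L x)]
  obtain ⟨n, r₀, hr₀, rfl⟩ := hL.exists_translate_mem_Ioo hr
  rw [hL.realSlice_add_period]
  by_contra hlt
  have hlt' := not_le.mp hlt
  have hcont : ContinuousOn (realSlice L) (Set.Ioo 0 L.ω₁.re) := fun x hx =>
    (hL.hasDerivAt_realSlice (hL.ne_of_mem_Ioo hx)).continuousAt.continuousWithinAt
  obtain ⟨y, hy, hya⟩ : ∃ y ∈ Set.Ioo 0 L.ω₁.re, a < realSlice L y := by
    have h1 : ∀ᶠ x in 𝓝[>] (0 : ℝ), a < realSlice L x :=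
      ((tendsto_realSlice_zero L).mono_left
        (nhdsWithin_mono 0 fun x (hx : 0 < x) => hx.ne')).eventually_gt_atTop a
    obtain ⟨y, hy1, hy2⟩ := (h1.and (Ioo_mem_nhdsGT hω)).exists
    exact ⟨y, hy2, hy1⟩
  have hsmall : realSlice L r₀ ≤ 0 := by
    have := key r₀ (hL.ne_of_mem_Ioo hr₀)
    by_contra hp
    have hp' := not_le.mp hp
    have : realSlice L r₀ * (realSlice L r₀ - a) * (realSlice L r₀ + a) < 0 :=
      mul_neg_of_neg_of_pos (mul_neg_of_pos_of_neg hp' (by linarith)) (by linarith)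
    linarith
  obtain ⟨z, hz, hza⟩ := isPreconnected_Ioo.intermediate_value hr₀ hy hcont
    (show a / 2 ∈ Set.Icc _ _ from ⟨by linarith, by linarith⟩)
  have := key z (hL.ne_of_mem_Ioo hz)
  rw [hza] at this
  nlinarith [pow_pos ha 3]

end IsPeriodPairFor

end Het
end

noncomputable section

namespace Het

/-! ### Calculus of differential forms -/

theorem wedge_two_apply (α β : V6 →L[ℝ] ℝ) (v : Fin 2 → V6) :
    wedge ![α, β] v = α (v 0) * β (v 1) - α (v 1) * β (v 0) := by
  rw [wedge_apply, Matrix.det_fin_two]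
  simp; ring

theorem wedge_three_apply (α β γ : V6 →L[ℝ] ℝ) (v : Fin 3 → V6) :
    wedge ![α, β, γ] v = α (v 0) * (β (v 1) * γ (v 2) - β (v 2) * γ (v 1))
      - α (v 1) * (β (v 0) * γ (v 2) - β (v 2) * γ (v 0))
      + α (v 2) * (β (v 0) * γ (v 1) - β (v 1) * γ (v 0)) := by
  rw [wedge_apply, Matrix.det_fin_three]
  simp; ring

theorem wedge_four_apply (α β γ δ : V6 →L[ℝ] ℝ) (v : Fin 4 → V6) :
    wedge ![α, β, γ, δ] v = wedge22 (wedge ![α, β]) (wedge ![γ, δ]) v := by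
  rw [wedge_apply, Matrix.det_succ_row_zero]
  simp [Fin.sum_univ_four, Matrix.det_fin_three, wedge22, wedge_two_apply, Fin.succAbove,
    Matrix.submatrix_apply]
  ring

/-- A field of forms is differentiable if all its evaluations are. -/
theorem differentiableAt_form {k : ℕ} {η : Form k} {x : V6}
    (h : ∀ v, DifferentiableAt ℝ (fun y => η y v) x) : DifferentiableAt ℝ η x := by
  let b : Fin 6 → V6 := fun i => Pi.single i 1
  let ev : (V6 [⋀^Fin k]→L[ℝ] ℝ) →ₗ[ℝ] ((Fin k → Fin 6) → ℝ) :=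
    { toFun := fun θ I => θ fun a => b (I a)
      map_add' := fun _ _ => rfl
      map_smul' := fun _ _ => rfl }
  have hinj : Function.Injective ev := by
    intro θ ζ hθ
    apply ContinuousAlternatingMap.toAlternatingMap_injective
    refine Module.Basis.ext_alternating (Pi.basisFun ℝ (Fin 6)) fun I _ => ?_
    have := congrFun hθ I
    simpa [ev, b] using this
  -- A form is recovered linearly from its finitely many values on basis vectors, so
  -- differentiability of those values suffices.
  obtain ⟨g, hg⟩ := ev.exists_leftInverse_of_injective (LinearMap.ker_eq_bot.mpr hinj)
  have heq : η = fun y => LinearMap.toContinuousLinearMap g (ev (η y)) := by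
    funext y
    exact (LinearMap.congr_fun hg (η y)).symm
  rw [heq]
  refine (LinearMap.toContinuousLinearMap g).differentiableAt.comp x ?_
  exact differentiableAt_pi.mpr fun I => h _

theorem differentiableAt_eval {η : OneForm} {x : V6} (h : DifferentiableAt ℝ η x) (a : V6) :
    DifferentiableAt ℝ (fun y => η y a) x := h.clm_apply (differentiableAt_const a)

theorem differentiableAt_wedge_two {α β : OneForm} {x : V6} (hα : DifferentiableAt ℝ α x)
    (hβ : DifferentiableAt ℝ β x) : DifferentiableAt ℝ (fun y => wedge ![α y, β y]) x := by
  refine differentiableAt_form fun v => ?_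
  simp only [wedge_two_apply]
  have h1 := differentiableAt_eval hα
  have h2 := differentiableAt_eval hβ
  exact ((h1 _).mul (h2 _)).sub ((h1 _).mul (h2 _))

theorem differentiableAt_smul_wedge_three {g : V6 → ℝ} {α β γ : OneForm} {x : V6}
    (hg : DifferentiableAt ℝ g x) (hα : DifferentiableAt ℝ α x) (hβ : DifferentiableAt ℝ β x)
    (hγ : DifferentiableAt ℝ γ x) :
    DifferentiableAt ℝ (fun y => g y • wedge ![α y, β y, γ y]) x := by
  refine differentiableAt_form fun v => ?_
  simp only [ContinuousAlternatingMap.smul_apply, wedge_three_apply]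
  have h1 := differentiableAt_eval hα
  have h2 := differentiableAt_eval hβ
  have h3 := differentiableAt_eval hγ
  have h4 (a b : V6) := ((h2 a).mul (h3 b)).sub ((h2 b).mul (h3 a))
  exact hg.smul ((((h1 _).mul (h4 _ _)).sub ((h1 _).mul (h4 _ _))).add ((h1 _).mul (h4 _ _)))

theorem extDeriv_wedge_two {α β : OneForm} {x : V6} (hα : DifferentiableAt ℝ α x)
    (hβ : DifferentiableAt ℝ β x) (u v w : V6) :
    extDeriv (fun y => wedge ![α y, β y]) x ![u, v, w] =
      (d1 α x ![u, v] * β x w - d1 α x ![u, w] * β x v + d1 α x ![v, w] * β x u)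
      - (d1 β x ![u, v] * α x w - d1 β x ![u, w] * α x v + d1 β x ![v, w] * α x u) := by
  rw [extDeriv_apply (differentiableAt_wedge_two hα hβ)]
  have hc (a b : V6) : HasFDerivAt (fun y => α y a * β y b - α y b * β y a) _ x :=
    ((hα.hasFDerivAt.clm_apply (hasFDerivAt_const a x)).mul
      (hβ.hasFDerivAt.clm_apply (hasFDerivAt_const b x))).sub
    ((hα.hasFDerivAt.clm_apply (hasFDerivAt_const b x)).mul
      (hβ.hasFDerivAt.clm_apply (hasFDerivAt_const a x)))
  rw [Fin.sum_univ_three]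
  simp only [wedge_two_apply]
  rw [(hc _ _).fderiv, (hc _ _).fderiv, (hc _ _).fderiv]
  simp [d1_apply hα, d1_apply hβ, Fin.removeNth, Fin.succAbove]
  ring

theorem extDeriv_smul_wedge_three {g : V6 → ℝ} {α β γ : OneForm} {x : V6}
    (hg : DifferentiableAt ℝ g x) (hα : DifferentiableAt ℝ α x) (hβ : DifferentiableAt ℝ β x)
    (hγ : DifferentiableAt ℝ γ x) (v : Fin 4 → V6) :
    extDeriv (fun y => g y • wedge ![α y, β y, γ y]) x v =
      wedge ![fderiv ℝ g x, α x, β x, γ x] v + g x *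
        (wedge22 (d1 α x) (wedge ![β x, γ x]) v - wedge22 (d1 β x) (wedge ![α x, γ x]) v
          + wedge22 (d1 γ x) (wedge ![α x, β x]) v) := by
  rw [extDeriv_apply (differentiableAt_smul_wedge_three hg hα hβ hγ)]
  have h1 (η : OneForm) (hη : DifferentiableAt ℝ η x) (a : V6) :
      HasFDerivAt (fun y => η y a) ((fderiv ℝ η x).flip a) x := by
    exact (hη.hasFDerivAt.clm_apply (hasFDerivAt_const a x)).congr_fderiv (by ext; simp)
  have hc (a b c : V6) : HasFDerivAt (fun y => g y • (α y a * (β y b * γ y c - β y c * γ y b)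
      - α y b * (β y a * γ y c - β y c * γ y a) + α y c * (β y a * γ y b - β y b * γ y a))) _ x :=
    hg.hasFDerivAt.smul
    ((((h1 α hα a).mul (((h1 β hβ b).mul (h1 γ hγ c)).sub ((h1 β hβ c).mul (h1 γ hγ b)))).sub
    ((h1 α hα b).mul (((h1 β hβ a).mul (h1 γ hγ c)).sub ((h1 β hβ c).mul (h1 γ hγ a))))).add
    ((h1 α hα c).mul (((h1 β hβ a).mul (h1 γ hγ b)).sub ((h1 β hβ b).mul (h1 γ hγ a)))))
  rw [Fin.sum_univ_four]
  simp only [ContinuousAlternatingMap.smul_apply, wedge_three_apply]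
  rw [(hc _ _ _).fderiv, (hc _ _ _).fderiv, (hc _ _ _).fderiv, (hc _ _ _).fderiv]
  simp [d1_apply hα, d1_apply hβ, d1_apply hγ, Fin.removeNth, Fin.succAbove, wedge22,
    wedge_four_apply, wedge_two_apply]
  ring

/-! ### Dilatons -/

/-- The function `t e^{-2f}`. -/
def fluxA (t : ℝ) (f : V6 → ℝ) (x : V6) : ℝ := t * Real.exp (-2 * f x)

/-- The function `(t/s) e^{-2f}`. -/
def fluxB (s t : ℝ) (f : V6 → ℝ) (x : V6) : ℝ := t / s * Real.exp (-2 * f x)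

/-- The differential equations of the dilaton `f = f(x¹)`, where `p` is the derivative of `f` along
the unit vector field `ē₁`. -/
structure IsDilaton (s t α : ℝ) (f p : V6 → ℝ) (U : Set V6) : Prop where
  isOpen : IsOpen U
  hasFDerivAt : ∀ x ∈ U, HasFDerivAt f (p x • (barFrame s t f).co 0 x) x
  hasFDerivAt_deriv : ∀ x ∈ U, HasFDerivAt p
    ((6 * fluxA t f x ^ 2 + 3 * fluxB s t f x ^ 2) • (barFrame s t f).co 0 x) x
  -- A first integral of the system: along `ē₁` the derivative of the bracket is `2p(6A² + 3B²) -
  -- 12pA² - 6pB² = 0`. The equation fixes its value.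
  norm_sq : ∀ x ∈ U, α ^ 2 * (p x ^ 2 + 3 * fluxA t f x ^ 2 + 3 / 2 * fluxB s t f x ^ 2) = 1

section

variable {s t α : ℝ} {f p : V6 → ℝ} {U : Set V6}

theorem barFrame_vec_sum (x v : V6) :
    ∑ i, (barFrame s t f).co i x v • (barFrame s t f).vec i x = v := by
  have hf : Real.exp (f x) ≠ 0 := Real.exp_ne_zero _
  funext j
  fin_cases j <;> simp [barFrame, weight, e, eVec, Fin.sum_univ_six] <;> field_simp <;> ring

theorem IsDilaton.hasFDerivAt_fluxA (h : IsDilaton s t α f p U) {x : V6} (hx : x ∈ U) :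
    HasFDerivAt (fluxA t f) ((-2 * p x * fluxA t f x) • (barFrame s t f).co 0 x) x := by
  refine ((((h.hasFDerivAt x hx).const_mul (-2)).exp).const_mul t).congr_fderiv ?_
  ext v
  simp [fluxA]
  ring

theorem IsDilaton.hasFDerivAt_fluxB (h : IsDilaton s t α f p U) {x : V6} (hx : x ∈ U) :
    HasFDerivAt (fluxB s t f) ((-2 * p x * fluxB s t f x) • (barFrame s t f).co 0 x) x := by
  refine ((((h.hasFDerivAt x hx).const_mul (-2)).exp).const_mul (t / s)).congr_fderiv ?_
  ext v
  simp [fluxB]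
  ring

theorem differentiable_e (i : Fin 6) : Differentiable ℝ (e s t i) := by
  fin_cases i <;> simp [e] <;> fun_prop

theorem IsDilaton.differentiableAt_co (h : IsDilaton s t α f p U) {x : V6} (hx : x ∈ U)
    (i : Fin 6) : DifferentiableAt ℝ ((barFrame s t f).co i) x := by
  have hf := (h.hasFDerivAt x hx).differentiableAt
  have hw : DifferentiableAt ℝ (weight f i) x := by
    unfold weight
    split_ifs <;> fun_prop
  exact hw.smul (differentiable_e i x)

/-- The value of `dē^i` on two vectors with components `a` and `b`. -/
def dCoframe (p A B : ℝ) (a b : Fin 6 → ℝ) : Fin 6 → ℝ :=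
  ![0, p * (a 0 * b 1 - b 0 * a 1), p * (a 0 * b 2 - b 0 * a 2), p * (a 0 * b 3 - b 0 * a 3),
    B * ((a 0 * b 2 - b 0 * a 2) + (a 1 * b 3 - b 1 * a 3)),
    -2 * A * ((a 0 * b 1 - b 0 * a 1) - (a 2 * b 3 - b 2 * a 3))
      - B * ((a 0 * b 3 - b 0 * a 3) - (a 1 * b 2 - b 1 * a 2))]

theorem IsDilaton.d1_co (h : IsDilaton s t α f p U) {x : V6} (hx : x ∈ U) (i : Fin 6) (v w : V6) :
    d1 ((barFrame s t f).co i) x ![v, w] = dCoframe (p x) (fluxA t f x) (fluxB s t f x)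
      (fun a => (barFrame s t f).co a x v) (fun a => (barFrame s t f).co a x w) i := by
  -- A horizontal 2-form carries weight `e^{2f}` in the new coframe; this turns `t` and `t/s` into
  -- `A` and `B`.
  have hE : Real.exp (f x) * Real.exp (f x) * Real.exp (-(2 * f x)) = 1 := by
    rw [← Real.exp_add, ← Real.exp_add]
    ring_nf
    exact Real.exp_zero
  have hlow (j : Fin 6) (hj : j < 4) (l : V6 →L[ℝ] ℝ) (hl : e s t j = fun _ => l) :
      d1 ((barFrame s t f).co j) x ![v, w] = p x *
        ((barFrame s t f).co 0 x v * (Real.exp (f x) * l w)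
          - (barFrame s t f).co 0 x w * (Real.exp (f x) * l v)) := by
    have h1 : (barFrame s t f).co j = fun y => Real.exp (f y) • l := by
      funext y; simp [barFrame, weight, hj, hl]
    have h2 := (h.hasFDerivAt x hx).exp.smul_const l
    rw [d1_apply (h.differentiableAt_co hx j), h1, h2.fderiv]
    simp
    ring
  have hs := e_structure s t x
  fin_cases i
  · simp only [Fin.zero_eta]
    rw [hlow 0 (by decide) (dx 0) rfl]
    simp [dCoframe, barFrame, weight, e]
    ring_nf
    simp
  · simp only [Fin.mk_one]
    rw [hlow 1 (by decide) (dx 1) rfl]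
    simp [dCoframe, barFrame, weight, e]
  · simp only [Fin.reduceFinMk]
    rw [hlow 2 (by decide) (dx 2) rfl]
    simp [dCoframe, barFrame, weight, e]
  · simp only [Fin.reduceFinMk]
    rw [hlow 3 (by decide) (dx 3) rfl]
    simp [dCoframe, barFrame, weight, e]
  · simp only [Fin.reduceFinMk]
    have h1 : (barFrame s t f).co 4 = e s t 4 := by funext y; simp [barFrame, weight]
    rw [h1, hs.2.2.2.2.1]
    simp [dCoframe, barFrame, weight, fluxB, wedge_two_apply]
    linear_combination (-(t / s) * (e s t 0 x v * e s t 2 x w - e s t 0 x w * e s t 2 x v +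
      (e s t 1 x v * e s t 3 x w - e s t 1 x w * e s t 3 x v))) * hE
  · simp only [Fin.reduceFinMk]
    have h1 : (barFrame s t f).co 5 = e s t 5 := by funext y; simp [barFrame, weight]
    rw [h1, hs.2.2.2.2.2]
    simp [dCoframe, barFrame, weight, fluxA, fluxB, wedge_two_apply]
    linear_combination ((2 * t) * ((e s t 0 x v * e s t 1 x w - e s t 0 x w * e s t 1 x v) -
      (e s t 2 x v * e s t 3 x w - e s t 2 x w * e s t 3 x v)) + (t / s) *
      ((e s t 0 x v * e s t 3 x w - e s t 0 x w * e s t 3 x v) -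
      (e s t 1 x v * e s t 2 x w - e s t 1 x w * e s t 2 x v))) * hE

/-- Exterior derivative of a 1-form whose components in the frame depend only on `x¹`. -/
theorem IsDilaton.d1_sum (h : IsDilaton s t α f p U) {x : V6} (hx : x ∈ U)
    {g : Fin 6 → V6 → ℝ} {g' : Fin 6 → ℝ}
    (hg : ∀ k, HasFDerivAt (g k) (g' k • (barFrame s t f).co 0 x) x) (v w : V6) :
    d1 (fun y => ∑ k, g k y • (barFrame s t f).co k y) x ![v, w] =
      ∑ k, (g' k * ((barFrame s t f).co 0 x v * (barFrame s t f).co k x w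
          - (barFrame s t f).co 0 x w * (barFrame s t f).co k x v)
        + g k x * d1 ((barFrame s t f).co k) x ![v, w]) := by
  have h1 : HasFDerivAt (fun y => ∑ k, g k y • (barFrame s t f).co k y) _ x :=
    HasFDerivAt.fun_sum fun k _ => (hg k).smul (h.differentiableAt_co hx k).hasFDerivAt
  rw [d1_apply h1.differentiableAt, h1.fderiv]
  simp only [d1_apply (h.differentiableAt_co hx _)]
  simp [← Finset.sum_sub_distrib]
  exact Finset.sum_congr rfl fun k _ => by ring

end

end Het
end

noncomputable section

namespace Het

/-! ### Connections and curvatures in the frame -/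

/-- Coefficients of the Levi-Civita connection forms in the coframe. -/
def lcCoeff (p A B : ℝ) : Fin 6 → Fin 6 → Fin 6 → ℝ :=
  ![
    ![0,
      ![0, -p, 0, 0, 0, A],
      ![0, 0, -p, 0, -B / 2, 0],
      ![0, 0, 0, -p, 0, B / 2],
      ![0, 0, -B / 2, 0, 0, 0],
      ![0, A, 0, B / 2, 0, 0]],
    ![![0, p, 0, 0, 0, -A],
      0,
      ![0, 0, 0, 0, 0, -B / 2],
      ![0, 0, 0, 0, -B / 2, 0],
      ![0, 0, 0, -B / 2, 0, 0],
      ![-A, 0, -B / 2, 0, 0, 0]],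
    ![![0, 0, p, 0, B / 2, 0],
      ![0, 0, 0, 0, 0, B / 2],
      0,
      ![0, 0, 0, 0, 0, -A],
      ![B / 2, 0, 0, 0, 0, 0],
      ![0, B / 2, 0, -A, 0, 0]],
    ![![0, 0, 0, p, 0, -B / 2],
      ![0, 0, 0, 0, B / 2, 0],
      ![0, 0, 0, 0, 0, A],
      0,
      ![0, B / 2, 0, 0, 0, 0],
      ![-B / 2, 0, A, 0, 0, 0]],
    ![![0, 0, B / 2, 0, 0, 0],
      ![0, 0, 0, B / 2, 0, 0],
      ![-B / 2, 0, 0, 0, 0, 0],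
      ![0, -B / 2, 0, 0, 0, 0],
      0,
      0],
    ![![0, -A, 0, -B / 2, 0, 0],
      ![A, 0, B / 2, 0, 0, 0],
      ![0, -B / 2, 0, A, 0, 0],
      ![B / 2, 0, -A, 0, 0, 0],
      0,
      0]]

/-- Coefficients of the connection forms of `∇⁺` in the coframe. -/
def plusCoeff (p A B : ℝ) : Fin 6 → Fin 6 → Fin 6 → ℝ :=
  ![
    ![0,
      ![0, -p, 0, 0, 0, 2 * A],
      ![0, 0, -p, 0, -B, 0],
      ![0, 0, 0, -p, 0, B],
      0,
      0],
    ![![0, p, 0, 0, 0, -2 * A],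
      0,
      ![0, 0, 0, p, 0, -B],
      ![0, 0, -p, 0, -B, 0],
      0,
      0],
    ![![0, 0, p, 0, B, 0],
      ![0, 0, 0, -p, 0, B],
      0,
      ![0, p, 0, 0, 0, -2 * A],
      0,
      0],
    ![![0, 0, 0, p, 0, -B],
      ![0, 0, p, 0, B, 0],
      ![0, -p, 0, 0, 0, 2 * A],
      0,
      0,
      0],
    ![0,
      0,
      0,
      0,
      0,
      0],
    ![0,
      0,
      0,
      0,
      0,
      0]]

/-- Coefficients of the connection forms of `∇⁻` in the coframe. -/
def minusCoeff (p A B : ℝ) : Fin 6 → Fin 6 → Fin 6 → ℝ :=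
  ![
    ![0,
      ![0, -p, 0, 0, 0, 0],
      ![0, 0, -p, 0, 0, 0],
      ![0, 0, 0, -p, 0, 0],
      ![0, 0, -B, 0, 0, 0],
      ![0, 2 * A, 0, B, 0, 0]],
    ![![0, p, 0, 0, 0, 0],
      0,
      ![0, 0, 0, -p, 0, 0],
      ![0, 0, p, 0, 0, 0],
      ![0, 0, 0, -B, 0, 0],
      ![-2 * A, 0, -B, 0, 0, 0]],
    ![![0, 0, p, 0, 0, 0],
      ![0, 0, 0, p, 0, 0],
      0,
      ![0, -p, 0, 0, 0, 0],
      ![B, 0, 0, 0, 0, 0],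
      ![0, B, 0, -2 * A, 0, 0]],
    ![![0, 0, 0, p, 0, 0],
      ![0, 0, -p, 0, 0, 0],
      ![0, p, 0, 0, 0, 0],
      0,
      ![0, B, 0, 0, 0, 0],
      ![-B, 0, 2 * A, 0, 0, 0]],
    ![![0, 0, B, 0, 0, 0],
      ![0, 0, 0, B, 0, 0],
      ![-B, 0, 0, 0, 0, 0],
      ![0, -B, 0, 0, 0, 0],
      0,
      0],
    ![![0, -2 * A, 0, -B, 0, 0],
      ![2 * A, 0, B, 0, 0, 0],
      ![0, -B, 0, 2 * A, 0, 0],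
      ![B, 0, -2 * A, 0, 0, 0],
      0,
      0]]

/-- The flux in terms of a coframe. -/
def fluxForm (p A B : ℝ) (c : Fin 6 → (V6 →L[ℝ] ℝ)) : V6 [⋀^Fin 3]→L[ℝ] ℝ :=
  (-2 * A) • wedge ![c 0, c 1, c 5] + B • wedge ![c 0, c 2, c 4] + (-B) • wedge ![c 0, c 3, c 5]
    + (-2 * p) • wedge ![c 1, c 2, c 3] + B • wedge ![c 1, c 2, c 5] + B • wedge ![c 1, c 3, c 4]
    + (2 * A) • wedge ![c 2, c 3, c 5]

/-- The components of `J v` in terms of those of `v`. -/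
def rotate (a : Fin 6 → ℝ) : Fin 6 → ℝ := ![a 1, -a 0, a 3, -a 2, a 5, -a 4]

section

variable {s t α : ℝ} {f p : V6 → ℝ} {U : Set V6}

theorem Frame.co_J (B : Frame) (x v : V6) (a : Fin 6) :
    B.co a x (B.J x v) = rotate (fun b => B.co b x v) a := by
  fin_cases a <;> simp [Frame.J, B.dual, rotate]

theorem IsDilaton.flux_eq (h : IsDilaton s t α f p U) {x : V6} (hx : x ∈ U) :
    (barFrame s t f).flux x = fluxForm (p x) (fluxA t f x) (fluxB s t f x)
      (fun a => (barFrame s t f).co a x) := by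
  have hd := h.differentiableAt_co hx
  ext v
  have hv : v = ![v 0, v 1, v 2] := by funext i; fin_cases i <;> rfl
  rw [hv]
  have hk : extDeriv (barFrame s t f).kahler x =
      extDeriv (fun y => wedge ![(barFrame s t f).co 0 y, (barFrame s t f).co 1 y]) x
      + extDeriv (fun y => wedge ![(barFrame s t f).co 2 y, (barFrame s t f).co 3 y]) x
      + extDeriv (fun y => wedge ![(barFrame s t f).co 4 y, (barFrame s t f).co 5 y]) x := by
    have h01 := differentiableAt_wedge_two (hd 0) (hd 1)
    have h23 := differentiableAt_wedge_two (hd 2) (hd 3)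
    have h45 := differentiableAt_wedge_two (hd 4) (hd 5)
    rw [← extDeriv_fun_add h01 h23, ← extDeriv_fun_add (h01.fun_add h23) h45]
    rfl
  have hc : (⇑((barFrame s t f).J x) ∘ ![v 0, v 1, v 2]) = ![(barFrame s t f).J x (v 0),
      (barFrame s t f).J x (v 1), (barFrame s t f).J x (v 2)] := by
    funext i; fin_cases i <;> rfl
  simp only [Frame.flux, ContinuousAlternatingMap.neg_apply,
    ContinuousAlternatingMap.compContinuousLinearMap_apply, hc, hk,
    ContinuousAlternatingMap.add_apply, extDeriv_wedge_two (hd _) (hd _), h.d1_co hx,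
    Frame.co_J, fluxForm, ContinuousAlternatingMap.smul_apply, wedge_three_apply]
  simp [rotate, dCoframe]
  ring

set_option maxHeartbeats 2000000 in
theorem IsDilaton.leviCivita_eq (h : IsDilaton s t α f p U) {x : V6} (hx : x ∈ U) (i j : Fin 6) :
    (barFrame s t f).leviCivita i j x =
      ∑ k, lcCoeff (p x) (fluxA t f x) (fluxB s t f x) i j k • (barFrame s t f).co k x := by
  refine Finset.sum_congr rfl fun k _ => ?_
  congr 1
  simp only [h.d1_co hx, (barFrame s t f).dual]
  generalize p x = p, fluxA t f x = A, fluxB s t f x = B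
  fin_cases i <;> fin_cases j <;> fin_cases k <;> simp [lcCoeff, dCoframe] <;> ring

set_option maxHeartbeats 2000000 in
-- Since `∇⁺ - ∇⁻ = H`, the flux needs no coefficient table of its own.
theorem IsDilaton.flux_vec (h : IsDilaton s t α f p U) {x : V6} (hx : x ∈ U) (i j k : Fin 6) :
    (barFrame s t f).flux x ![(barFrame s t f).vec k x, (barFrame s t f).vec j x,
        (barFrame s t f).vec i x] =
      plusCoeff (p x) (fluxA t f x) (fluxB s t f x) i j k
        - minusCoeff (p x) (fluxA t f x) (fluxB s t f x) i j k := by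
  simp only [h.flux_eq hx, fluxForm, ContinuousAlternatingMap.add_apply,
    ContinuousAlternatingMap.smul_apply, wedge_three_apply,
    Matrix.cons_val, (barFrame s t f).dual]
  generalize p x = p, fluxA t f x = A, fluxB s t f x = B
  fin_cases i <;> fin_cases j <;> fin_cases k <;> simp [plusCoeff, minusCoeff] <;> ring

set_option maxHeartbeats 2000000 in
-- The average of `∇⁺` and `∇⁻` is `∇^g`. Together with `IsDilaton.flux_vec` this identifies both
-- tables.
theorem plusCoeff_add_minusCoeff (p A B : ℝ) (i j k : Fin 6) :
    plusCoeff p A B i j k + minusCoeff p A B i j k = 2 * lcCoeff p A B i j k := by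
  fin_cases i <;> fin_cases j <;> fin_cases k <;> simp [plusCoeff, minusCoeff, lcCoeff] <;> ring

/-- The table shows the reduction of holonomy: the rows and columns of `ē⁵`, `ē⁶` vanish, and the
remaining block satisfies `ω¹₂ = -ω³₄`, `ω¹₃ = ω²₄`, `ω¹₄ = -ω²₃`, so it is `su(2)`-valued. -/
theorem IsDilaton.nablaPlus_eq (h : IsDilaton s t α f p U) {x : V6} (hx : x ∈ U) (i j : Fin 6) :
    (barFrame s t f).nablaPlus i j x =
      ∑ k, plusCoeff (p x) (fluxA t f x) (fluxB s t f x) i j k • (barFrame s t f).co k x := by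
  rw [Frame.nablaPlus, Frame.torsionConn, h.leviCivita_eq hx, ← Finset.sum_add_distrib]
  refine Finset.sum_congr rfl fun k _ => ?_
  rw [← add_smul, h.flux_vec hx]
  congr 1
  linear_combination -(1 / 2 : ℝ) *
    plusCoeff_add_minusCoeff (p x) (fluxA t f x) (fluxB s t f x) i j k

theorem IsDilaton.nablaMinus_eq (h : IsDilaton s t α f p U) {x : V6} (hx : x ∈ U) (i j : Fin 6) :
    (barFrame s t f).nablaMinus i j x =
      ∑ k, minusCoeff (p x) (fluxA t f x) (fluxB s t f x) i j k • (barFrame s t f).co k x := by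
  rw [Frame.nablaMinus, Frame.torsionConn, h.leviCivita_eq hx, ← Finset.sum_add_distrib]
  refine Finset.sum_congr rfl fun k _ => ?_
  rw [← add_smul, h.flux_vec hx]
  congr 1
  linear_combination -(1 / 2 : ℝ) *
    plusCoeff_add_minusCoeff (p x) (fluxA t f x) (fluxB s t f x) i j k

/-- A family of real numbers that depends linearly on `(p, A, B)`. -/
def IsLinearFamily (C : ℝ → ℝ → ℝ → Fin 6 → Fin 6 → Fin 6 → ℝ) : Prop :=
  ∀ p A B i j k,
    C p A B i j k = C 1 0 0 i j k * p + C 0 1 0 i j k * A + C 0 0 1 i j k * B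

set_option maxHeartbeats 2000000 in
theorem isLinearFamily_lcCoeff : IsLinearFamily lcCoeff := by
  intro p A B i j k
  fin_cases i <;> fin_cases j <;> fin_cases k <;> simp [lcCoeff] <;> ring

set_option maxHeartbeats 2000000 in
theorem isLinearFamily_minusCoeff : IsLinearFamily minusCoeff := by
  intro p A B i j k
  fin_cases i <;> fin_cases j <;> fin_cases k <;> simp [minusCoeff]

/-- The value on vectors with components `a`, `b` of the curvature 2-form of the connection with
coefficients `C`. -/
def frameCurv (C : ℝ → ℝ → ℝ → Fin 6 → Fin 6 → Fin 6 → ℝ) (p A B : ℝ) (a b : Fin 6 → ℝ)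
    (i j : Fin 6) : ℝ :=
  -- The arguments of this first `C` are the derivatives of `p`, `A`, `B` along `ē₁`; by linearity
  -- it is the derivative of the coefficient itself.
  ∑ k, (C (6 * A ^ 2 + 3 * B ^ 2) (-2 * p * A) (-2 * p * B) i j k * (a 0 * b k - b 0 * a k)
      + C p A B i j k * dCoframe p A B a b k)
    + ∑ m, ((∑ k, C p A B i m k * a k) * (∑ k, C p A B m j k * b k)
      - (∑ k, C p A B i m k * b k) * (∑ k, C p A B m j k * a k))

/-- The derivative of a coefficient that depends linearly on `(p, A, B)`. -/
theorem IsDilaton.hasFDerivAt_coeff (h : IsDilaton s t α f p U) {x : V6} (hx : x ∈ U)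
    {C : ℝ → ℝ → ℝ → Fin 6 → Fin 6 → Fin 6 → ℝ} (hC : IsLinearFamily C) (i j k : Fin 6) :
    HasFDerivAt (fun y => C (p y) (fluxA t f y) (fluxB s t f y) i j k)
      (C (6 * fluxA t f x ^ 2 + 3 * fluxB s t f x ^ 2) (-2 * p x * fluxA t f x)
        (-2 * p x * fluxB s t f x) i j k • (barFrame s t f).co 0 x) x := by
  have h1 := (((h.hasFDerivAt_deriv x hx).const_mul (C 1 0 0 i j k)).add
    ((h.hasFDerivAt_fluxA hx).const_mul (C 0 1 0 i j k))).add
    ((h.hasFDerivAt_fluxB hx).const_mul (C 0 0 1 i j k))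
  have h2 : (fun y => C (p y) (fluxA t f y) (fluxB s t f y) i j k) = fun y =>
      C 1 0 0 i j k * p y + C 0 1 0 i j k * fluxA t f y + C 0 0 1 i j k * fluxB s t f y :=
    funext fun y => hC ..
  rw [h2, hC (6 * fluxA t f x ^ 2 + 3 * fluxB s t f x ^ 2)]
  refine h1.congr_fderiv ?_
  ext u
  simp
  ring

/-- The curvature of a connection whose coefficients in the frame depend linearly on
`(p, A, B)`. -/
theorem IsDilaton.curvature_eq (h : IsDilaton s t α f p U) {x : V6} (hx : x ∈ U) {θ : Conn}
    {C : ℝ → ℝ → ℝ → Fin 6 → Fin 6 → Fin 6 → ℝ} (hC : IsLinearFamily C)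
    (hθ : ∀ y ∈ U, ∀ i j, θ i j y =
      ∑ k, C (p y) (fluxA t f y) (fluxB s t f y) i j k • (barFrame s t f).co k y)
    (i j : Fin 6) (v w : V6) :
    curvature θ i j x ![v, w] = frameCurv C (p x) (fluxA t f x) (fluxB s t f x)
      (fun a => (barFrame s t f).co a x v) (fun a => (barFrame s t f).co a x w) i j := by
  have hd : d1 (θ i j) x = d1 (fun y => ∑ k, C (p y) (fluxA t f y) (fluxB s t f y) i j k •
      (barFrame s t f).co k y) x := by
    refine Filter.EventuallyEq.extDeriv_eq ?_
    filter_upwards [h.isOpen.mem_nhds hx] with y hy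
    rw [hθ y hy]
  rw [curvature, ContinuousAlternatingMap.add_apply, hd, h.d1_sum hx (h.hasFDerivAt_coeff hx hC i j)]
  simp only [ContinuousAlternatingMap.sum_apply, wedge_two_apply, hθ x hx, h.d1_co hx]
  simp [frameCurv]

/-- Components of the curvature 2-forms of `∇⁻` with respect to
`ē¹², ē¹³, ē¹⁴, ē²³, ē²⁴, ē³⁴`. -/
def minusCurv (p A B : ℝ) : Fin 6 → Fin 6 → Fin 6 → ℝ :=
  ![
    ![0,
      ![-p ^ 2 - 10 * A ^ 2 - 3 * B ^ 2, 0, -2 * A * B, 2 * A * B, 0, -2 * p ^ 2 - 2 * B ^ 2],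
      ![0, -p ^ 2 - 6 * A ^ 2 - 4 * B ^ 2, 0, 0, 2 * p ^ 2 + 4 * A ^ 2 + B ^ 2, 0],
      ![-2 * A * B, 0, -p ^ 2 - 6 * A ^ 2 - 4 * B ^ 2, -2 * p ^ 2 - 4 * A ^ 2 - B ^ 2, 0, 2 * A * B],
      ![0, 2 * p * B, 0, 0, 2 * p * B, 0],
      ![-4 * p * A, 0, -2 * p * B, 2 * p * B, 0, 4 * p * A]],
    ![![p ^ 2 + 10 * A ^ 2 + 3 * B ^ 2, 0, 2 * A * B, -2 * A * B, 0, 2 * p ^ 2 + 2 * B ^ 2],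
      0,
      ![2 * A * B, 0, -p ^ 2 - 10 * A ^ 2 - 4 * B ^ 2, -2 * p ^ 2 - B ^ 2, 0, -2 * A * B],
      ![0, p ^ 2 + 10 * A ^ 2 + 4 * B ^ 2, 0, 0, -2 * p ^ 2 - B ^ 2, 0],
      ![0, 0, 2 * p * B, -2 * p * B, 0, 0],
      ![0, 2 * p * B, 0, 0, 2 * p * B, 0]],
    ![![0, p ^ 2 + 6 * A ^ 2 + 4 * B ^ 2, 0, 0, -2 * p ^ 2 - 4 * A ^ 2 - B ^ 2, 0],
      ![-2 * A * B, 0, p ^ 2 + 10 * A ^ 2 + 4 * B ^ 2, 2 * p ^ 2 + B ^ 2, 0, 2 * A * B],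
      0,
      ![-p ^ 2 - 6 * A ^ 2 - 5 * B ^ 2, 0, 2 * A * B, -2 * A * B, 0, -2 * p ^ 2 - 4 * A ^ 2],
      0,
      ![-2 * p * B, 0, 4 * p * A, -4 * p * A, 0, 2 * p * B]],
    ![![2 * A * B, 0, p ^ 2 + 6 * A ^ 2 + 4 * B ^ 2, 2 * p ^ 2 + 4 * A ^ 2 + B ^ 2, 0, -2 * A * B],
      ![0, -p ^ 2 - 10 * A ^ 2 - 4 * B ^ 2, 0, 0, 2 * p ^ 2 + B ^ 2, 0],
      ![p ^ 2 + 6 * A ^ 2 + 5 * B ^ 2, 0, -2 * A * B, 2 * A * B, 0, 2 * p ^ 2 + 4 * A ^ 2],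
      0,
      ![-2 * p * B, 0, 0, 0, 0, 2 * p * B],
      ![0, -4 * p * A, 0, 0, -4 * p * A, 0]],
    ![![0, -2 * p * B, 0, 0, -2 * p * B, 0],
      ![0, 0, -2 * p * B, 2 * p * B, 0, 0],
      0,
      ![2 * p * B, 0, 0, 0, 0, -2 * p * B],
      0,
      ![-2 * B ^ 2, 0, 4 * A * B, -4 * A * B, 0, 2 * B ^ 2]],
    ![![4 * p * A, 0, 2 * p * B, -2 * p * B, 0, -4 * p * A],
      ![0, -2 * p * B, 0, 0, -2 * p * B, 0],
      ![2 * p * B, 0, -4 * p * A, 4 * p * A, 0, -2 * p * B],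
      ![0, 4 * p * A, 0, 0, 4 * p * A, 0],
      ![2 * B ^ 2, 0, -4 * A * B, 4 * A * B, 0, -2 * B ^ 2],
      0]]

/-- The value on two vectors with components `a`, `b` of the horizontal 2-form with components `c`
with respect to `ē¹², ē¹³, ē¹⁴, ē²³, ē²⁴, ē³⁴`. -/
def horizontalForm (c a b : Fin 6 → ℝ) : ℝ :=
  c 0 * (a 0 * b 1 - b 0 * a 1) + c 1 * (a 0 * b 2 - b 0 * a 2) + c 2 * (a 0 * b 3 - b 0 * a 3)
    + c 3 * (a 1 * b 2 - b 1 * a 2) + c 4 * (a 1 * b 3 - b 1 * a 3)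
    + c 5 * (a 2 * b 3 - b 2 * a 3)

set_option maxHeartbeats 2000000 in
-- No `ē⁵` or `ē⁶` occurs. Conceptually, exchanging the pairs of arguments turns the curvature of
-- `∇⁻` into that of `∇⁺` up to a multiple of `dH`; here `dH` is horizontal, and `∇⁺` has `ē₅`, `ē₆`
-- parallel.
theorem IsDilaton.curvature_nablaMinus (h : IsDilaton s t α f p U) {x : V6} (hx : x ∈ U)
    (i j : Fin 6) (v w : V6) :
    curvature (barFrame s t f).nablaMinus i j x ![v, w] =
      horizontalForm (minusCurv (p x) (fluxA t f x) (fluxB s t f x) i j)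
        (fun a => (barFrame s t f).co a x v) (fun a => (barFrame s t f).co a x w) := by
  rw [h.curvature_eq hx isLinearFamily_minusCoeff (fun _ hy => h.nablaMinus_eq hy)]
  generalize p x = p, fluxA t f x = A, fluxB s t f x = B,
    (fun a => (barFrame s t f).co a x v) = a, (fun a => (barFrame s t f).co a x w) = b
  fin_cases i <;> fin_cases j <;>
    simp [frameCurv, minusCoeff, minusCurv, horizontalForm, dCoframe, Fin.sum_univ_six] <;> ring

end

end Het
end

noncomputable section

namespace Het

section

variable {s t α : ℝ} {f p : V6 → ℝ} {U : Set V6}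

/-! ### Anomaly cancellation -/

/-- The square of a 2-form in four dimensions is twice its Pfaffian times the volume form. Hence
every Pontrjagin form here is a scalar multiple of `ē¹²³⁴`. -/
theorem wedge22_horizontal {B : Frame} {x : V6} {Ω : V6 [⋀^Fin 2]→L[ℝ] ℝ} {c : Fin 6 → ℝ}
    (hΩ : ∀ v w, Ω ![v, w] = horizontalForm c (fun a => B.co a x v) (fun a => B.co a x w))
    (v : Fin 4 → V6) :
    wedge22 Ω Ω v = 2 * (c 0 * c 5 - c 1 * c 4 + c 2 * c 3) *
      wedge ![B.co 0 x, B.co 1 x, B.co 2 x, B.co 3 x] v := by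
  simp only [wedge22, hΩ, horizontalForm, wedge_four_apply, wedge_two_apply, Matrix.cons_val]
  ring

theorem sum_sum_Ioi (F : Fin 6 → Fin 6 → ℝ) : ∑ i, ∑ j ∈ Finset.Ioi i, F i j =
    F 0 1 + F 0 2 + F 0 3 + F 0 4 + F 0 5 + F 1 2 + F 1 3 + F 1 4 + F 1 5 + F 2 3 + F 2 4 + F 2 5
      + F 3 4 + F 3 5 + F 4 5 := by
  have h0 : Finset.Ioi (0 : Fin 6) = {1, 2, 3, 4, 5} := by decide
  have h1 : Finset.Ioi (1 : Fin 6) = {2, 3, 4, 5} := by decide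
  have h2 : Finset.Ioi (2 : Fin 6) = {3, 4, 5} := by decide
  have h3 : Finset.Ioi (3 : Fin 6) = {4, 5} := by decide
  have h4 : Finset.Ioi (4 : Fin 6) = {5} := by decide
  have h5 : Finset.Ioi (5 : Fin 6) = ∅ := by decide
  rw [Fin.sum_univ_six, h0, h1, h2, h3, h4, h5]
  simp
  ring

/-- The flux is `dē⁵∧ē⁵ + dē⁶∧ē⁶ - 2p ē²³⁴`. The first two terms contribute the anti-self-dual
squares, `-(8A² + 4B²)`; the last contributes `-2(6A² + 3B²)` from `dp` and `-6p²` from `dē²³⁴`. -/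
theorem IsDilaton.extDeriv_flux (h : IsDilaton s t α f p U) {x : V6} (hx : x ∈ U)
    (v : Fin 4 → V6) :
    extDeriv (barFrame s t f).flux x v =
      -(6 * p x ^ 2 + 20 * fluxA t f x ^ 2 + 10 * fluxB s t f x ^ 2) *
        wedge ![(barFrame s t f).co 0 x, (barFrame s t f).co 1 x, (barFrame s t f).co 2 x,
          (barFrame s t f).co 3 x] v := by
  have hd := h.differentiableAt_co hx
  have hp := h.hasFDerivAt_deriv x hx
  have hA := h.hasFDerivAt_fluxA hx
  have hB := h.hasFDerivAt_fluxB hx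
  have hA1 := hA.const_mul (-2)
  have hA2 := hA.const_mul 2
  have hp1 := hp.const_mul (-2)
  have hB1 := hB.fun_neg
  have hcongr : extDeriv (barFrame s t f).flux x = extDeriv (fun y => fluxForm (p y) (fluxA t f y)
      (fluxB s t f y) (fun a => (barFrame s t f).co a y)) x :=
    Filter.EventuallyEq.extDeriv_eq (by
      filter_upwards [h.isOpen.mem_nhds hx] with y hy using h.flux_eq hy)
  have D {g : V6 → ℝ} (hg : DifferentiableAt ℝ g x) (i j k : Fin 6) :=
    differentiableAt_smul_wedge_three hg (hd i) (hd j) (hd k)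
  have d1 := D hA1.differentiableAt 0 1 5
  have d2 := D hB.differentiableAt 0 2 4
  have d3 := D hB1.differentiableAt 0 3 5
  have d4 := D hp1.differentiableAt 1 2 3
  have d5 := D hB.differentiableAt 1 2 5
  have d6 := D hB.differentiableAt 1 3 4
  have d7 := D hA2.differentiableAt 2 3 5
  rw [hcongr]
  simp only [fluxForm]
  rw [extDeriv_fun_add (((((d1.fun_add d2).fun_add d3).fun_add d4).fun_add d5).fun_add d6) d7,
    extDeriv_fun_add ((((d1.fun_add d2).fun_add d3).fun_add d4).fun_add d5) d6,
    extDeriv_fun_add (((d1.fun_add d2).fun_add d3).fun_add d4) d5,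
    extDeriv_fun_add ((d1.fun_add d2).fun_add d3) d4, extDeriv_fun_add (d1.fun_add d2) d3,
    extDeriv_fun_add d1 d2]
  simp only [ContinuousAlternatingMap.add_apply,
    extDeriv_smul_wedge_three hA1.differentiableAt (hd _) (hd _) (hd _),
    extDeriv_smul_wedge_three hA2.differentiableAt (hd _) (hd _) (hd _),
    extDeriv_smul_wedge_three hB.differentiableAt (hd _) (hd _) (hd _),
    extDeriv_smul_wedge_three hB1.differentiableAt (hd _) (hd _) (hd _),
    extDeriv_smul_wedge_three hp1.differentiableAt (hd _) (hd _) (hd _),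
    hA1.fderiv, hA2.fderiv, hB.fderiv, hB1.fderiv, hp1.fderiv, wedge22, wedge_four_apply,
    wedge_two_apply, h.d1_co hx, Matrix.cons_val, dCoframe, smul_apply,
    neg_apply, smul_eq_mul]
  ring

/-- The quartic is left factored because its second factor is `2/α²` by the first integral; only a
quadratic remains to be compared with `dH`. -/
theorem IsDilaton.pontrjagin_nablaMinus (h : IsDilaton s t α f p U) {x : V6} (hx : x ∈ U)
    (v : Fin 4 → V6) :
    8 * Real.pi ^ 2 * p1 (barFrame s t f).nablaMinus x v =
      12 * (p x ^ 2 + 2 * fluxA t f x ^ 2 + fluxB s t f x ^ 2) *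
        (2 * p x ^ 2 + 6 * fluxA t f x ^ 2 + 3 * fluxB s t f x ^ 2) *
        wedge ![(barFrame s t f).co 0 x, (barFrame s t f).co 1 x, (barFrame s t f).co 2 x,
          (barFrame s t f).co 3 x] v := by
  have hpi : 8 * Real.pi ^ 2 ≠ 0 := by positivity
  rw [p1, mul_inv_cancel_left₀ hpi]
  simp only [wedge22_horizontal (h.curvature_nablaMinus hx _ _)]
  generalize p x = p, fluxA t f x = A, fluxB s t f x = B
  rw [sum_sum_Ioi]
  simp only [minusCurv, Matrix.cons_val, Pi.zero_apply]
  ring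

/-- All connection forms are multiples of `ē⁶`, so the quadratic term of the curvature vanishes and
the constant matrix multiplies `dē⁶`. -/
theorem IsDilaton.curvature_instanton (h : IsDilaton s t α f p U) {x : V6} (hx : x ∈ U)
    (l : Fin 3 → ℝ) (i j : Fin 6) (v w : V6) :
    curvature (instanton (barFrame s t f) l) i j x ![v, w] =
      instantonMatrix l i j * horizontalForm
        ![-2 * fluxA t f x, 0, -fluxB s t f x, fluxB s t f x, 0, 2 * fluxA t f x]
        (fun a => (barFrame s t f).co a x v) (fun a => (barFrame s t f).co a x w) := by
  have h1 : d1 (instanton (barFrame s t f) l i j) x ![v, w] =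
      instantonMatrix l i j * d1 ((barFrame s t f).co 5) x ![v, w] := by
    have hc := (h.differentiableAt_co hx 5).hasFDerivAt.const_smul (instantonMatrix l i j)
    have hc' : HasFDerivAt (instanton (barFrame s t f) l i j) _ x := hc
    rw [d1_apply hc'.differentiableAt, hc'.fderiv, d1_apply (h.differentiableAt_co hx 5)]
    simp
    ring
  rw [curvature, ContinuousAlternatingMap.add_apply, h1, h.d1_co hx,
    ContinuousAlternatingMap.sum_apply, Finset.sum_eq_zero]
  · simp only [dCoframe, horizontalForm, Matrix.cons_val]
    ring
  · intro k _
    simp [wedge_two_apply, instanton]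
    ring

theorem IsDilaton.pontrjagin_instanton (h : IsDilaton s t α f p U) {x : V6} (hx : x ∈ U)
    (l : Fin 3 → ℝ) (v : Fin 4 → V6) :
    8 * Real.pi ^ 2 * p1 (instanton (barFrame s t f) l) x v =
      -4 * (4 * fluxA t f x ^ 2 + fluxB s t f x ^ 2) * (∑ i, l i ^ 2) *
        wedge ![(barFrame s t f).co 0 x, (barFrame s t f).co 1 x, (barFrame s t f).co 2 x,
          (barFrame s t f).co 3 x] v := by
  have hpi : 8 * Real.pi ^ 2 ≠ 0 := by positivity
  have hΩ (i j : Fin 6) (v w : V6) : curvature (instanton (barFrame s t f) l) i j x ![v, w] =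
      horizontalForm (instantonMatrix l i j •
        ![-2 * fluxA t f x, 0, -fluxB s t f x, fluxB s t f x, 0, 2 * fluxA t f x])
        (fun a => (barFrame s t f).co a x v) (fun a => (barFrame s t f).co a x w) := by
    rw [h.curvature_instanton hx]
    simp only [horizontalForm, Pi.smul_apply, smul_eq_mul]
    ring
  rw [p1, mul_inv_cancel_left₀ hpi]
  simp only [wedge22_horizontal (hΩ _ _)]
  rw [sum_sum_Ioi]
  simp [instantonMatrix, Fin.sum_univ_three]
  ring

/-- The instanton parameter in terms of the frame: the identity `4κ² = α²(1+κ²)|λ|²`. -/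
theorem fluxA_fluxB_instanton (hs : s ≠ 0) {l : Fin 3 → ℝ}
    (hl : 4 * kappaSq s = α ^ 2 * (1 + kappaSq s) * ∑ i, l i ^ 2) (x : V6) :
    α ^ 2 * ((4 * fluxA t f x ^ 2 + fluxB s t f x ^ 2) * ∑ i, l i ^ 2) =
      8 * fluxA t f x ^ 2 + 4 * fluxB s t f x ^ 2 := by
  have h1 : fluxB s t f x * s = fluxA t f x := by
    simp only [fluxA, fluxB]; field_simp
  -- With `A = sB` one has `8A² + 4B² = 8κ²A²` and `4A² + B² = 2(1 + κ²)A²`, so the claim is `2A²`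
  -- times the hypothesis on `|λ|`.
  rw [← h1]
  simp only [kappaSq] at hl
  field_simp at hl
  linear_combination (-fluxB s t f x ^ 2) * hl

/-- By the first integral the term of `∇⁻` becomes `24(p² + 2A² + B²)`; by the choice of `|λ|` that
of `A_λ` adds `4(8A² + 4B²)`. The sum is four times the coefficient of `-dH`. -/
theorem IsDilaton.anomalyForm_eq (h : IsDilaton s t α f p U) (hs : s ≠ 0) {l : Fin 3 → ℝ}
    (hl : 4 * kappaSq s = α ^ 2 * (1 + kappaSq s) * ∑ i, l i ^ 2) {x : V6} (hx : x ∈ U)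
    (v : Fin 4 → V6) :
    α ^ 2 * (barFrame s t f).anomalyForm (instanton (barFrame s t f) l) x v =
      4 * (6 * p x ^ 2 + 20 * fluxA t f x ^ 2 + 10 * fluxB s t f x ^ 2) *
        wedge ![(barFrame s t f).co 0 x, (barFrame s t f).co 1 x, (barFrame s t f).co 2 x,
          (barFrame s t f).co 3 x] v := by
  rw [Frame.anomalyForm, mul_sub, h.pontrjagin_nablaMinus hx, h.pontrjagin_instanton hx]
  have h1 := h.norm_sq x hx
  have h2 := fluxA_fluxB_instanton (t := t) (f := f) hs hl x
  generalize p x = p, fluxA t f x = A, fluxB s t f x = B, ∑ i, l i ^ 2 = Λ,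
    wedge ![(barFrame s t f).co 0 x, (barFrame s t f).co 1 x, (barFrame s t f).co 2 x,
          (barFrame s t f).co 3 x] v = W at *
  linear_combination 4 * W * h2 + (24 * (p ^ 2 + 2 * A ^ 2 + B ^ 2)) * W * h1

theorem IsDilaton.anomaly (h : IsDilaton s t α f p U) (hs : s ≠ 0) {l : Fin 3 → ℝ}
    (hl : 4 * kappaSq s = α ^ 2 * (1 + kappaSq s) * ∑ i, l i ^ 2) :
    (barFrame s t f).Anomaly U (barFrame s t f).nablaMinus (instanton (barFrame s t f) l)
      (-α ^ 2) := by
  intro x hx v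
  have h1 := h.anomalyForm_eq hs hl hx v
  rw [Frame.anomalyForm] at h1
  rw [h.extDeriv_flux hx]
  linear_combination (1 / 4 : ℝ) * h1

/-! ### Hermitian structure -/

theorem IsDilaton.isHermitianConn_nablaPlus (h : IsDilaton s t α f p U) :
    (barFrame s t f).IsHermitianConn U (barFrame s t f).nablaPlus := by
  intro x hx v
  simp only [h.nablaPlus_eq hx, Frame.co_J, (barFrame s t f).dual]
  simp only [sum_apply, smul_apply, smul_eq_mul]
  generalize p x = p, fluxA t f x = A, fluxB s t f x = B
  constructor
  · intro i j
    fin_cases i <;> fin_cases j <;> simp [plusCoeff, Fin.sum_univ_six] <;> ring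
  · intro i j
    fin_cases i <;> fin_cases j <;> simp [plusCoeff, Fin.sum_univ_six, rotate] <;> ring

theorem instanton_skew (B : Frame) (l : Fin 3 → ℝ) (x v : V6) (i j : Fin 6) :
    instanton B l i j x v = -instanton B l j i x v := by
  fin_cases i <;> fin_cases j <;> simp [instanton, instantonMatrix]

/-- The curvature is a matrix times `dē⁶`, and anti-self-dual forms on the base are `J`-invariant
and orthogonal to the Kähler form. -/
theorem IsDilaton.isInstanton (h : IsDilaton s t α f p U) (l : Fin 3 → ℝ) :
    (barFrame s t f).IsInstanton U (instanton (barFrame s t f) l) := by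
  intro x hx i j
  constructor
  · intro v w
    simp only [h.curvature_instanton hx, Frame.co_J]
    simp [horizontalForm, rotate]
    ring_nf
    simp
  · simp only [h.curvature_instanton hx, Frame.co_J, (barFrame s t f).dual]
    simp [horizontalForm, rotate, Fin.sum_univ_six]

/-- `J` pairs coframe elements of equal weight, so `f` drops out. The result is affine in the base
coordinates, which gives `J` a constant derivative. -/
theorem barFrame_J_apply (x v : V6) : (barFrame s t f).J x v =
    ![v 1, -v 0, v 3, -v 2,
      v 5 - (2 * t) * (x 0 * v 1 - x 2 * v 3) - (t / s) * (x 0 * v 3 - x 1 * v 2)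
        - (t / s) * (x 0 * v 3 - x 1 * v 2),
      -(v 4 + (t / s) * (x 0 * v 2 + x 1 * v 3)) - 2 * t * x 0 * v 0 + 2 * t * x 2 * v 2
        - (t / s) * (x 0 * v 2) - (t / s) * (x 1 * v 3)] := by
  have hf : Real.exp (f x) ≠ 0 := Real.exp_ne_zero _
  funext j
  fin_cases j <;> simp [Frame.J, barFrame, weight, e, eVec] <;> field_simp <;> ring

/-- The derivative of the field `J` of endomorphisms of `ℝ⁶`. -/
def derivJ (s t : ℝ) : V6 →L[ℝ] V6 →L[ℝ] V6 :=
  LinearMap.toContinuousLinearMap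
    ((LinearMap.toContinuousLinearMap : (V6 →ₗ[ℝ] V6) ≃ₗ[ℝ] (V6 →L[ℝ] V6)).toLinearMap ∘ₗ
      LinearMap.mk₂ ℝ (fun h v : V6 => (![0, 0, 0, 0,
        -(2 * t) * (h 0 * v 1 - h 2 * v 3) - 2 * (t / s) * (h 0 * v 3 - h 1 * v 2),
        -(2 * t) * (h 0 * v 0 - h 2 * v 2) - 2 * (t / s) * (h 0 * v 2 + h 1 * v 3)] : V6))
        (fun a b c => by funext j; fin_cases j <;> simp <;> ring)
        (fun a b c => by funext j; fin_cases j <;> simp <;> ring)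
        (fun a b c => by funext j; fin_cases j <;> simp <;> ring)
        (fun a b c => by funext j; fin_cases j <;> simp <;> ring))

theorem derivJ_apply (s t : ℝ) (h v : V6) : derivJ s t h v = ![0, 0, 0, 0,
    -(2 * t) * (h 0 * v 1 - h 2 * v 3) - 2 * (t / s) * (h 0 * v 3 - h 1 * v 2),
    -(2 * t) * (h 0 * v 0 - h 2 * v 2) - 2 * (t / s) * (h 0 * v 2 + h 1 * v 3)] := rfl

theorem hasFDerivAt_J (x : V6) : HasFDerivAt (barFrame s t f).J (derivJ s t) x := by
  have h : (barFrame s t f).J = fun y => (barFrame s t f).J 0 + derivJ s t y := by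
    funext y
    refine ContinuousLinearMap.ext fun v => ?_
    rw [add_apply, barFrame_J_apply, barFrame_J_apply, derivJ_apply]
    funext j
    fin_cases j <;> simp <;> ring
  rw [h]
  exact (derivJ s t).hasFDerivAt.const_add _

theorem barFrame_J_J (x v : V6) : (barFrame s t f).J x ((barFrame s t f).J x v) = -v := by
  rw [barFrame_J_apply, barFrame_J_apply]
  funext j
  fin_cases j <;> simp <;> ring

theorem barFrame_isHermitian (hU : IsOpen U) : (barFrame s t f).IsHermitian U where
  pos x _ v hv := by
    by_contra hn
    have h0 : ∀ i, (barFrame s t f).co i x v = 0 := by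
      have h1 : (barFrame s t f).metric x v v = 0 :=
        le_antisymm (not_lt.mp hn) (Finset.sum_nonneg fun i _ => mul_self_nonneg _)
      intro i
      have h2 := (Finset.sum_eq_zero_iff_of_nonneg fun i _ => mul_self_nonneg _).mp h1 i
        (Finset.mem_univ i)
      exact mul_self_eq_zero.mp h2
    refine hv ?_
    rw [← barFrame_vec_sum (s := s) (t := t) (f := f) x v]
    simp [h0]
  sq x _ v := barFrame_J_J x v
  compat x _ v w := by
    simp only [Frame.metric, Frame.co_J]
    simp [Fin.sum_univ_six, rotate]
    ring
  kahler_eq x _ v w := by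
    simp only [Frame.metric, Frame.co_J, Frame.kahler]
    simp [Fin.sum_univ_six, rotate, wedge_two_apply]
    ring
  integrable X Y hX hY x hx := by
    have hX' := ((hX.contDiffAt (hU.mem_nhds hx)).differentiableAt (by simp)).hasFDerivAt
    have hY' := ((hY.contDiffAt (hU.mem_nhds hx)).differentiableAt (by simp)).hasFDerivAt
    have hJX := (hasFDerivAt_J (s := s) (t := t) (f := f) x).clm_apply hX'
    have hJY := (hasFDerivAt_J (s := s) (t := t) (f := f) x).clm_apply hY'
    simp only [VectorField.lieBracket, hJX.fderiv, hJY.fderiv]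
    -- The derivatives of `X` and `Y` cancel in the Nijenhuis tensor because `J² = -1`; this
    -- algebraic identity in the derivative of `J` is all that remains.
    have hK : derivJ s t ((barFrame s t f).J x (X x)) (Y x)
        - derivJ s t ((barFrame s t f).J x (Y x)) (X x)
        + (barFrame s t f).J x (derivJ s t (Y x) (X x))
        - (barFrame s t f).J x (derivJ s t (X x) (Y x)) = 0 := by
      simp only [barFrame_J_apply, derivJ_apply]
      funext j
      fin_cases j <;> simp <;> ring
    simp only [add_apply, ContinuousLinearMap.comp_apply, ContinuousLinearMap.flip_apply,
      map_add, map_sub, barFrame_J_J]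
    rw [← hK]
    abel

end

end Het
end

noncomputable section

namespace Het

section

variable {s t α : ℝ} {f p : V6 → ℝ} {U : Set V6}

/-! ### The Einstein equation -/

set_option maxHeartbeats 2000000 in
theorem sum_frameCurv_lcCoeff (p A B : ℝ) (b : Fin 6 → ℝ) (k : Fin 6) :
    ∑ i, frameCurv lcCoeff p A B (fun a => if a = i then 1 else 0) b i k =
      ![-3 * p ^ 2 - 20 * A ^ 2 - 10 * B ^ 2, -3 * p ^ 2 - 8 * A ^ 2 - 4 * B ^ 2,
        -3 * p ^ 2 - 8 * A ^ 2 - 4 * B ^ 2, -3 * p ^ 2 - 8 * A ^ 2 - 4 * B ^ 2,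
        B ^ 2, 4 * A ^ 2 + B ^ 2] k * b k := by
  fin_cases k <;> simp [frameCurv, lcCoeff, dCoframe, Fin.sum_univ_six] <;> ring

theorem IsDilaton.ricci_eq (h : IsDilaton s t α f p U) {x : V6} (hx : x ∈ U) (X Y : V6) :
    (barFrame s t f).ricci x X Y =
      ∑ k, ![-3 * p x ^ 2 - 20 * fluxA t f x ^ 2 - 10 * fluxB s t f x ^ 2,
        -3 * p x ^ 2 - 8 * fluxA t f x ^ 2 - 4 * fluxB s t f x ^ 2,
        -3 * p x ^ 2 - 8 * fluxA t f x ^ 2 - 4 * fluxB s t f x ^ 2,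
        -3 * p x ^ 2 - 8 * fluxA t f x ^ 2 - 4 * fluxB s t f x ^ 2,
        fluxB s t f x ^ 2, 4 * fluxA t f x ^ 2 + fluxB s t f x ^ 2] k *
        (barFrame s t f).co k x X * (barFrame s t f).co k x Y := by
  rw [Frame.ricci, Finset.sum_comm]
  refine Finset.sum_congr rfl fun k _ => ?_
  rw [← Finset.sum_mul]
  congr 1
  simp only [h.curvature_eq hx isLinearFamily_lcCoeff (fun _ hy => h.leviCivita_eq hy),
    (barFrame s t f).dual]
  exact sum_frameCurv_lcCoeff _ _ _ _ k

/-- The components of the flux. -/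
def fluxCoeff (p A B : ℝ) (i j k : Fin 6) : ℝ := plusCoeff p A B i j k - minusCoeff p A B i j k

theorem IsDilaton.flux_apply_vec_vec (h : IsDilaton s t α f p U) {x : V6} (hx : x ∈ U) (X : V6)
    (i j : Fin 6) :
    (barFrame s t f).flux x ![X, (barFrame s t f).vec j x, (barFrame s t f).vec i x] =
      ∑ k, fluxCoeff (p x) (fluxA t f x) (fluxB s t f x) i j k * (barFrame s t f).co k x X := by
  have h1 : ∀ k, fluxCoeff (p x) (fluxA t f x) (fluxB s t f x) i j k =
      (barFrame s t f).flux x ![(barFrame s t f).vec k x, (barFrame s t f).vec j x,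
        (barFrame s t f).vec i x] := fun k => (h.flux_vec hx i j k).symm
  simp only [h1, h.flux_eq hx, fluxForm, ContinuousAlternatingMap.add_apply,
    ContinuousAlternatingMap.smul_apply, wedge_three_apply, Matrix.cons_val,
    (barFrame s t f).dual]
  simp only [Fin.sum_univ_six, Fin.reduceEq, if_true, if_false, smul_eq_mul]
  ring

theorem sum_fluxCoeff (p A B : ℝ) (a b : Fin 6 → ℝ) :
    ∑ j, ∑ i, (∑ k, fluxCoeff p A B i j k * a k) * (∑ k, fluxCoeff p A B i j k * b k) =
      (8 * A ^ 2 + 4 * B ^ 2) * (a 0 * b 0) + (8 * p ^ 2 + 8 * A ^ 2 + 4 * B ^ 2) *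
        (a 1 * b 1 + a 2 * b 2 + a 3 * b 3) + 4 * B ^ 2 * (a 4 * b 4) +
      (16 * A ^ 2 + 4 * B ^ 2) * (a 5 * b 5) - 8 * p * A * (a 1 * b 5 + a 5 * b 1)
      + 4 * p * B * (a 2 * b 4 + a 4 * b 2) - 4 * p * B * (a 3 * b 5 + a 5 * b 3) := by
  simp [fluxCoeff, plusCoeff, minusCoeff, Fin.sum_univ_six]
  ring

theorem IsDilaton.dir_eq (h : IsDilaton s t α f p U) {x : V6} (hx : x ∈ U) (i : Fin 6) :
    (barFrame s t f).dir i f x = if 0 = i then p x else 0 := by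
  rw [Frame.dir, (h.hasFDerivAt x hx).fderiv, smul_apply, (barFrame s t f).dual]
  split_ifs <;> simp

theorem IsDilaton.dir_dir_eq (h : IsDilaton s t α f p U) {x : V6} (hx : x ∈ U) (i j : Fin 6) :
    (barFrame s t f).dir i ((barFrame s t f).dir j f) x =
      if 0 = i ∧ 0 = j then 6 * fluxA t f x ^ 2 + 3 * fluxB s t f x ^ 2 else 0 := by
  have h1 : (barFrame s t f).dir j f =ᶠ[𝓝 x] fun y => if 0 = j then p y else 0 := by
    filter_upwards [h.isOpen.mem_nhds hx] with y hy using h.dir_eq hy j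
  rw [Frame.dir, h1.fderiv_eq]
  by_cases hj : 0 = j
  · simp only [hj, if_true, and_true]
    rw [(h.hasFDerivAt_deriv x hx).fderiv, smul_apply, (barFrame s t f).dual, hj]
    split_ifs <;> simp
  · simp [hj]

theorem IsDilaton.leviCivita_vec (h : IsDilaton s t α f p U) {x : V6} (hx : x ∈ U)
    (i j k : Fin 6) : (barFrame s t f).leviCivita i j x ((barFrame s t f).vec k x) =
      lcCoeff (p x) (fluxA t f x) (fluxB s t f x) i j k := by
  simp [h.leviCivita_eq hx, (barFrame s t f).dual]

theorem IsDilaton.nablaPlus_vec (h : IsDilaton s t α f p U) {x : V6} (hx : x ∈ U)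
    (i j k : Fin 6) : (barFrame s t f).nablaPlus i j x ((barFrame s t f).vec k x) =
      plusCoeff (p x) (fluxA t f x) (fluxB s t f x) i j k := by
  simp [h.nablaPlus_eq hx, (barFrame s t f).dual]

theorem IsDilaton.hessian_eq (h : IsDilaton s t α f p U) {x : V6} (hx : x ∈ U) (X Y : V6)
    {a b : Fin 6 → ℝ} (ha : a = fun i => (barFrame s t f).co i x X)
    (hb : b = fun i => (barFrame s t f).co i x Y) :
    (barFrame s t f).hessian f x X Y =
      (6 * fluxA t f x ^ 2 + 3 * fluxB s t f x ^ 2) * (a 0 * b 0)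
      + p x ^ 2 * (a 1 * b 1 + a 2 * b 2 + a 3 * b 3) - p x * fluxA t f x * (a 1 * b 5 + a 5 * b 1)
      + p x * fluxB s t f x / 2 * (a 2 * b 4 + a 4 * b 2)
      - p x * fluxB s t f x / 2 * (a 3 * b 5 + a 5 * b 3) := by
  simp only [Frame.hessian, h.dir_dir_eq hx, h.leviCivita_vec hx, h.dir_eq hx]
  subst ha hb
  simp [Fin.sum_univ_six, lcCoeff]
  ring

theorem sum_horizontalForm (c a b : Fin 6 → ℝ) :
    ∑ k, horizontalForm c a (fun i => if i = k then 1 else 0) *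
        horizontalForm c b (fun i => if i = k then 1 else 0) =
      (-c 0 * a 1 - c 1 * a 2 - c 2 * a 3) * (-c 0 * b 1 - c 1 * b 2 - c 2 * b 3)
      + (c 0 * a 0 - c 3 * a 2 - c 4 * a 3) * (c 0 * b 0 - c 3 * b 2 - c 4 * b 3)
      + (c 1 * a 0 + c 3 * a 1 - c 5 * a 3) * (c 1 * b 0 + c 3 * b 1 - c 5 * b 3)
      + (c 2 * a 0 + c 4 * a 1 + c 5 * a 2) * (c 2 * b 0 + c 4 * b 1 + c 5 * b 2) := by
  simp [horizontalForm, Fin.sum_univ_six]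
  ring

theorem IsDilaton.curvInner_nablaMinus (h : IsDilaton s t α f p U) {x : V6} (hx : x ∈ U) (X Y : V6)
    {a b : Fin 6 → ℝ} (ha : a = fun i => (barFrame s t f).co i x X)
    (hb : b = fun i => (barFrame s t f).co i x Y) {P A B : ℝ} (hP : P = p x)
    (hA : A = fluxA t f x) (hB : B = fluxB s t f x) :
    (barFrame s t f).curvInner (barFrame s t f).nablaMinus x X Y =
      (6 * P ^ 4 + 72 * P ^ 2 * (2 * A ^ 2 + B ^ 2) + 102 * (2 * A ^ 2 + B ^ 2) ^ 2) * (a 0 * b 0)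
      + (18 * P ^ 4 + 56 * P ^ 2 * (2 * A ^ 2 + B ^ 2) + 42 * (2 * A ^ 2 + B ^ 2) ^ 2) *
        (a 1 * b 1 + a 2 * b 2 + a 3 * b 3) := by
  simp only [Frame.curvInner, h.curvature_nablaMinus hx, (barFrame s t f).dual, ← ha, ← hb, ← hP,
    ← hA, ← hB, sum_horizontalForm]
  rw [sum_sum_Ioi]
  simp only [minusCurv, Matrix.cons_val, Pi.zero_apply]
  ring

theorem IsDilaton.curvInner_instanton (h : IsDilaton s t α f p U) {x : V6} (hx : x ∈ U)
    (l : Fin 3 → ℝ) (X Y : V6)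
    {a b : Fin 6 → ℝ} (ha : a = fun i => (barFrame s t f).co i x X)
    (hb : b = fun i => (barFrame s t f).co i x Y) :
    (barFrame s t f).curvInner (instanton (barFrame s t f) l) x X Y =
      2 * ((4 * fluxA t f x ^ 2 + fluxB s t f x ^ 2) * ∑ i, l i ^ 2) *
        (a 0 * b 0 + a 1 * b 1 + a 2 * b 2 + a 3 * b 3) := by
  simp only [Frame.curvInner, h.curvature_instanton hx, (barFrame s t f).dual, ← ha, ← hb,
    mul_mul_mul_comm, ← Finset.mul_sum, sum_horizontalForm]
  rw [sum_sum_Ioi]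
  simp [instantonMatrix, Fin.sum_univ_three]
  ring

/-- The components of `ē¹²³⁴(ē_k, ē_l, ·, ·)`. -/
def starCoeff : Fin 6 → Fin 6 → Fin 6 → ℝ :=
  ![![0, ![0, 0, 0, 0, 0, 1], ![0, 0, 0, 0, -1, 0], ![0, 0, 0, 1, 0, 0], 0, 0],
    ![![0, 0, 0, 0, 0, -1], 0, ![0, 0, 1, 0, 0, 0], ![0, -1, 0, 0, 0, 0], 0, 0],
    ![![0, 0, 0, 0, 1, 0], ![0, 0, -1, 0, 0, 0], 0, ![1, 0, 0, 0, 0, 0], 0, 0],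
    ![![0, 0, 0, -1, 0, 0], ![0, 1, 0, 0, 0, 0], ![-1, 0, 0, 0, 0, 0], 0, 0, 0],
    0, 0]

theorem Frame.wedge_four_vec (B : Frame) (x : V6) (k l : Fin 6) (v w : V6) :
    wedge ![B.co 0 x, B.co 1 x, B.co 2 x, B.co 3 x] ![B.vec k x, B.vec l x, v, w] =
      horizontalForm (starCoeff k l) (fun a => B.co a x v) (fun a => B.co a x w) := by
  simp only [wedge_four_apply, wedge22, wedge_two_apply, Matrix.cons_val, B.dual]
  fin_cases k <;> fin_cases l <;> simp [starCoeff, horizontalForm] <;> ring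

set_option maxHeartbeats 1000000 in
-- This is the contraction in `secondOrder` with `P` replaced by `ē¹²³⁴`; it is legitimate because
-- `P` is a scalar multiple of that form.
theorem sum_minusCurv_starCoeff (p A B : ℝ) (a b : Fin 6 → ℝ) :
    ∑ k, ∑ l, (horizontalForm (minusCurv p A B l k) a (rotate b) *
          (∑ i, horizontalForm (starCoeff k l) (fun j => if j = i then 1 else 0)
            (rotate fun j => if j = i then 1 else 0))
        + 2 * ∑ i, horizontalForm (minusCurv p A B l k) a (fun j => if j = i then 1 else 0) *
          (horizontalForm (starCoeff k l) b (fun j => if j = i then 1 else 0)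
            - horizontalForm (starCoeff k l) (rotate b)
              (rotate fun j => if j = i then 1 else 0))) =
      (24 * p ^ 2 + 96 * (2 * A ^ 2 + B ^ 2)) * (a 0 * b 0)
      + (40 * p ^ 2 + 48 * (2 * A ^ 2 + B ^ 2)) * (a 1 * b 1 + a 2 * b 2 + a 3 * b 3) := by
  -- The trace with `J` sees only the component along the Kähler form of the base.
  have h1 (c : Fin 6 → ℝ) : ∑ i, horizontalForm c (fun j => if j = i then 1 else 0)
      (rotate fun j => if j = i then 1 else 0) = -2 * (c 0 + c 5) := by
    simp [horizontalForm, rotate, Fin.sum_univ_six]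
    ring
  -- Subtracting the `J`-rotated term keeps the part of type (2,0) + (0,2), with components `d 1 - d
  -- 4` and `d 2 + d 3`. With the trace in `h1` these make up the self-dual part, the obstruction to
  -- being an instanton.
  have h2 (c d : Fin 6 → ℝ) :
      ∑ i, horizontalForm c a (fun j => if j = i then 1 else 0) *
          (horizontalForm d b (fun j => if j = i then 1 else 0)
            - horizontalForm d (rotate b) (rotate fun j => if j = i then 1 else 0)) =
        (-c 0 * a 1 - c 1 * a 2 - c 2 * a 3) * ((d 4 - d 1) * b 2 + (-d 2 - d 3) * b 3)
        + (c 0 * a 0 - c 3 * a 2 - c 4 * a 3) * ((-d 3 - d 2) * b 2 + (d 1 - d 4) * b 3)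
        + (c 1 * a 0 + c 3 * a 1 - c 5 * a 3) * ((d 1 - d 4) * b 0 + (d 3 + d 2) * b 1)
        + (c 2 * a 0 + c 4 * a 1 + c 5 * a 2) * ((d 2 + d 3) * b 0 + (d 4 - d 1) * b 1) := by
    simp [horizontalForm, rotate, Fin.sum_univ_six]
    ring
  simp only [h1, h2]
  simp [Fin.sum_univ_six, starCoeff, minusCurv, horizontalForm, rotate]
  ring

theorem IsDilaton.secondOrder_eq (h : IsDilaton s t α f p U) (hs : s ≠ 0) {l : Fin 3 → ℝ}
    (hl : 4 * kappaSq s = α ^ 2 * (1 + kappaSq s) * ∑ i, l i ^ 2) {x : V6} (hx : x ∈ U)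
    (X Y : V6) {a b : Fin 6 → ℝ} (ha : a = fun i => (barFrame s t f).co i x X)
    (hb : b = fun i => (barFrame s t f).co i x Y) {P A B : ℝ} (hP : P = p x)
    (hA : A = fluxA t f x) (hB : B = fluxB s t f x) :
    α ^ 2 * (barFrame s t f).secondOrder (instanton (barFrame s t f) l) x X Y =
      -(1 / 32) * (6 * P ^ 2 + 10 * (2 * A ^ 2 + B ^ 2)) *
        ((24 * P ^ 2 + 96 * (2 * A ^ 2 + B ^ 2)) * (a 0 * b 0)
        + (40 * P ^ 2 + 48 * (2 * A ^ 2 + B ^ 2)) * (a 1 * b 1 + a 2 * b 2 + a 3 * b 3)) := by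
  have hα : α ^ 2 ≠ 0 := fun h0 => by simpa [h0] using h.norm_sq x hx
  have hform (v : Fin 4 → V6) :
      (barFrame s t f).anomalyForm (instanton (barFrame s t f) l) x v =
      (α ^ 2)⁻¹ * (4 * (6 * p x ^ 2 + 20 * fluxA t f x ^ 2 + 10 * fluxB s t f x ^ 2)) *
        wedge ![(barFrame s t f).co 0 x, (barFrame s t f).co 1 x, (barFrame s t f).co 2 x,
          (barFrame s t f).co 3 x] v := by
    rw [mul_assoc, ← h.anomalyForm_eq hs hl hx v, inv_mul_cancel_left₀ hα]
  rw [Frame.secondOrder, ← sum_minusCurv_starCoeff]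
  simp only [hform, Frame.wedge_four_vec, h.curvature_nablaMinus hx, Frame.co_J,
    (barFrame s t f).dual, ← ha, ← hb, ← hP, ← hA, ← hB]
  -- The scalar `K`, with `P = K ē¹²³⁴`, is pulled out of all sums so that the purely algebraic
  -- contraction applies.
  generalize hK : (α ^ 2)⁻¹ * (4 * (6 * P ^ 2 + 20 * A ^ 2 + 10 * B ^ 2)) = K
  have hK' : α ^ 2 * K = 4 * (6 * P ^ 2 + 20 * A ^ 2 + 10 * B ^ 2) := by
    rw [← hK, mul_inv_cancel_left₀ hα]
  simp only [← mul_sub, ← Finset.mul_sum, mul_left_comm _ K, ← mul_add]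
  have key (S : ℝ) : K * (α ^ 2 * (-(1 / 128) * S)) =
      -(1 / 32) * (6 * P ^ 2 + 10 * (2 * A ^ 2 + B ^ 2)) * S := by
    linear_combination (-(1 / 128) * S) * hK'
  exact key _

/-- The mixed terms of `H²` cancel against those of the Hessian, and the vertical ones against the
Ricci tensor. Only horizontal diagonal terms are left, and on these the first integral and the
choice of `|λ|` are used. -/
theorem IsDilaton.einstein_eq (h : IsDilaton s t α f p U) (hs : s ≠ 0) {l : Fin 3 → ℝ}
    (hl : 4 * kappaSq s = α ^ 2 * (1 + kappaSq s) * ∑ i, l i ^ 2) {x : V6} (hx : x ∈ U)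
    (X Y : V6) :
    (barFrame s t f).einstein f (instanton (barFrame s t f) l) (-α ^ 2) x X Y =
      (-α ^ 2) ^ 2 * (barFrame s t f).secondOrder (instanton (barFrame s t f) l) x X Y := by
  obtain ⟨a, ha⟩ : ∃ a, a = fun i => (barFrame s t f).co i x X := ⟨_, rfl⟩
  obtain ⟨b, hb⟩ : ∃ b, b = fun i => (barFrame s t f).co i x Y := ⟨_, rfl⟩
  have hflux := sum_fluxCoeff (p x) (fluxA t f x) (fluxB s t f x) a b
  simp only [ha, hb, ← h.flux_apply_vec_vec hx] at hflux
  have hric := h.ricci_eq hx X Y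
  have h2 := h.secondOrder_eq hs hl hx X Y ha hb rfl rfl rfl
  have h3 := h.norm_sq x hx
  have h4 := fluxA_fluxB_instanton (t := t) (f := f) hs hl x
  rw [Frame.einstein, Frame.fluxInner, hric, hflux, h.hessian_eq hx X Y ha hb,
    h.curvInner_nablaMinus hx X Y ha hb rfl rfl rfl, h.curvInner_instanton hx l X Y ha hb,
    show (-α ^ 2) ^ 2 * (barFrame s t f).secondOrder (instanton (barFrame s t f) l) x X Y =
      α ^ 2 * (α ^ 2 * (barFrame s t f).secondOrder (instanton (barFrame s t f) l) x X Y) by ring,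
    h2]
  subst ha hb
  simp only [Fin.sum_univ_six, Matrix.cons_val]
  generalize p x = p, fluxA t f x = A, fluxB s t f x = B,
    (barFrame s t f).co 0 x X = a0, (barFrame s t f).co 1 x X = a1,
    (barFrame s t f).co 2 x X = a2, (barFrame s t f).co 3 x X = a3,
    (barFrame s t f).co 4 x X = a4, (barFrame s t f).co 5 x X = a5,
    (barFrame s t f).co 0 x Y = b0, (barFrame s t f).co 1 x Y = b1,
    (barFrame s t f).co 2 x Y = b2, (barFrame s t f).co 3 x Y = b3,
    (barFrame s t f).co 4 x Y = b4, (barFrame s t f).co 5 x Y = b5, ∑ i, l i ^ 2 = Λ at *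
  linear_combination (3 * (p ^ 2 + 2 * A ^ 2 + B ^ 2) * (a0 * b0 + a1 * b1 + a2 * b2 + a3 * b3)) * h3
    + (1 / 2 * (a0 * b0 + a1 * b1 + a2 * b2 + a3 * b3)) * h4

/-! ### The equations for the flux and the gauge field -/

theorem isLinearFamily_fluxCoeff : IsLinearFamily fluxCoeff := by
  intro p A B i j k
  have h := plusCoeff_add_minusCoeff
  have h1 := isLinearFamily_lcCoeff p A B i j k
  have h2 := isLinearFamily_minusCoeff p A B i j k
  simp only [fluxCoeff]
  linear_combination h p A B i j k - h 1 0 0 i j k * p - h 0 1 0 i j k * A - h 0 0 1 i j k * B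
    + 2 * h1 - 2 * h2

theorem IsDilaton.hasFDerivAt_exp (h : IsDilaton s t α f p U) {x : V6} (hx : x ∈ U) :
    HasFDerivAt (fun y => Real.exp (-2 * f y))
      ((-2 * p x * Real.exp (-2 * f x)) • (barFrame s t f).co 0 x) x := by
  refine (((h.hasFDerivAt x hx).const_mul (-2)).exp).congr_fderiv ?_
  ext v
  simp
  ring

set_option maxHeartbeats 4000000 in
-- The equation for the flux with `e^{-2f}` divided out: a coefficient `C` of `H` contributes its
-- derivative along `ē₁` minus `2pC`.
theorem sum_codiff_fluxCoeff (p A B : ℝ) (a b : Fin 6) :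
    ∑ k, ((if 0 = k then fluxCoeff (6 * A ^ 2 + 3 * B ^ 2) (-2 * p * A) (-2 * p * B) b a k
        - 2 * p * fluxCoeff p A B b a k else 0)
      - ∑ l, (lcCoeff p A B l k k * fluxCoeff p A B b a l
        + lcCoeff p A B l a k * fluxCoeff p A B b l k
        + lcCoeff p A B l b k * fluxCoeff p A B l a k)) = 0 := by
  fin_cases a <;> fin_cases b <;>
    simp [fluxCoeff, plusCoeff, minusCoeff, lcCoeff, Fin.sum_univ_six] <;> ring

theorem IsDilaton.codiff_flux (h : IsDilaton s t α f p U) {x : V6} (hx : x ∈ U) (a b : Fin 6) :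
    (barFrame s t f).codiff3 (fun y => Real.exp (-2 * f y) • (barFrame s t f).flux y) x a b =
      0 := by
  have hval (y : V6) (hy : y ∈ U) (i j k : Fin 6) : (Real.exp (-2 * f y) • (barFrame s t f).flux y)
      ![(barFrame s t f).vec k y, (barFrame s t f).vec j y, (barFrame s t f).vec i y] =
      Real.exp (-2 * f y) * fluxCoeff (p y) (fluxA t f y) (fluxB s t f y) i j k := by
    rw [ContinuousAlternatingMap.smul_apply, h.flux_vec hy, smul_eq_mul, fluxCoeff]
  have hdir (k : Fin 6) : (barFrame s t f).dir k (fun y => (Real.exp (-2 * f y) •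
      (barFrame s t f).flux y) ![(barFrame s t f).vec k y, (barFrame s t f).vec a y,
        (barFrame s t f).vec b y]) x = Real.exp (-2 * f x) * (if 0 = k then
        fluxCoeff (6 * fluxA t f x ^ 2 + 3 * fluxB s t f x ^ 2) (-2 * p x * fluxA t f x)
          (-2 * p x * fluxB s t f x) b a k
        - 2 * p x * fluxCoeff (p x) (fluxA t f x) (fluxB s t f x) b a k else 0) := by
    have h1 : (fun y => (Real.exp (-2 * f y) • (barFrame s t f).flux y)
        ![(barFrame s t f).vec k y, (barFrame s t f).vec a y, (barFrame s t f).vec b y]) =ᶠ[𝓝 x]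
        fun y => Real.exp (-2 * f y) * fluxCoeff (p y) (fluxA t f y) (fluxB s t f y) b a k := by
      filter_upwards [h.isOpen.mem_nhds hx] with y hy using hval y hy b a k
    rw [Frame.dir, h1.fderiv_eq, ((h.hasFDerivAt_exp hx).fun_mul
      (h.hasFDerivAt_coeff hx isLinearFamily_fluxCoeff b a k)).fderiv]
    simp only [add_apply, smul_apply, (barFrame s t f).dual, smul_eq_mul]
    split_ifs <;> ring
  rw [Frame.codiff3, neg_eq_zero]
  simp only [hdir, hval x hx, h.leviCivita_vec hx]
  refine Eq.trans (Finset.sum_congr rfl fun k _ => ?_) ((Finset.mul_sum _ _ _).symm.trans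
    ((congrArg (Real.exp (-2 * f x) * ·) (sum_codiff_fluxCoeff (p x) (fluxA t f x)
      (fluxB s t f x) a b)).trans (mul_zero _)))
  simp only [Finset.mul_sum, mul_sub, mul_add, mul_left_comm (Real.exp (-2 * f x))]

set_option maxHeartbeats 1000000 in
-- The same for `dē⁶`. Its components already scale like `e^{-2f}`, so with the prefactor they scale
-- like `e^{-4f}`, whence the logarithmic derivative `-4p`.
theorem sum_codiff_dCoframe (p A B : ℝ) (a : Fin 6) :
    ∑ k, ((if 0 = k then (-4 * p) *
        horizontalForm ![-2 * A, 0, -B, B, 0, 2 * A] (fun i => if i = k then 1 else 0)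
          (fun i => if i = a then 1 else 0) else 0)
      - ∑ l, (plusCoeff p A B l k k * horizontalForm ![-2 * A, 0, -B, B, 0, 2 * A]
          (fun i => if i = l then 1 else 0) (fun i => if i = a then 1 else 0)
        + plusCoeff p A B l a k * horizontalForm ![-2 * A, 0, -B, B, 0, 2 * A]
          (fun i => if i = k then 1 else 0) (fun i => if i = l then 1 else 0))) = 0 := by
  fin_cases a <;> simp [horizontalForm, plusCoeff, Fin.sum_univ_six] <;> ring

theorem IsDilaton.codiff_gauge (h : IsDilaton s t α f p U) {x : V6} (hx : x ∈ U) (l : Fin 3 → ℝ)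
    (i j a : Fin 6) :
    (barFrame s t f).codiffGauge (instanton (barFrame s t f) l)
      (fun i j y => Real.exp (-2 * f y) • curvature (instanton (barFrame s t f) l) i j y) x i j a =
      0 := by
  have hval (y : V6) (hy : y ∈ U) (i j k a : Fin 6) : (Real.exp (-2 * f y) •
      curvature (instanton (barFrame s t f) l) i j y)
      ![(barFrame s t f).vec k y, (barFrame s t f).vec a y] =
      Real.exp (-2 * f y) * (instantonMatrix l i j * horizontalForm
        ![-2 * fluxA t f y, 0, -fluxB s t f y, fluxB s t f y, 0, 2 * fluxA t f y]
        (fun i => if i = k then 1 else 0) (fun i => if i = a then 1 else 0)) := by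
    rw [ContinuousAlternatingMap.smul_apply, h.curvature_instanton hy, smul_eq_mul]
    simp only [(barFrame s t f).dual]
  have hdir (k : Fin 6) : (barFrame s t f).dir k (fun y => (Real.exp (-2 * f y) •
      curvature (instanton (barFrame s t f) l) i j y)
      ![(barFrame s t f).vec k y, (barFrame s t f).vec a y]) x =
      Real.exp (-2 * f x) * instantonMatrix l i j * (if 0 = k then (-4 * p x) *
        horizontalForm
          ![-2 * fluxA t f x, 0, -fluxB s t f x, fluxB s t f x, 0, 2 * fluxA t f x]
          (fun i => if i = k then 1 else 0) (fun i => if i = a then 1 else 0) else 0) := by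
    have h1 : (fun y => (Real.exp (-2 * f y) • curvature (instanton (barFrame s t f) l) i j y)
        ![(barFrame s t f).vec k y, (barFrame s t f).vec a y]) =ᶠ[𝓝 x]
        fun y => instantonMatrix l i j * (horizontalForm ![-2 * t, 0, -(t / s), t / s, 0, 2 * t]
          (fun i => if i = k then 1 else 0) (fun i => if i = a then 1 else 0)) *
          (Real.exp (-2 * f y) * Real.exp (-2 * f y)) := by
      filter_upwards [h.isOpen.mem_nhds hx] with y hy
      rw [hval y hy]
      simp only [horizontalForm, fluxA, fluxB, Matrix.cons_val]
      ring
    rw [Frame.dir, h1.fderiv_eq, (((h.hasFDerivAt_exp hx).fun_mul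
      (h.hasFDerivAt_exp hx)).const_mul _).fderiv]
    simp only [add_apply, smul_apply, (barFrame s t f).dual, smul_eq_mul]
    split_ifs
    · simp only [horizontalForm, fluxA, fluxB, Matrix.cons_val]
      ring
    · simp
  rw [Frame.codiffGauge, neg_eq_zero]
  simp only [hdir, hval x hx, h.nablaPlus_vec hx]
  refine Eq.trans (Finset.sum_congr rfl fun k _ => ?_) ((Finset.mul_sum _ _ _).symm.trans
    ((congrArg (Real.exp (-2 * f x) * instantonMatrix l i j * ·) (sum_codiff_dCoframe (p x)
      (fluxA t f x) (fluxB s t f x) a)).trans (mul_zero _)))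
  -- The gauge commutator vanishes term by term: connection and curvature are scalar forms times the
  -- same constant matrix.
  refine (congrArg₂ (· + ·) ?_ (Finset.sum_eq_zero fun m _ => ?_)).trans (add_zero _)
  · simp only [Finset.mul_sum, mul_sub, mul_add]
    congr 1
    refine Finset.sum_congr rfl fun m _ => ?_
    ring
  · simp only [instanton, smul_apply, smul_eq_mul]
    ring

theorem IsDilaton.solvesMotionFirstOrder (h : IsDilaton s t α f p U) (hs : s ≠ 0) {l : Fin 3 → ℝ}
    (hl : 4 * kappaSq s = α ^ 2 * (1 + kappaSq s) * ∑ i, l i ^ 2) :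
    (barFrame s t f).SolvesMotionFirstOrder U f (instanton (barFrame s t f) l) (-α ^ 2) where
  einstein _ hx X Y := h.einstein_eq hs hl hx X Y
  flux _ hx a b := h.codiff_flux hx a b
  gauge _ hx i j a := h.codiff_gauge hx l i j a

end

end Het
end

noncomputable section

namespace Het

/-! ### The parallel spinor -/

/-- The standard basis of the spinor space. -/
def ket (i j k : Fin 2) : Spinor := Pi.single ((i, j), k) 1

theorem σ₁_mulVec (i k : Fin 2) : σ₁ k i = if k = 1 - i then 1 else 0 := by
  fin_cases i <;> fin_cases k <;> simp [σ₁]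

theorem σ₂_mulVec (i k : Fin 2) :
    σ₂ k i = if k = 1 - i then (if i = 0 then Complex.I else -Complex.I) else 0 := by
  fin_cases i <;> fin_cases k <;> simp [σ₂]

theorem σ₃_mulVec (i k : Fin 2) : σ₃ k i = if k = i then (if i = 0 then 1 else -1) else 0 := by
  fin_cases i <;> fin_cases k <;> simp [σ₃]

theorem gamma_mulVec_ket (i j k : Fin 2) :
    (gamma 0).mulVec (ket i j k) = ket (1 - i) j k ∧
    (gamma 1).mulVec (ket i j k) = (if i = 0 then Complex.I else -Complex.I) • ket (1 - i) j k ∧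
    (gamma 2).mulVec (ket i j k) = (if i = 0 then (1 : ℂ) else -1) • ket i (1 - j) k ∧
    (gamma 3).mulVec (ket i j k) = ((if i = 0 then (1 : ℂ) else -1) *
      if j = 0 then Complex.I else -Complex.I) • ket i (1 - j) k ∧
    (gamma 4).mulVec (ket i j k) = ((if i = 0 then (1 : ℂ) else -1) *
      if j = 0 then 1 else -1) • ket i j (1 - k) ∧
    (gamma 5).mulVec (ket i j k) = (((if i = 0 then (1 : ℂ) else -1) * if j = 0 then 1 else -1) *
      if k = 0 then Complex.I else -Complex.I) • ket i j (1 - k) := by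
  refine ⟨?_, ?_, ?_, ?_, ?_, ?_⟩ <;> ext ⟨⟨a, b⟩, c⟩ <;>
    simp [ket, gamma, Matrix.kroneckerMap_apply, σ₁_mulVec, σ₂_mulVec, σ₃_mulVec, Pi.single_apply,
      Prod.ext_iff, Matrix.one_apply] <;>
    split_ifs <;> simp_all

/-- The pure spinor fixing the `SU(3)`-structure. -/
def vacuum : Spinor := ket 1 1 1

theorem vacuum_ne_zero : vacuum ≠ 0 := by
  intro h
  simpa [vacuum, ket] using congrFun h ((1, 1), 1)

/-- The action on `vacuum` of a skew-symmetric matrix, viewed as an element of the Clifford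
algebra. -/
theorem sum_gamma_mulVec_vacuum {c : Fin 6 → Fin 6 → ℝ} (hc : ∀ i j, c j i = -c i j) :
    ∑ i, ∑ j, (c i j : ℂ) • (gamma i * gamma j).mulVec vacuum =
      -- The four coefficients are the trace against the Kähler form and the three components of
      -- type (2,0). They vanish together exactly when the skew matrix lies in `su(3)`.
      (-2 * Complex.I * (c 0 1 + c 2 3 + c 4 5)) • ket 1 1 1
      + (-2 * ((c 0 2 - c 1 3) - Complex.I * (c 0 3 + c 1 2))) • ket 0 0 1
      + (2 * ((c 0 4 - c 1 5) - Complex.I * (c 0 5 + c 1 4))) • ket 0 1 0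
      + (-2 * ((c 2 4 - c 3 5) - Complex.I * (c 2 5 + c 3 4))) • ket 1 0 0 := by
  have h0 (i : Fin 6) : c i i = 0 := by linarith [hc i i]
  simp only [← Matrix.mulVec_mulVec, Fin.sum_univ_six, vacuum, gamma_mulVec_ket,
    Matrix.mulVec_smul, h0, hc 0 1, hc 0 2, hc 0 3, hc 0 4, hc 0 5, hc 1 2, hc 1 3, hc 1 4, hc 1 5,
    hc 2 3, hc 2 4, hc 2 5, hc 3 4, hc 3 5, hc 4 5, sub_self, sub_zero, if_true, one_ne_zero,
    if_false]
  match_scalars <;> ring_nf <;> simp only [Complex.I_sq] <;> ring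

theorem Frame.clifford_one (B : Frame) (x : V6) (φ : V6 [⋀^Fin 1]→L[ℝ] ℝ) (ε : Spinor) :
    B.clifford x φ ε = ∑ i, (φ (fun _ => B.vec i x) : ℂ) • (gamma i).mulVec ε := by
  rw [Frame.clifford, ← (Equiv.funUnique (Fin 1) (Fin 6)).symm.sum_comp]
  simp [Matrix.sum_mulVec, Matrix.smul_mulVec]

theorem Frame.clifford_two (B : Frame) (x : V6) (φ : V6 [⋀^Fin 2]→L[ℝ] ℝ) (ε : Spinor) :
    B.clifford x φ ε = (1 / 2 : ℂ) • ∑ i, ∑ j,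
      (φ ![B.vec i x, B.vec j x] : ℂ) • (gamma i * gamma j).mulVec ε := by
  rw [Frame.clifford, ← (finTwoArrowEquiv (Fin 6)).symm.sum_comp, Fintype.sum_prod_type]
  have h (i j : Fin 6) : (fun a => B.vec (![i, j] a) x) = ![B.vec i x, B.vec j x] := by
    funext a; fin_cases a <;> rfl
  simp [Matrix.sum_mulVec, Matrix.smul_mulVec, h]

/-- Splitting off the first gamma matrix leaves the 2-forms `i_{e_i}φ`, to which
`sum_gamma_mulVec_vacuum` applies. -/
theorem Frame.clifford_three (B : Frame) (x : V6) (φ : V6 [⋀^Fin 3]→L[ℝ] ℝ) (ε : Spinor) :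
    B.clifford x φ ε = (1 / 6 : ℂ) • ∑ i, (gamma i).mulVec (∑ j, ∑ k,
      (φ ![B.vec i x, B.vec j x, B.vec k x] : ℂ) • (gamma j * gamma k).mulVec ε) := by
  rw [Frame.clifford, ← (Fin.consEquiv fun _ : Fin 3 => Fin 6).sum_comp, Fintype.sum_prod_type]
  simp_rw [← (finTwoArrowEquiv (Fin 6)).symm.sum_comp, Fintype.sum_prod_type]
  have h (i j k : Fin 6) : (fun a => B.vec (![i, j, k] a) x) =
      ![B.vec i x, B.vec j x, B.vec k x] := by
    funext a; fin_cases a <;> rfl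
  simp [Matrix.sum_mulVec, Matrix.smul_mulVec, Matrix.mulVec_sum, Matrix.mulVec_smul, h,
    Fin.consEquiv, Nat.factorial]

theorem Frame.cliffordVec_J_vacuum (B : Frame) (x v : V6) :
    B.cliffordVec x (B.J x v) vacuum = Complex.I • B.cliffordVec x v vacuum := by
  simp only [Frame.cliffordVec, B.co_J, Matrix.add_mulVec, Matrix.smul_mulVec, Fin.sum_univ_six,
    vacuum, gamma_mulVec_ket, rotate, Matrix.cons_val, sub_self, one_ne_zero, if_false]
  match_scalars <;> ring_nf <;> simp only [Complex.I_sq] <;> ring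

section

variable {s t α : ℝ} {f p : V6 → ℝ} {U : Set V6}

/-- The spinor is constant in the frame, so only the connection term matters, and it is
`su(3)`-valued. -/
theorem IsDilaton.gravitino (h : IsDilaton s t α f p U) {x : V6} (hx : x ∈ U) (v : V6) :
    spinNabla (barFrame s t f).nablaPlus (fun _ => vacuum) x v = 0 := by
  have hc (i j : Fin 6) := ((h.isHermitianConn_nablaPlus x hx v).1 j i)
  rw [spinNabla, sum_gamma_mulVec_vacuum hc]
  simp [h.nablaPlus_eq hx, Fin.sum_univ_six, plusCoeff]
  module

theorem IsDilaton.dilatino (h : IsDilaton s t α f p U) {x : V6} (hx : x ∈ U) :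
    (barFrame s t f).clifford x ((2 : ℝ) • ContinuousAlternatingMap.ofSubsingleton ℝ V6 ℝ
      (0 : Fin 1) (fderiv ℝ f x)) vacuum
      - (barFrame s t f).clifford x ((barFrame s t f).flux x) vacuum = 0 := by
  -- Each contraction `i_{ē_i}H` is a skew matrix, as the formula for the action on `vacuum`
  -- requires.
  have hskew (i j k : Fin 6) : (fun j k => fluxCoeff (p x) (fluxA t f x) (fluxB s t f x) k j i) k j =
      -(fun j k => fluxCoeff (p x) (fluxA t f x) (fluxB s t f x) k j i) j k := by
    dsimp only
    rw [fluxCoeff, fluxCoeff, ← h.flux_vec hx, ← h.flux_vec hx]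
    refine Eq.trans (congrArg ((barFrame s t f).flux x) ?_)
      (((barFrame s t f).flux x).toAlternatingMap.map_swap _ (show (1 : Fin 3) ≠ 2 by decide))
    funext a; fin_cases a <;> rfl
  rw [Frame.clifford_one, Frame.clifford_three, (h.hasFDerivAt x hx).fderiv]
  have hval (i j k : Fin 6) : (barFrame s t f).flux x ![(barFrame s t f).vec i x,
      (barFrame s t f).vec j x, (barFrame s t f).vec k x] =
      fluxCoeff (p x) (fluxA t f x) (fluxB s t f x) k j i := h.flux_vec hx k j i
  simp only [hval, sum_gamma_mulVec_vacuum (hskew _)]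
  simp only [Fin.sum_univ_six, Matrix.mulVec_add, Matrix.mulVec_smul, gamma_mulVec_ket, vacuum]
  simp [fluxCoeff, plusCoeff, minusCoeff, (barFrame s t f).dual]
  match_scalars <;> ring_nf <;> simp only [Complex.I_sq] <;> ring

theorem IsDilaton.gaugino (h : IsDilaton s t α f p U) {x : V6} (hx : x ∈ U) (l : Fin 3 → ℝ)
    (i j : Fin 6) : (barFrame s t f).clifford x
      (curvature (instanton (barFrame s t f) l) i j x) vacuum = 0 := by
  rw [Frame.clifford_two, sum_gamma_mulVec_vacuum fun a b => ?_]
  · simp [h.curvature_instanton hx, (barFrame s t f).dual, horizontalForm]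
  · refine Eq.trans (congrArg (curvature (instanton (barFrame s t f) l) i j x) ?_)
      ((curvature (instanton (barFrame s t f) l) i j x).toAlternatingMap.map_swap _
        (show (0 : Fin 2) ≠ 1 by decide))
    funext a; fin_cases a <;> rfl

theorem IsDilaton.isKillingSpinor (h : IsDilaton s t α f p U) (l : Fin 3 → ℝ) :
    (barFrame s t f).IsKillingSpinor U f (instanton (barFrame s t f) l) fun _ => vacuum where
  smooth := contDiffOn_const
  ne_zero _ _ := vacuum_ne_zero
  gravitino _ hx v := h.gravitino hx v
  dilatino _ hx := h.dilatino hx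
  gaugino _ hx i j := h.gaugino hx l i j

end

end Het
end

noncomputable section

namespace Het

/-! ### The dilaton built from the Weierstrass function -/

section

variable {s t α : ℝ} {L : PeriodPair}

theorem aParam_pos (hs : s ≠ 0) (ht : t ≠ 0) (hα : 0 < α) : 0 < aParam s t α := by
  have : 0 < kappaSq s := by unfold kappaSq; positivity
  unfold aParam
  positivity

/-- This is the reason for the value of `a`: it makes `3A² + (3/2)B²` equal to `a²/(α²u²)`, the part
of the first integral that `℘` has to match. -/
theorem aParam_sq (hα : α ≠ 0) : α ^ 2 * aParam s t α ^ 2 = 3 * t ^ 2 + 3 / 2 * (t / s) ^ 2 := by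
  have h : 0 ≤ kappaSq s := by unfold kappaSq; positivity
  rw [aParam, div_pow, mul_pow, mul_pow, Real.sq_sqrt h, sq_abs, Real.sq_sqrt (by norm_num)]
  rw [mul_div_cancel₀ _ (pow_ne_zero 2 hα), kappaSq]
  ring

theorem isOpen_regular (L : PeriodPair) : IsOpen (regular L) := by
  have hc : IsClosed (Set.range fun n : ℤ => (n : ℝ) * L.ω₁.re) := by
    have h : Set.range (fun n : ℤ => (n : ℝ) * L.ω₁.re) =
        (AddSubgroup.zmultiples L.ω₁.re : Set ℝ) := by
      ext r; simp [AddSubgroup.mem_zmultiples_iff]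
    rw [h]
    exact AddSubgroup.isClosed_of_discrete
  have h : regular L = (fun x : V6 => x 0) ⁻¹' (Set.range fun n : ℤ => (n : ℝ) * L.ω₁.re)ᶜ := by
    ext x; simp [regular, eq_comm]
  rw [h]
  exact hc.isOpen_compl.preimage (continuous_apply 0)

namespace IsPeriodPairFor

theorem realSlice_pos (hL : IsPeriodPairFor L (aParam s t α)) (hs : s ≠ 0) (ht : t ≠ 0)
    (hα : 0 < α) {r : ℝ} (hr : ∀ n : ℤ, r ≠ n * L.ω₁.re) : 0 < realSlice L r :=
  (aParam_pos hs ht hα).trans_le (hL.le_realSlice (aParam_pos hs ht hα) hr)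

theorem exp_dilaton (hL : IsPeriodPairFor L (aParam s t α)) (hs : s ≠ 0) (ht : t ≠ 0)
    (hα : 0 < α) {x : V6} (hx : x ∈ regular L) :
    Real.exp (2 * dilaton α L x) = α ^ 2 * realSlice L (x 0) := by
  have hu := hL.realSlice_pos hs ht hα hx
  rw [dilaton, ← mul_assoc, mul_one_div_cancel two_ne_zero, one_mul, Real.exp_log (by positivity)]

theorem hasFDerivAt_dilaton (hL : IsPeriodPairFor L (aParam s t α)) (hs : s ≠ 0) (ht : t ≠ 0)
    (hα : 0 < α) {x : V6} (hx : x ∈ regular L) :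
    HasFDerivAt (dilaton α L) ((realSliceDeriv L (x 0) / (2 * realSlice L (x 0))) • dx 0) x := by
  have hu := hL.realSlice_pos hs ht hα hx
  have h0 : HasFDerivAt (fun y : V6 => y 0) (dx 0) x :=
    (ContinuousLinearMap.proj 0 : V6 →L[ℝ] ℝ).hasFDerivAt
  have h1 := ((((hL.hasDerivAt_realSlice hx).const_mul (α ^ 2)).log
    (by positivity)).const_mul (1 / 2)).comp_hasFDerivAt x h0
  refine h1.congr_fderiv ?_
  ext v
  simp only [smul_apply, smul_eq_mul]
  field_simp

theorem contDiffOn_dilaton (hL : IsPeriodPairFor L (aParam s t α)) (hs : s ≠ 0) (ht : t ≠ 0)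
    (hα : 0 < α) : ContDiffOn ℝ ∞ (dilaton α L) (regular L) := by
  intro x hx
  have hu := hL.realSlice_pos hs ht hα hx
  have h0 : ContDiffAt ℝ ∞ (fun y : V6 => y 0) x :=
    (ContinuousLinearMap.proj 0 : V6 →L[ℝ] ℝ).contDiff.contDiffAt
  have h1 : ContDiffAt ℝ ∞ (fun y : V6 => realSlice L (y 0)) x :=
    ContDiffAt.comp (g := realSlice L) x (hL.contDiffAt_realSlice hx) h0
  exact (contDiffAt_const.mul ((contDiffAt_const.mul h1).log (by positivity))).contDiffWithinAt

/-- Put `u = ℘(x¹)`, so `e^{2f} = α²u`. The cubic equation gives `p² = (1 - a²/u²)/α²`, which is the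
first integral. The equation `u'' = 6u² - 2a²` gives `(f'' - f'²)e^{-2f} = 2a²/(α²u²) = 6A² + 3B²`.
-/
theorem isDilaton (hL : IsPeriodPairFor L (aParam s t α)) (hs : s ≠ 0) (ht : t ≠ 0)
    (hα : 0 < α) : IsDilaton s t α (dilaton α L)
    (fun x => realSliceDeriv L (x 0) / (2 * realSlice L (x 0)) * Real.exp (-dilaton α L x))
    (regular L) where
  isOpen := isOpen_regular L
  hasFDerivAt x hx := by
    refine (hL.hasFDerivAt_dilaton hs ht hα hx).congr_fderiv ?_
    have h : Real.exp (-dilaton α L x) * Real.exp (dilaton α L x) = 1 := by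
      rw [← Real.exp_add]; simp
    ext v
    simp only [barFrame, weight, e, smul_apply, smul_eq_mul, Matrix.cons_val, show (0 : Fin 6) < 4 by decide,
      if_true]
    linear_combination (-(realSliceDeriv L (x 0) / (2 * realSlice L (x 0)) * dx 0 v)) * h
  hasFDerivAt_deriv x hx := by
    have hu := hL.realSlice_pos hs ht hα hx
    have h0 : HasFDerivAt (fun y : V6 => y 0) (dx 0) x :=
      (ContinuousLinearMap.proj 0 : V6 →L[ℝ] ℝ).hasFDerivAt
    have h1 := ((hL.hasDerivAt_realSliceDeriv hx).div ((hL.hasDerivAt_realSlice hx).const_mul 2)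
      (by positivity)).comp_hasFDerivAt x h0
    have h2 := (hL.hasFDerivAt_dilaton hs ht hα hx).neg.exp
    refine (h1.mul h2).congr_fderiv ?_
    have h3 := hL.realSliceDeriv_sq hx
    have h4 := hL.exp_dilaton hs ht hα hx
    have ha := aParam_sq (s := s) (t := t) hα.ne'
    have h5 : Real.exp (-2 * dilaton α L x) = Real.exp (-dilaton α L x) ^ 2 := by
      rw [← Real.exp_nat_mul]; congr 1; push_cast; ring
    have h6 : Real.exp (2 * dilaton α L x) = (Real.exp (-dilaton α L x) ^ 2)⁻¹ := by
      rw [← h5, ← Real.exp_neg]; congr 1; ring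
    have h7 : Real.exp (dilaton α L x) = (Real.exp (-dilaton α L x))⁻¹ := by
      rw [← Real.exp_neg, neg_neg]
    have hE := Real.exp_pos (-dilaton α L x)
    ext v
    simp only [barFrame, weight, e, smul_apply, smul_eq_mul, Matrix.cons_val,
      show (0 : Fin 6) < 4 by decide, if_true, fluxA, fluxB, add_apply, neg_apply,
      Function.comp, Pi.div_apply, h5, h7]
    rw [h6] at h4
    generalize Real.exp (-dilaton α L x) = E at *
    generalize realSlice L (x 0) = u at *
    generalize realSliceDeriv L (x 0) = u' at *
    generalize aParam s t α = a at *
    generalize t / s = b at *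
    -- Here `E = e^{-f}`. After clearing denominators the identity follows from the cubic for `u'`,
    -- the value of `a`, and this normalisation.
    have h8 : 1 = α ^ 2 * u * E ^ 2 := by rw [← h4]; field_simp
    field_simp
    linear_combination (-3 * dx 0 v) * h3 + (8 * E ^ 2 * u ^ 2 * dx 0 v) * ha
      + (8 * a ^ 2 * u * dx 0 v) * h8
  norm_sq x hx := by
    have hu := hL.realSlice_pos hs ht hα hx
    have h3 := hL.realSliceDeriv_sq hx
    have h4 := hL.exp_dilaton hs ht hα hx
    have ha := aParam_sq (s := s) (t := t) hα.ne'
    have h5 : Real.exp (-2 * dilaton α L x) = (α ^ 2 * realSlice L (x 0))⁻¹ := by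
      rw [← h4, ← Real.exp_neg]; congr 1; ring
    have h6 : Real.exp (-dilaton α L x) ^ 2 = (α ^ 2 * realSlice L (x 0))⁻¹ := by
      rw [← h5, ← Real.exp_nat_mul]; congr 1; push_cast; ring
    simp only [fluxA, fluxB, h5, mul_pow, h6, div_pow, h3]
    field_simp
    rw [div_pow] at ha
    field_simp at ha
    linear_combination (-2) * ha

theorem single_mem_regular (hL : IsPeriodPairFor L (aParam s t α))
    {r : ℝ} (hr : r ∈ Set.Ioo 0 L.ω₁.re) :
    (Pi.single 0 r : V6) ∈ regular L := by
  intro n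
  simpa using hL.ne_of_mem_Ioo hr n

/-- The dilaton is unbounded near the pole at `0`. -/
theorem dilaton_not_constant (hL : IsPeriodPairFor L (aParam s t α)) (hs : s ≠ 0) (ht : t ≠ 0)
    (hα : 0 < α) : ¬∃ c : ℝ, ∀ x ∈ regular L, dilaton α L x = c := by
  rintro ⟨c, hc⟩
  have h1 : Filter.Tendsto (realSlice L) (𝓝[>] 0) Filter.atTop :=
    (tendsto_realSlice_zero L).mono_left (nhdsWithin_mono _ fun r hr => ne_of_gt hr)
  obtain ⟨r, hr, hr'⟩ := ((h1.eventually_gt_atTop (Real.exp (2 * c) / α ^ 2)).and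
    (Ioo_mem_nhdsGT hL.re_pos)).exists
  have h2 := hL.exp_dilaton hs ht hα (hL.single_mem_regular hr')
  rw [hc _ (hL.single_mem_regular hr'), Pi.single_eq_same] at h2
  rw [div_lt_iff₀ (by positivity)] at hr
  linarith

theorem flux_ne_zero (hL : IsPeriodPairFor L (aParam s t α)) (hs : s ≠ 0) (ht : t ≠ 0)
    (hα : 0 < α) : ∃ x ∈ regular L, (backFrame s t α L).flux x ≠ 0 := by
  have hx := hL.single_mem_regular (r := L.ω₁.re / 2) ⟨by linarith [hL.re_pos],
    by linarith [hL.re_pos]⟩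
  refine ⟨_, hx, fun h0 => ?_⟩
  have h1 := (hL.isDilaton hs ht hα).flux_vec hx 0 1 5
  rw [h0] at h1
  simp [plusCoeff, minusCoeff, fluxA, ht] at h1

theorem curvature_ne_zero (hL : IsPeriodPairFor L (aParam s t α)) (hs : s ≠ 0) (ht : t ≠ 0)
    (hα : 0 < α) {l : Fin 3 → ℝ}
    (hl : 4 * kappaSq s = α ^ 2 * (1 + kappaSq s) * ∑ i, l i ^ 2) :
    ∃ x ∈ regular L, ∃ i j, curvature (backInstanton s t α L l) i j x ≠ 0 := by
  have hx := hL.single_mem_regular (r := L.ω₁.re / 2) ⟨by linarith [hL.re_pos],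
    by linarith [hL.re_pos]⟩
  by_contra! h0
  -- On `(ē₁, ē₂)` the form `dē⁶` equals `-2A ≠ 0`, so flatness annihilates the first row of the
  -- matrix, that is `λ`; this contradicts `4κ² > 0`.
  have h1 (i : Fin 6) : instantonMatrix l 0 i = 0 := by
    have h2 := (hL.isDilaton hs ht hα).curvature_instanton hx l 0 i
      ((backFrame s t α L).vec 0 (Pi.single 0 (L.ω₁.re / 2)))
      ((backFrame s t α L).vec 1 (Pi.single 0 (L.ω₁.re / 2)))
    rw [h0 _ hx] at h2
    simpa [horizontalForm, (backFrame s t α L).dual, fluxA, ht] using h2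
  have hk : 0 < kappaSq s := by unfold kappaSq; positivity
  have h2 := h1 1
  have h3 := h1 2
  have h4 := h1 3
  simp only [instantonMatrix, Matrix.of_apply, Matrix.cons_val, neg_eq_zero] at h2 h3 h4
  rw [Fin.sum_univ_three, h2, h3, h4] at hl
  linarith

theorem backFrame_metric (hL : IsPeriodPairFor L (aParam s t α)) (hs : s ≠ 0) (ht : t ≠ 0)
    (hα : 0 < α) {x : V6} (hx : x ∈ regular L) (v w : V6) :
    (backFrame s t α L).metric x v w =
      α ^ 2 * baseMetric L ![x 0, x 1, x 2, x 3] ![v 0, v 1, v 2, v 3] ![w 0, w 1, w 2, w 3]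
        + e s t 4 x v * e s t 4 x w + e s t 5 x v * e s t 5 x w := by
  have h : Real.exp (dilaton α L x) * Real.exp (dilaton α L x) = α ^ 2 * realSlice L (x 0) := by
    rw [← hL.exp_dilaton hs ht hα hx, ← Real.exp_add]; congr 1; ring
  simp only [Frame.metric, barFrame, Fin.sum_univ_six, weight, baseMetric, euclid4]
  simp [e, Fin.sum_univ_four]
  linear_combination (v 0 * w 0 + v 1 * w 1 + v 2 * w 2 + v 3 * w 3) * h

end IsPeriodPairFor

end

end Het
end

noncomputable section

namespace Het

/-! ### The nilmanifold and the covering of `M⁶` -/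

section

variable {s t : ℝ}

theorem continuous_h5Mul : Continuous fun z : V6 × V6 => h5Mul s t z.1 z.2 := by
  refine continuous_pi fun i => ?_
  fin_cases i <;> simp only [h5Mul, Fin.reduceFinMk, Matrix.cons_val] <;> fun_prop

instance : T2Space (H5 s t) := inferInstanceAs (T2Space (Fin 6 → ℝ))

instance : IsTopologicalGroup (H5 s t) where
  continuous_mul := continuous_h5Mul
  continuous_inv := by
    refine continuous_pi (A := fun _ => ℝ) (X := V6) fun i => ?_
    fin_cases i
    · exact (continuous_apply (A := fun _ : Fin 6 => ℝ) 0).neg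
    · exact (continuous_apply (A := fun _ : Fin 6 => ℝ) 1).neg
    · exact (continuous_apply (A := fun _ : Fin 6 => ℝ) 2).neg
    · exact (continuous_apply (A := fun _ : Fin 6 => ℝ) 3).neg
    · change Continuous fun x : V6 => -x 4 - t / s * (x 0 * x 2 + x 1 * x 3)
      fun_prop
    · change Continuous fun x : V6 => -x 5 + 2 * t * (x 0 * x 1 - x 2 * x 3)
        + t / s * (x 0 * x 3 - x 1 * x 2)
      fun_prop

theorem hasFDerivAt_h5Mul (a x : V6) : HasFDerivAt (h5Mul s t a) (ContinuousLinearMap.pi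
    ![dx 0, dx 1, dx 2, dx 3, dx 4 - (t / s) • (a 0 • dx 2 + a 1 • dx 3),
      dx 5 + (2 * t) • (a 0 • dx 1 - a 2 • dx 3) + (t / s) • (a 0 • dx 3 - a 1 • dx 2)]) x := by
  have hc (i : Fin 6) : HasFDerivAt (fun z : V6 => z i) (dx i) x :=
    (ContinuousLinearMap.proj i : V6 →L[ℝ] ℝ).hasFDerivAt
  refine hasFDerivAt_pi.mpr fun i => ?_
  fin_cases i
  · exact (hc 0).const_add (a 0)
  · exact (hc 1).const_add (a 1)
  · exact (hc 2).const_add (a 2)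
  · exact (hc 3).const_add (a 3)
  · exact ((hc 4).const_add (a 4)).sub
      ((((hc 2).const_mul (a 0)).add ((hc 3).const_mul (a 1))).const_mul (t / s))
  · exact (((hc 5).const_add (a 5)).add
      ((((hc 1).const_mul (a 0)).sub ((hc 3).const_mul (a 2))).const_mul (2 * t))).add
      ((((hc 3).const_mul (a 0)).sub ((hc 2).const_mul (a 1))).const_mul (t / s))

theorem e_h5Mul (a x v : V6) (i : Fin 6) :
    e s t i (h5Mul s t a x) (fderiv ℝ (h5Mul s t a) x v) = e s t i x v := by
  rw [(hasFDerivAt_h5Mul a x).fderiv]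
  fin_cases i <;> simp [e, h5Mul] <;> ring

variable {Γ : Subgroup (H5 s t)} {L : PeriodPair}

theorem HasPeriod.exists_int (hΓ : HasPeriod Γ L) {a : H5 s t} (ha : a ∈ Γ) :
    ∃ n : ℤ, (a : V6) 0 = n * L.ω₁.re := by
  have h : (a : V6) 0 ∈ (fun a : H5 s t => (a : V6) 0) '' (Γ : Set (H5 s t)) := ⟨a, ha, rfl⟩
  rw [hΓ] at h
  exact h

theorem add_mem_regular {x y : V6} {n : ℤ} (h : y 0 = n * L.ω₁.re + x 0) (hx : x ∈ regular L) :
    y ∈ regular L := by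
  intro m hm
  refine hx (m - n) ?_
  rw [h] at hm
  push_cast
  linarith

theorem HasPeriod.mul_mem_regular (hΓ : HasPeriod Γ L) {a : H5 s t} (ha : a ∈ Γ) {x : V6}
    (hx : x ∈ regular L) : h5Mul s t a x ∈ regular L := by
  obtain ⟨n, hn⟩ := hΓ.exists_int ha
  exact add_mem_regular (n := n) (by simp [h5Mul, hn]) hx

theorem HasPeriod.descends_dilaton (hΓ : HasPeriod Γ L) {b : ℝ} (hL : IsPeriodPairFor L b)
    (α : ℝ) : Descends Γ L (dilaton α L) := by
  intro a ha x _
  obtain ⟨n, hn⟩ := hΓ.exists_int ha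
  have h : h5Mul s t a x 0 = n * L.ω₁.re + x 0 := by simp [h5Mul, hn]
  rw [dilaton, dilaton, h, hL.realSlice_add_period]

theorem HasPeriod.coframeDescends (hΓ : HasPeriod Γ L) {b : ℝ} (hL : IsPeriodPairFor L b)
    (α : ℝ) : CoframeDescends Γ L (backFrame s t α L) := by
  intro a ha x hx
  refine ⟨hΓ.mul_mem_regular ha hx, fun i v => ?_⟩
  simp only [barFrame, weight, smul_apply, hΓ.descends_dilaton hL α a ha x hx]
  exact congrArg _ (e_h5Mul a x v i)

theorem mk_eq_mk_iff {x y : H5 s t} : (Quotient.mk _ x : Nilmanifold Γ) = Quotient.mk _ y ↔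
    ∃ a ∈ Γ, a * y = x := by
  rw [Quotient.eq, MulAction.orbitRel_apply, MulAction.mem_orbit_iff]
  exact ⟨fun ⟨a, h⟩ => ⟨a, a.2, h⟩, fun ⟨a, ha, h⟩ => ⟨⟨a, ha⟩, h⟩⟩

theorem isQuotientCoveringMap_mk [DiscreteTopology Γ] :
    IsQuotientCoveringMap (Quotient.mk _ : H5 s t → Nilmanifold Γ) Γ := by
  refine isQuotientMap_quotient_mk'.isQuotientCoveringMap_of_subgroup Γ
    ⟨inferInstanceAs (DiscreteTopology Γ)⟩ fun {x y} => ?_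
  refine mk_eq_mk_iff.trans ?_
  constructor
  · rintro ⟨a, ha, rfl⟩
    simpa using Γ.inv_mem ha
  · intro h
    exact ⟨_, Γ.inv_mem h, by group⟩

theorem HasPeriod.preimage_M (hΓ : HasPeriod Γ L) :
    (Quotient.mk _ : H5 s t → Nilmanifold Γ) ⁻¹' M Γ L = (regular L : Set V6) := by
  ext x
  constructor
  · rintro ⟨y, hy, hxy⟩
    obtain ⟨a, ha, rfl⟩ := mk_eq_mk_iff.mp hxy.symm
    exact hΓ.mul_mem_regular ha hy
  · exact fun hx => ⟨x, hx, rfl⟩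

/-- The period condition makes the regular set saturated under `Γ`, so this is the covering of the
nilmanifold restricted over `M Γ L`. -/
theorem HasPeriod.isCoveringMap_proj (hΓ : HasPeriod Γ L) [DiscreteTopology Γ] :
    IsCoveringMap (proj Γ L) :=
  ((isQuotientCoveringMap_mk (Γ := Γ)).isCoveringMap.restrictPreimage (M Γ L)).comp_homeomorph
    (Homeomorph.setCongr hΓ.preimage_M.symm)

theorem t2Space_nilmanifold [DiscreteTopology Γ] : T2Space (Nilmanifold Γ) := by
  have := Γ.properlyDiscontinuousSMul_of_tendsto_cofinite
    (Γ.tendsto_coe_cofinite_of_discrete ⟨inferInstanceAs (DiscreteTopology Γ)⟩)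
  infer_instance

theorem t2Space_M [DiscreteTopology Γ] : T2Space (M Γ L) := by
  have := t2Space_nilmanifold (Γ := Γ)
  infer_instance

end

end Het
end

noncomputable section

namespace Het

/-! ### The torus lattices of a lattice in `H₅` -/

theorem isTorusLattice_of_finite {n : ℕ} {Λ : AddSubgroup (Fin n → ℝ)} {R : ℝ}
    (hf : {v | v ∈ Λ ∧ ‖v‖ ≤ 1}.Finite) (hR : ∀ v, ∃ a ∈ Λ, ‖a + v‖ ≤ R) : IsTorusLattice Λ := by
  constructor
  · have h0 : ({0} : Set Λ) = Subtype.val ⁻¹' ({v | v ∈ Λ ∧ ‖v‖ ≤ 1} \ {0})ᶜ ∩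
        Subtype.val ⁻¹' Metric.ball 0 1 := by
      ext v
      simp only [Set.mem_singleton_iff, Set.mem_inter_iff, Set.mem_preimage, Set.mem_compl_iff,
        Set.mem_sdiff, Set.mem_ofPred_eq, v.2, true_and, ZeroMemClass.coe_eq_zero, not_and, not_not,
        Metric.mem_ball, dist_zero_right]
      constructor
      · rintro rfl
        simp
      · exact fun h => h.1 h.2.le
    refine discreteTopology_of_isOpen_singleton_zero ?_
    rw [h0]
    exact ((hf.subset Set.sdiff_subset).isClosed.isOpen_compl.preimage continuous_subtype_val).inter
      (Metric.isOpen_ball.preimage continuous_subtype_val)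
  · refine ⟨?_⟩
    have h : (QuotientAddGroup.mk : (Fin n → ℝ) → (Fin n → ℝ) ⧸ Λ) '' Metric.closedBall 0 R =
        Set.univ := by
      refine Set.eq_univ_of_forall fun q => ?_
      obtain ⟨v, rfl⟩ := QuotientAddGroup.mk_surjective q
      obtain ⟨a, ha, hav⟩ := hR v
      refine ⟨a + v, by simpa using hav, ?_⟩
      rw [QuotientAddGroup.eq]
      simpa using Λ.neg_mem ha
    rw [← h]
    exact (isCompact_closedBall 0 R).image continuous_quot_mk

theorem exists_bound_of_span_eq_top {n : ℕ} {Λ : AddSubgroup (Fin n → ℝ)}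
    (h : Submodule.span ℝ (Λ : Set (Fin n → ℝ)) = ⊤) : ∃ R, ∀ v, ∃ a ∈ Λ, ‖a + v‖ ≤ R := by
  classical
  let b := Module.Basis.ofSpan h.ge
  have hb (i) : b i ∈ Λ := Module.Basis.ofSpan_subset h.ge ⟨i, rfl⟩
  have : Finite _ := Module.Finite.finite_basis b
  have := Fintype.ofFinite
    ((linearIndepOn_empty ℝ id).extend (Set.empty_subset (Λ : Set (Fin n → ℝ))))
  refine ⟨∑ i, ‖b i‖, fun v => ⟨-(ZSpan.floor b v : Fin n → ℝ), Λ.neg_mem ?_, ?_⟩⟩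
  · have hle : Submodule.span ℤ (Set.range b) ≤ AddSubgroup.toIntSubmodule Λ := by
      rw [Submodule.span_le]
      rintro _ ⟨i, rfl⟩
      exact hb i
    exact hle (ZSpan.floor b v).2
  · rw [neg_add_eq_sub]
    exact ZSpan.norm_fract_le (K := ℝ) b v

/-- A functional `φ` that vanishes on `Λ` satisfies `|φ(mv)| ≤ ‖φ‖R` for every `m`, because `mv` can
be moved into a ball by `Λ`. So it is zero. -/
theorem span_eq_top_of_exists_bound {n : ℕ} {Λ : AddSubgroup (Fin n → ℝ)} {R : ℝ}
    (hR : ∀ v, ∃ a ∈ Λ, ‖a + v‖ ≤ R) : Submodule.span ℝ (Λ : Set (Fin n → ℝ)) = ⊤ := by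
  by_contra hne
  obtain ⟨φ, hφ, hle⟩ := Submodule.exists_le_ker_of_lt_top _ (lt_top_iff_ne_top.mpr hne)
  obtain ⟨v, hv⟩ : ∃ v, φ v ≠ 0 := by
    by_contra! h0
    exact hφ (LinearMap.ext h0)
  let ψ : (Fin n → ℝ) →L[ℝ] ℝ := LinearMap.toContinuousLinearMap φ
  obtain ⟨m, hm⟩ := exists_nat_gt (‖ψ‖ * R / |φ v|)
  obtain ⟨a, ha, hav⟩ := hR ((m : ℝ) • v)
  have h1 : φ a = 0 := hle (Submodule.subset_span ha)
  have h2 : ψ (a + (m : ℝ) • v) = m * φ v := by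
    change φ (a + (m : ℝ) • v) = _
    simp [h1]
  have h3 := (ψ.le_opNorm (a + (m : ℝ) • v)).trans
    (mul_le_mul_of_nonneg_left hav (norm_nonneg ψ))
  rw [h2, Real.norm_eq_abs, abs_mul, Nat.abs_cast] at h3
  rw [div_lt_iff₀ (abs_pos.mpr hv)] at hm
  linarith

section

variable {s t : ℝ} {Γ : Subgroup (H5 s t)} {L : PeriodPair}

/-- A discrete subgroup of a Hausdorff group is closed, so it meets a compact ball in a finite set.
-/
theorem finite_of_discrete [DiscreteTopology Γ] (R : ℝ) :
    {a : V6 | (a : H5 s t) ∈ Γ ∧ ‖a‖ ≤ R}.Finite := by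
  have h1 := Γ.tendsto_coe_cofinite_of_discrete ⟨inferInstanceAs (DiscreteTopology Γ)⟩
  let K : Set (H5 s t) := Metric.closedBall (α := V6) 0 R
  have hK : IsCompact K := isCompact_closedBall (0 : V6) R
  have h2 : {a : Γ | (a : H5 s t) ∈ K}.Finite := by
    have h := h1 hK.compl_mem_cocompact
    rw [Filter.mem_map, Filter.mem_cofinite, ← Set.preimage_compl, compl_compl] at h
    exact h
  refine (h2.image Subtype.val).subset ?_
  rintro a ⟨ha, haR⟩
  exact ⟨⟨a, ha⟩, mem_closedBall_zero_iff.mpr haR, rfl⟩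

theorem exists_bound_of_compactSpace [CompactSpace (Nilmanifold Γ)] :
    ∃ R, ∀ x : V6, ∃ a : V6, (a : H5 s t) ∈ Γ ∧ ‖h5Mul s t a x‖ ≤ R := by
  let q : H5 s t → Nilmanifold Γ := Quotient.mk _
  have hq : IsOpenMap q := isOpenMap_quotient_mk'_mul
  have hopen (n : ℕ) : IsOpen (q '' (Metric.ball (0 : V6) n : Set V6)) :=
    hq _ (Metric.isOpen_ball (α := V6))
  obtain ⟨n, hn⟩ := isCompact_univ.elim_directed_cover
    (fun n : ℕ => q '' (Metric.ball (0 : V6) n : Set V6)) hopen (fun z _ => by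
      obtain ⟨x, rfl⟩ := Quotient.exists_rep z
      obtain ⟨n, hn⟩ := exists_nat_gt (norm (E := V6) x)
      exact Set.mem_iUnion.mpr ⟨n, x, mem_ball_zero_iff.mpr hn, rfl⟩)
    (directed_of_isDirected_le fun m n hmn =>
      Set.image_mono (Metric.ball_subset_ball (by exact_mod_cast hmn)))
  refine ⟨n, fun x => ?_⟩
  obtain ⟨y, hy, hxy⟩ := hn (Set.mem_univ (q x))
  obtain ⟨a, ha, rfl⟩ := mk_eq_mk_iff.mp hxy
  exact ⟨a, ha, (mem_ball_zero_iff.mp hy).le⟩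

/-- The projection of `H₅` onto `ℝ⁴`. -/
def toBase (x : V6) : Fin 4 → ℝ := ![x 0, x 1, x 2, x 3]

theorem norm_toBase_le (x : V6) : ‖toBase x‖ ≤ ‖x‖ := by
  refine (pi_norm_le_iff_of_nonneg (norm_nonneg x)).mpr fun i => ?_
  fin_cases i
  exacts [norm_le_pi_norm x 0, norm_le_pi_norm x 1, norm_le_pi_norm x 2, norm_le_pi_norm x 3]

theorem toBase_h5Mul (x y : V6) : toBase (h5Mul s t x y) = toBase x + toBase y := by
  funext i; fin_cases i <;> rfl

theorem toBase_mem {a : V6} (ha : (a : H5 s t) ∈ Γ) : toBase a ∈ baseLattice Γ := ⟨a, ha, rfl⟩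

theorem exists_of_mem_baseLattice {v : Fin 4 → ℝ} (hv : v ∈ baseLattice Γ) :
    ∃ a : V6, (a : H5 s t) ∈ Γ ∧ toBase a = v := by
  obtain ⟨a, ha, rfl⟩ := hv
  exact ⟨a, ha, rfl⟩

theorem exists_bound_baseLattice [CompactSpace (Nilmanifold Γ)] :
    ∃ R, ∀ v, ∃ a ∈ baseLattice Γ, ‖a + v‖ ≤ R := by
  obtain ⟨R, hR⟩ := exists_bound_of_compactSpace (Γ := Γ)
  refine ⟨R, fun v => ?_⟩
  obtain ⟨a, ha, hav⟩ := hR ![v 0, v 1, v 2, v 3, 0, 0]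
  refine ⟨_, toBase_mem ha, ?_⟩
  have h : toBase ![v 0, v 1, v 2, v 3, 0, 0] = v := by
    funext i; fin_cases i <;> rfl
  have h2 := norm_toBase_le (h5Mul s t a ![v 0, v 1, v 2, v 3, 0, 0])
  rw [toBase_h5Mul, h] at h2
  exact h2.trans hav

/-- The commutator form of `H₅`, with values in the centre. -/
def commForm (s t : ℝ) (v w : Fin 4 → ℝ) : Fin 2 → ℝ :=
  ![-(t / s * (v 0 * w 2 + v 1 * w 3 - w 0 * v 2 - w 1 * v 3)),
    2 * t * (v 0 * w 1 - v 2 * w 3 - w 0 * v 1 + w 2 * v 3)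
      + t / s * (v 0 * w 3 - v 1 * w 2 - w 0 * v 3 + w 1 * v 2)]

theorem commForm_mem {v w : Fin 4 → ℝ} (hv : v ∈ baseLattice Γ) (hw : w ∈ baseLattice Γ) :
    commForm s t v w ∈ fibreLattice Γ := by
  obtain ⟨a, ha, rfl⟩ := hv
  obtain ⟨b, hb, rfl⟩ := hw
  have h := Γ.mul_mem (Γ.mul_mem ha hb) (Γ.inv_mem (Γ.mul_mem hb ha))
  have h2 : a * b * (b * a)⁻¹ = central s t (commForm s t ![(a : V6) 0, (a : V6) 1, (a : V6) 2,
      (a : V6) 3] ![(b : V6) 0, (b : V6) 1, (b : V6) 2, (b : V6) 3]) := by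
    rw [mul_inv_eq_iff_eq_mul]
    change h5Mul s t (a : V6) b = h5Mul s t _ (h5Mul s t (b : V6) a)
    generalize (a : V6) = a
    funext i
    fin_cases i <;> simp [h5Mul, central, commForm] <;> ring
  rw [h2] at h
  exact h

/-- The fibre lattice contains the commutators of `Γ`, which are bilinear in base vectors. As the
base vectors span `ℝ⁴`, a functional killing all commutators of `Γ` kills every value of the
commutator form. -/
theorem span_fibreLattice (hs : s ≠ 0) (ht : t ≠ 0)
    (hΛ : Submodule.span ℝ (baseLattice Γ : Set (Fin 4 → ℝ)) = ⊤) :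
    Submodule.span ℝ (fibreLattice Γ : Set (Fin 2 → ℝ)) = ⊤ := by
  by_contra hne
  obtain ⟨φ, hφ, hle⟩ := Submodule.exists_le_ker_of_lt_top _ (lt_top_iff_ne_top.mpr hne)
  have hlin (w : Fin 2 → ℝ) : φ w = w 0 * φ ![1, 0] + w 1 * φ ![0, 1] := by
    have h : w = w 0 • ![1, 0] + w 1 • ![0, 1] := by
      funext i; fin_cases i <;> simp
    conv_lhs => rw [h]
    rw [map_add, map_smul, map_smul, smul_eq_mul, smul_eq_mul]
  have hzero (v w : Fin 4 → ℝ) : φ (commForm s t v w) = 0 := by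
    have h1 : v ∈ Submodule.span ℝ (baseLattice Γ : Set (Fin 4 → ℝ)) := hΛ ▸ Submodule.mem_top
    have h2 : w ∈ Submodule.span ℝ (baseLattice Γ : Set (Fin 4 → ℝ)) := hΛ ▸ Submodule.mem_top
    induction h1, h2 using Submodule.span_induction₂ with
    | mem_mem v w hv hw => exact hle (Submodule.subset_span (commForm_mem hv hw))
    | zero_left w _ => rw [hlin]; simp [commForm]
    | zero_right w _ => rw [hlin]; simp [commForm]
    | add_left x y z _ _ _ h1 h2 =>
      rw [hlin] at *; simp [commForm] at *; linear_combination h1 + h2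
    | add_right x y z _ _ _ h1 h2 =>
      rw [hlin] at *; simp [commForm] at *; linear_combination h1 + h2
    | smul_left r x y _ _ h => rw [hlin] at *; simp [commForm] at *; linear_combination r * h
    | smul_right r x y _ _ h => rw [hlin] at *; simp [commForm] at *; linear_combination r * h
  -- These two commutators are nonzero multiples, `-t/s` and `2t`, of the two central basis vectors.
  have h1 := hzero ![1, 0, 0, 0] ![0, 0, 1, 0]
  have h2 := hzero ![1, 0, 0, 0] ![0, 1, 0, 0]
  rw [hlin] at h1 h2
  simp [commForm, hs, ht] at h1 h2
  refine hφ (LinearMap.ext fun w => ?_)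
  rw [hlin, h1, h2]
  simp

theorem norm_central (w : Fin 2 → ℝ) : norm (E := V6) (central s t w) ≤ ‖w‖ := by
  refine (pi_norm_le_iff_of_nonneg (norm_nonneg w)).mpr fun i => ?_
  fin_cases i
  on_goal 5 => exact norm_le_pi_norm w 0
  on_goal 5 => exact norm_le_pi_norm w 1
  all_goals simp [central]

theorem isTorusLattice_fibreLattice (hs : s ≠ 0) (ht : t ≠ 0) (hΓ : IsLattice Γ) :
    IsTorusLattice (fibreLattice Γ) := by
  have := hΓ.1
  have := hΓ.2
  obtain ⟨R, hR⟩ := exists_bound_baseLattice (Γ := Γ)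
  obtain ⟨R', hR'⟩ := exists_bound_of_span_eq_top
    (span_fibreLattice hs ht (span_eq_top_of_exists_bound hR))
  refine isTorusLattice_of_finite ?_ hR'
  refine ((finite_of_discrete (Γ := Γ) 1).preimage (f := central s t) ?_).subset ?_
  rotate_left
  · rintro w ⟨hw, hw1⟩
    exact ⟨hw, (norm_central w).trans hw1⟩
  · intro v _ w _ h
    funext i
    fin_cases i
    · exact congrFun h 4
    · exact congrFun h 5

/-- A projection of a discrete group need not be discrete. Here each lift can be corrected by the
cocompact fibre lattice until its central coordinates are bounded, so short base vectors come from a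
finite set of lifts. -/
theorem finite_baseLattice (hs : s ≠ 0) (ht : t ≠ 0) (hΓ : IsLattice Γ) (r : ℝ) :
    {v | v ∈ baseLattice Γ ∧ ‖v‖ ≤ r}.Finite := by
  have := hΓ.1
  have := hΓ.2
  obtain ⟨R, hR⟩ := exists_bound_baseLattice (Γ := Γ)
  obtain ⟨R', hR'⟩ := exists_bound_of_span_eq_top
    (span_fibreLattice hs ht (span_eq_top_of_exists_bound hR))
  refine ((finite_of_discrete (Γ := Γ) (max r R')).image toBase).subset ?_
  rintro v ⟨hv, hvr⟩
  obtain ⟨a, ha, rfl⟩ := exists_of_mem_baseLattice hv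
  obtain ⟨w, hw, hwa⟩ := hR' ![a 4, a 5]
  refine ⟨h5Mul s t (central s t w) a, ⟨Γ.mul_mem hw ha, ?_⟩, ?_⟩
  · have h0 : 0 ≤ max r R' := (norm_nonneg _).trans (hvr.trans (le_max_left _ _))
    refine (pi_norm_le_iff_of_nonneg h0).mpr fun i => ?_
    have h1 (i) := (norm_le_pi_norm (toBase a) i).trans (hvr.trans (le_max_left r R'))
    have h2 (i) := (norm_le_pi_norm (w + ![a 4, a 5]) i).trans (hwa.trans (le_max_right r R'))
    have h30 := h1 0
    have h31 := h1 1
    have h32 := h1 2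
    have h33 := h1 3
    have h34 := h2 0
    have h35 := h2 1
    fin_cases i <;> simp [h5Mul, central, toBase] at * <;> tauto
  · funext i
    fin_cases i <;> simp [toBase, h5Mul, central]

theorem isTorusLattice_baseLattice (hs : s ≠ 0) (ht : t ≠ 0) (hΓ : IsLattice Γ) :
    IsTorusLattice (baseLattice Γ) := by
  have := hΓ.2
  obtain ⟨R, hR⟩ := exists_bound_baseLattice (Γ := Γ)
  exact isTorusLattice_of_finite (finite_baseLattice hs ht hΓ 1) hR

theorem HasPeriod.base_exists_int (hΓ : HasPeriod Γ L) {v : Fin 4 → ℝ} (hv : v ∈ baseLattice Γ) :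
    ∃ n : ℤ, v 0 = n * L.ω₁.re := by
  obtain ⟨a, ha, rfl⟩ := hv
  exact hΓ.exists_int ha

/-- The period condition provides a base vector `η` with first coordinate exactly one period.
Subtracting a multiple of it brings any lattice vector into the wall, and the multiple is at most `R
/ ω₁` when the first coordinate is at most `R`. -/
theorem isTorusLattice_boundaryLattice (hs : s ≠ 0) (ht : t ≠ 0) (hΓ : IsLattice Γ)
    (hp : HasPeriod Γ L) (hL : 0 < L.ω₁.re) :
    IsTorusLattice (boundaryLattice (baseLattice Γ)) := by
  have := hΓ.2
  obtain ⟨R, hR⟩ := exists_bound_baseLattice (Γ := Γ)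
  obtain ⟨η, hη, hη0⟩ : ∃ η ∈ baseLattice Γ, η 0 = L.ω₁.re := by
    have h : L.ω₁.re ∈ {r | ∃ n : ℤ, r = n * L.ω₁.re} := ⟨1, by simp⟩
    rw [← hp] at h
    obtain ⟨a, ha, h⟩ := h
    exact ⟨_, toBase_mem ha, h⟩
  let ι : (Fin 3 → ℝ) → Fin 4 → ℝ := fun w => ![0, w 0, w 1, w 2]
  have hι (w) : ‖ι w‖ ≤ ‖w‖ := by
    refine (pi_norm_le_iff_of_nonneg (norm_nonneg w)).mpr fun i => ?_
    fin_cases i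
    on_goal 2 => exact norm_le_pi_norm w 0
    on_goal 2 => exact norm_le_pi_norm w 1
    on_goal 2 => exact norm_le_pi_norm w 2
    simp [ι]
  refine isTorusLattice_of_finite (R := R + R / L.ω₁.re * ‖η‖) ?_ fun w => ?_
  · refine ((finite_baseLattice hs ht hΓ 1).preimage (f := ι) ?_).subset ?_
    rotate_left
    · rintro w ⟨hw, hw1⟩
      exact ⟨hw, (hι w).trans hw1⟩
    · intro v _ w _ h
      funext i
      fin_cases i
      exacts [congrFun h 1, congrFun h 2, congrFun h 3]
  · obtain ⟨a, ha, haw⟩ := hR (ι w)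
    obtain ⟨n, hn⟩ := hp.base_exists_int ha
    have hmem : a - n • η ∈ baseLattice Γ :=
      (baseLattice Γ).sub_mem ha ((baseLattice Γ).zsmul_mem hη n)
    have h0 : (a - n • η) 0 = 0 := by simp [hn, hη0]
    have hR0 : 0 ≤ R := (norm_nonneg _).trans haw
    have hnle : |(n : ℝ)| ≤ R / L.ω₁.re := by
      rw [le_div_iff₀ hL]
      have h1 := (norm_le_pi_norm (a + ι w) 0).trans haw
      simpa [ι, hn, abs_mul, abs_of_pos hL] using h1
    refine ⟨![(a - n • η) 1, (a - n • η) 2, (a - n • η) 3], ?_, ?_⟩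
    · change (![0, (a - n • η) 1, (a - n • η) 2, (a - n • η) 3] : Fin 4 → ℝ) ∈ baseLattice Γ
      convert hmem using 1
      funext i
      fin_cases i
      exacts [h0.symm, rfl, rfl, rfl]
    · have h1 : ‖(a + ι w) - (n : ℝ) • η‖ ≤ R + R / L.ω₁.re * ‖η‖ := by
        refine (norm_sub_le _ _).trans (add_le_add haw ?_)
        rw [norm_smul, Real.norm_eq_abs]
        exact mul_le_mul_of_nonneg_right hnle (norm_nonneg η)
      refine (pi_norm_le_iff_of_nonneg ((norm_nonneg _).trans h1)).mpr fun i => ?_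
      have h2 (i) := (norm_le_pi_norm ((a + ι w) - (n : ℝ) • η) i).trans h1
      have h21 := h2 1
      have h22 := h2 2
      have h23 := h2 3
      fin_cases i <;> simp [ι, sub_add_eq_add_sub] at * <;> assumption

end

end Het
end

noncomputable section

namespace Het

/-! ### Existence of lattices -/

/-- A group law on `ℝ⁶` of the same shape as the one of `H₅`. -/
def twistMul (c : Fin 3 → ℝ) (x y : V6) : V6 :=
  ![x 0 + y 0, x 1 + y 1, x 2 + y 2, x 3 + y 3,
    x 4 + y 4 - c 0 * (x 0 * y 2 + x 1 * y 3),
    x 5 + y 5 + c 1 * (x 0 * y 1 - x 2 * y 3) + c 2 * (x 0 * y 3 - x 1 * y 2)]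

section

variable {s t : ℝ} {c : Fin 3 → ℝ} {P : V6 ≃ₜ V6} {κ₀ κ₁ κ₂ : ℝ} {m : Fin 3 → ℤ}

theorem exists_int_mul_bound {k : ℝ} (hk : k ≠ 0) (r : ℝ) : ∃ n : ℤ, |n * k + r| ≤ |k| := by
  refine ⟨-⌊r / k⌋, ?_⟩
  have h : ((-⌊r / k⌋ : ℤ) : ℝ) * k + r = Int.fract (r / k) * k := by
    rw [Int.fract]
    push_cast
    field_simp
    ring
  rw [h, abs_mul, abs_of_nonneg (Int.fract_nonneg _)]
  exact mul_le_of_le_one_left (abs_nonneg k) (Int.fract_lt_one _).le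

theorem exists_twistMul_bound (hκ₀ : κ₀ ≠ 0) (hκ₁ : κ₁ ≠ 0) (hκ₂ : κ₂ ≠ 0) (x : V6) :
    ∃ n : Fin 6 → ℤ, ∀ i, |twistMul c (fun i => n i * ![κ₀, κ₀, κ₀, κ₀, κ₁, κ₂] i) x i| ≤
      |![κ₀, κ₀, κ₀, κ₀, κ₁, κ₂] i| := by
  obtain ⟨n0, hn0⟩ := exists_int_mul_bound hκ₀ (x 0)
  obtain ⟨n1, hn1⟩ := exists_int_mul_bound hκ₀ (x 1)
  obtain ⟨n2, hn2⟩ := exists_int_mul_bound hκ₀ (x 2)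
  obtain ⟨n3, hn3⟩ := exists_int_mul_bound hκ₀ (x 3)
  obtain ⟨n4, hn4⟩ := exists_int_mul_bound hκ₁
    (x 4 - c 0 * (n0 * κ₀ * x 2 + n1 * κ₀ * x 3))
  obtain ⟨n5, hn5⟩ := exists_int_mul_bound hκ₂
    (x 5 + c 1 * (n0 * κ₀ * x 1 - n2 * κ₀ * x 3) + c 2 * (n0 * κ₀ * x 3 - n1 * κ₀ * x 2))
  refine ⟨![n0, n1, n2, n3, n4, n5], fun i => ?_⟩
  fin_cases i
  · exact hn0
  · exact hn1
  · exact hn2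
  · exact hn3
  · convert hn4 using 2
    · simp [twistMul]; ring
    · rfl
  · convert hn5 using 2
    · simp [twistMul]; ring
    · rfl

/-- The points with integral coordinates in a chart in which the group law is integral. -/
def chartLattice (hP : ∀ x y, P (h5Mul s t x y) = twistMul c (P x) (P y)) (hP0 : P 0 = 0)
    (h0 : c 0 * κ₀ ^ 2 = m 0 * κ₁) (h1 : c 1 * κ₀ ^ 2 = m 1 * κ₂) (h2 : c 2 * κ₀ ^ 2 = m 2 * κ₂) :
    Subgroup (H5 s t) where
  carrier := {x | ∀ i, ∃ n : ℤ, P x i = n * ![κ₀, κ₀, κ₀, κ₀, κ₁, κ₂] i}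
  one_mem' i := ⟨0, by
    have h : P (1 : H5 s t) = 0 := hP0
    rw [h]
    simp⟩
  mul_mem' {a b} ha hb i := by
    choose k hk using ha
    choose l hl using hb
    have h : P (a * b) = twistMul c (P a) (P b) := hP a b
    have hk' : P a = fun i => k i * ![κ₀, κ₀, κ₀, κ₀, κ₁, κ₂] i := funext hk
    have hl' : P b = fun i => l i * ![κ₀, κ₀, κ₀, κ₀, κ₁, κ₂] i := funext hl
    rw [h, hk', hl']
    refine ⟨![k 0 + l 0, k 1 + l 1, k 2 + l 2, k 3 + l 3,
      k 4 + l 4 - m 0 * (k 0 * l 2 + k 1 * l 3),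
      k 5 + l 5 + m 1 * (k 0 * l 1 - k 2 * l 3) + m 2 * (k 0 * l 3 - k 1 * l 2)] i, ?_⟩
    fin_cases i <;> simp [twistMul]
    · ring
    · ring
    · ring
    · ring
    · linear_combination (-(k 0 * l 2 + k 1 * l 3)) * h0
    · linear_combination ((k 0 * l 1 - k 2 * l 3)) * h1 + (k 0 * l 3 - k 1 * l 2) * h2
  inv_mem' {a} ha i := by
    choose k hk using ha
    have hk' : P a = fun i => k i * ![κ₀, κ₀, κ₀, κ₀, κ₁, κ₂] i := funext hk
    let b : H5 s t := a⁻¹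
    have hb : h5Mul s t b a = (0 : V6) := inv_mul_cancel a
    have h : twistMul c (P b) (P a) = 0 := (hP b a).symm.trans ((congrArg P hb).trans hP0)
    change ∃ n : ℤ, P b i = _
    rw [hk'] at h
    have e0 := congrFun h 0
    have e1 := congrFun h 1
    have e2 := congrFun h 2
    have e3 := congrFun h 3
    have e4 := congrFun h 4
    have e5 := congrFun h 5
    simp [twistMul] at e0 e1 e2 e3 e4 e5
    generalize P b = y at *
    have e0' : y 0 = -(k 0 * κ₀) := by linarith
    have e1' : y 1 = -(k 1 * κ₀) := by linarith
    have e2' : y 2 = -(k 2 * κ₀) := by linarith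
    have e3' : y 3 = -(k 3 * κ₀) := by linarith
    rw [e0', e1'] at e4
    rw [e0', e1', e2'] at e5
    refine ⟨![-k 0, -k 1, -k 2, -k 3,
      -k 4 - m 0 * (k 0 * k 2 + k 1 * k 3),
      -k 5 + m 1 * (k 0 * k 1 - k 2 * k 3) + m 2 * (k 0 * k 3 - k 1 * k 2)] i, ?_⟩
    fin_cases i <;> simp
    · linarith
    · linarith
    · linarith
    · linarith
    · linear_combination e4 - (k 0 * k 2 + k 1 * k 3) * h0
    · linear_combination e5 + ((k 0 * k 1 - k 2 * k 3)) * h1 + (k 0 * k 3 - k 1 * k 2) * h2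

variable (hP : ∀ x y, P (h5Mul s t x y) = twistMul c (P x) (P y)) (hP0 : P 0 = 0)
  (h0 : c 0 * κ₀ ^ 2 = m 0 * κ₁) (h1 : c 1 * κ₀ ^ 2 = m 1 * κ₂) (h2 : c 2 * κ₀ ^ 2 = m 2 * κ₂)

theorem isLattice_chartLattice (hκ₀ : κ₀ ≠ 0) (hκ₁ : κ₁ ≠ 0) (hκ₂ : κ₂ ≠ 0) :
    IsLattice (chartLattice hP hP0 h0 h1 h2) := by
  have hk (i : Fin 6) : ![κ₀, κ₀, κ₀, κ₀, κ₁, κ₂] i ≠ 0 := by fin_cases i <;> assumption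
  constructor
  · let W : Set (H5 s t) := {x : V6 | ∀ i, |P x i| < |![κ₀, κ₀, κ₀, κ₀, κ₁, κ₂] i|}
    have hW : IsOpen (X := V6) {x | ∀ i, |P x i| < |![κ₀, κ₀, κ₀, κ₀, κ₁, κ₂] i|} := by
      simp only [Set.ofPred_forall]
      refine isOpen_iInter_of_finite fun i => ?_
      exact isOpen_lt ((continuous_apply i).comp P.continuous).abs continuous_const
    refine discreteTopology_of_isOpen_singleton_one ?_
    convert (show IsOpen W from hW).preimage continuous_subtype_val using 1
    ext x
    constructor
    · rintro rfl i
      have h : P (1 : H5 s t) = 0 := hP0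
      rw [OneMemClass.coe_one, h]
      simpa using hk i
    · intro hx
      have hx0 : P (x : H5 s t) = 0 := by
        funext i
        obtain ⟨n, hn⟩ := x.2 i
        have h := hx i
        rw [hn, abs_mul, mul_lt_iff_lt_one_left (abs_pos.mpr (hk i))] at h
        have hn0 : n = 0 := by
          have h' : |n| < 1 := by exact_mod_cast h
          exact Int.abs_lt_one_iff.mp h'
        simpa [hn0] using hn
      exact Subtype.ext (P.injective (hx0.trans hP0.symm))
  · let K : Set V6 := P.symm '' Set.pi Set.univ fun i =>
      Set.Icc (-|![κ₀, κ₀, κ₀, κ₀, κ₁, κ₂] i|) |![κ₀, κ₀, κ₀, κ₀, κ₁, κ₂] i|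
    have hK : IsCompact (X := H5 s t) K :=
      (isCompact_univ_pi fun i => isCompact_Icc).image P.symm.continuous
    let q : H5 s t → Nilmanifold (chartLattice hP hP0 h0 h1 h2) := Quotient.mk _
    have hq : q '' K = Set.univ := by
      refine Set.eq_univ_of_forall fun z => ?_
      obtain ⟨x, rfl⟩ := Quotient.exists_rep z
      obtain ⟨n, hn⟩ := exists_twistMul_bound (c := c) hκ₀ hκ₁ hκ₂ (P x)
      let a : H5 s t := P.symm fun i => n i * ![κ₀, κ₀, κ₀, κ₀, κ₁, κ₂] i
      have hPa : P a = fun i => n i * ![κ₀, κ₀, κ₀, κ₀, κ₁, κ₂] i := P.apply_symm_apply _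
      have ha : a ∈ chartLattice hP hP0 h0 h1 h2 := by
        intro i
        rw [hPa]
        exact ⟨n i, rfl⟩
      refine ⟨a * x, ⟨P (a * x), fun i _ => ?_, P.symm_apply_apply _⟩,
        mk_eq_mk_iff.mpr ⟨a, ha, rfl⟩⟩
      have hm : P (a * x) = twistMul c (P a) (P x) := hP a x
      rw [hm, hPa, Set.mem_Icc, ← abs_le]
      exact hn i
    refine ⟨?_⟩
    rw [← hq]
    exact hK.image continuous_quot_mk

theorem hasPeriod_chartLattice {L : PeriodPair} (hκ₀ : κ₀ = L.ω₁.re) (hx : ∀ x, P x 0 = x 0) :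
    HasPeriod (chartLattice hP hP0 h0 h1 h2) L := by
  subst hκ₀
  ext r
  constructor
  · rintro ⟨a, ha, rfl⟩
    obtain ⟨n, hn⟩ := ha 0
    exact ⟨n, (hx a).symm.trans hn⟩
  · rintro ⟨n, rfl⟩
    refine ⟨P.symm ![n * L.ω₁.re, 0, 0, 0, 0, 0], fun i => ?_, ?_⟩
    · rw [P.apply_symm_apply]
      refine ⟨![n, 0, 0, 0, 0, 0] i, ?_⟩
      fin_cases i <;> simp
    · change P.symm ![n * L.ω₁.re, 0, 0, 0, 0, 0] 0 = _
      rw [← hx (P.symm _), P.apply_symm_apply]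
      rfl

end

section

variable {s t : ℝ}

/-- The chart in which the commutators of the unit lattice are commensurable: a rotation in the
plane of `x¹` and `x³`, followed by a quadratic change of the central coordinates. -/
def rotationChart (s t C S : ℝ) (h : C ^ 2 + S ^ 2 = 1) : V6 ≃ₜ V6 where
  toFun x := ![x 0, C * x 1 + S * x 3, x 2, C * x 3 - S * x 1,
    x 4 + t / s * (C * S * ((C * x 1 + S * x 3) ^ 2 - (C * x 3 - S * x 1) ^ 2) / 2
      - S ^ 2 * ((C * x 1 + S * x 3) * (C * x 3 - S * x 1))),
    x 5 + t / s * (x 1 * x 2)]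
  invFun y := ![y 0, C * y 1 - S * y 3, y 2, S * y 1 + C * y 3,
    y 4 - t / s * (C * S * (y 1 ^ 2 - y 3 ^ 2) / 2 - S ^ 2 * (y 1 * y 3)),
    y 5 - t / s * ((C * y 1 - S * y 3) * y 2)]
  left_inv x := by
    have h1 : C * (C * x 1 + S * x 3) - S * (C * x 3 - S * x 1) = x 1 := by
      linear_combination x 1 * h
    have h3 : S * (C * x 1 + S * x 3) + C * (C * x 3 - S * x 1) = x 3 := by
      linear_combination x 3 * h
    funext i
    fin_cases i <;> simp [h1, h3]
  right_inv y := by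
    have h1 : C * (C * y 1 - S * y 3) + S * (S * y 1 + C * y 3) = y 1 := by
      linear_combination y 1 * h
    have h3 : C * (S * y 1 + C * y 3) - S * (C * y 1 - S * y 3) = y 3 := by
      linear_combination y 3 * h
    funext i
    fin_cases i <;> simp [h1, h3]
  continuous_toFun := by
    refine continuous_pi fun i => ?_
    fin_cases i <;> simp only [Fin.reduceFinMk, Matrix.cons_val] <;> fun_prop
  continuous_invFun := by
    refine continuous_pi fun i => ?_
    fin_cases i <;> simp only [Fin.reduceFinMk, Matrix.cons_val] <;> fun_prop

/-- The rotation preserves the pairing in the fifth coordinate and merges the coefficients `2` and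
`1/s` of the sixth into their norm `σ`. The quadratic central terms absorb the difference between
cohomologous cocycles. -/
theorem rotationChart_mul {C S σ : ℝ} (h : C ^ 2 + S ^ 2 = 1) (h1 : σ * C = 2)
    (h2 : σ * S = 1 / s) (x y : V6) :
    rotationChart s t C S h (h5Mul s t x y) = twistMul ![t / s, t * σ, 0]
      (rotationChart s t C S h x) (rotationChart s t C S h y) := by
  funext i
  have h2' : t / s = t * (σ * S) := by rw [h2]; ring
  fin_cases i <;> simp [rotationChart, twistMul, h5Mul]
  · ring
  · ring
  · linear_combination (t / s * ((C ^ 2 + S ^ 2 + 1) * x 1 * y 3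
      - (C * x 1 + S * x 3) * (C * y 3 - S * y 1))) * h
  · rw [h2']
    linear_combination (-(t * (x 0 * y 1 - x 2 * y 3))) * h1

/-- For irrational `s` the constants `2t` and `t/s` in the sixth coordinate are incommensurable. In
the rotated chart each central coordinate has one constant, `t/s` or `tσ` with `σ² = 4 + 1/s²`, and
its step is scaled accordingly. -/
theorem exists_lattice_hasPeriod (hs : s ≠ 0) (ht : t ≠ 0) {L : PeriodPair} (hL : 0 < L.ω₁.re) :
    ∃ Γ : Subgroup (H5 s t), IsLattice Γ ∧ HasPeriod Γ L := by
  have hσ : 0 < √(4 + 1 / s ^ 2) := Real.sqrt_pos.mpr (by positivity)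
  have hσ2 : √(4 + 1 / s ^ 2) ^ 2 = 4 + 1 / s ^ 2 := Real.sq_sqrt (by positivity)
  generalize √(4 + 1 / s ^ 2) = σ at *
  have h : (2 / σ) ^ 2 + (1 / (s * σ)) ^ 2 = 1 := by
    field_simp at hσ2 ⊢
    linarith
  have hmul := rotationChart_mul (s := s) (t := t) h (mul_div_cancel₀ 2 hσ.ne') (by field_simp)
  have hP0 : rotationChart s t (2 / σ) (1 / (s * σ)) h 0 = 0 := by
    funext i; fin_cases i <;> simp [rotationChart]
  have h0 : (![t / s, t * σ, 0] : Fin 3 → ℝ) 0 * L.ω₁.re ^ 2 =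
      ((![1, 1, 0] : Fin 3 → ℤ) 0 : ℤ) * (t / s * L.ω₁.re ^ 2) := by simp
  have h1 : (![t / s, t * σ, 0] : Fin 3 → ℝ) 1 * L.ω₁.re ^ 2 =
      ((![1, 1, 0] : Fin 3 → ℤ) 1 : ℤ) * (t * σ * L.ω₁.re ^ 2) := by simp
  have h2 : (![t / s, t * σ, 0] : Fin 3 → ℝ) 2 * L.ω₁.re ^ 2 =
      ((![1, 1, 0] : Fin 3 → ℤ) 2 : ℤ) * (t * σ * L.ω₁.re ^ 2) := by simp
  exact ⟨_, isLattice_chartLattice hmul hP0 h0 h1 h2 hL.ne' (by positivity) (by positivity),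
    hasPeriod_chartLattice hmul hP0 h0 h1 h2 rfl fun x => rfl⟩

/-- For `s = num/den` both constants of the sixth coordinate are integral multiples of `t/num`, so
no rotation is needed and the base lattice stays cubic. -/
theorem exists_lattice_of_rat (hs : s ≠ 0) (ht : t ≠ 0) {L : PeriodPair} (hL : 0 < L.ω₁.re)
    (hq : ∃ q : ℚ, s = q) : ∃ Γ : Subgroup (H5 s t), IsLattice Γ ∧ HasPeriod Γ L ∧
      ∀ v : Fin 4 → ℝ, v ∈ baseLattice Γ ↔ ∀ i, ∃ n : ℤ, v i = n * L.ω₁.re := by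
  obtain ⟨q, rfl⟩ := hq
  have hq0 : q ≠ 0 := by exact_mod_cast hs
  have hnum : (q.num : ℝ) ≠ 0 := by exact_mod_cast Rat.num_ne_zero.mpr hq0
  have hden : (q.den : ℝ) ≠ 0 := by exact_mod_cast q.den_ne_zero
  have hqe : (q : ℝ) = q.num / q.den := Rat.cast_def q
  have hmul (x y : V6) : Homeomorph.refl V6 (h5Mul q t x y) =
      twistMul ![t / q, 2 * t, t / q] (Homeomorph.refl V6 x) (Homeomorph.refl V6 y) := rfl
  have hP0 : Homeomorph.refl V6 0 = 0 := rfl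
  have h0 : (![t / q, 2 * t, t / q] : Fin 3 → ℝ) 0 * L.ω₁.re ^ 2 =
      ((![1, 2 * q.num, q.den] : Fin 3 → ℤ) 0 : ℤ) * (t / q * L.ω₁.re ^ 2) := by simp
  have h1 : (![t / q, 2 * t, t / q] : Fin 3 → ℝ) 1 * L.ω₁.re ^ 2 =
      ((![1, 2 * q.num, q.den] : Fin 3 → ℤ) 1 : ℤ) * (t / q.num * L.ω₁.re ^ 2) := by
    simp; field_simp
  have h2 : (![t / q, 2 * t, t / q] : Fin 3 → ℝ) 2 * L.ω₁.re ^ 2 =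
      ((![1, 2 * q.num, q.den] : Fin 3 → ℤ) 2 : ℤ) * (t / q.num * L.ω₁.re ^ 2) := by
    simp [hqe]; field_simp
  refine ⟨_, isLattice_chartLattice hmul hP0 h0 h1 h2 hL.ne' (by positivity) (by positivity),
    hasPeriod_chartLattice hmul hP0 h0 h1 h2 rfl fun x => rfl, fun v => ⟨?_, fun hv => ?_⟩⟩
  · rintro ⟨a, ha, rfl⟩ i
    fin_cases i
    exacts [ha 0, ha 1, ha 2, ha 3]
  · refine ⟨(![v 0, v 1, v 2, v 3, 0, 0] : V6), fun i => ?_, ?_⟩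
    · fin_cases i
      exacts [hv 0, hv 1, hv 2, hv 3, ⟨0, by simp⟩, ⟨0, by simp⟩]
    · funext i
      fin_cases i <;> rfl

end

end Het
end

noncomputable section

namespace Het

/-! ### Conformal compactness of the base -/

open Classical in
/-- The boundary defining function `1 / √℘`, extended by zero to the poles. -/
def poleDist (L : PeriodPair) (r : ℝ) : ℝ :=
  if ∃ n : ℤ, r = n * L.ω₁.re then 0 else (√(realSlice L r))⁻¹

/-- Near the pole `u = h/y²` with `h` smooth and `h(0) = 1`, hence `1/√u = |y/√h|`, and `y/√h` has
derivative `1` at `0`. -/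
theorem exists_poleDist_eq_abs {L : PeriodPair} (hω : 0 < L.ω₁.re) :
    ∃ r : ℝ → ℝ, ContDiffAt ℝ ∞ r 0 ∧ HasDerivAt r 1 0 ∧ ∀ᶠ y in 𝓝 0, poleDist L y = |r y| := by
  obtain ⟨h, hc, h0, hu⟩ := exists_realSlice_mul_sq L
  have hh : ContDiffAt ℝ ∞ (fun y => (√(h y))⁻¹) 0 := by
    refine (hc.sqrt (by simp [h0])).inv (by simp [h0])
  refine ⟨fun y => y * (√(h y))⁻¹, contDiffAt_id.mul hh, ?_, ?_⟩
  · have h1 := (hasDerivAt_id' (0 : ℝ)).fun_mul (hh.differentiableAt (by simp)).hasDerivAt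
    simpa [h0] using h1
  · have hpos : ∀ᶠ y in 𝓝 0, 0 < h y :=
      hc.continuousAt.eventually (lt_mem_nhds (by simp [h0]))
    filter_upwards [hpos, Metric.ball_mem_nhds (0 : ℝ) hω] with y hy hyω
    rcases eq_or_ne y 0 with rfl | hy0
    · simp [poleDist]
    · have hn : ¬∃ n : ℤ, y = n * L.ω₁.re := by
        rintro ⟨n, rfl⟩
        rw [mem_ball_zero_iff, Real.norm_eq_abs, abs_mul, abs_of_pos hω,
          mul_lt_iff_lt_one_left hω] at hyω
        have h' : |n| < 1 := by exact_mod_cast hyω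
        rw [Int.abs_lt_one_iff] at h'
        simp [h'] at hy0
      have hs : realSlice L y = h y / y ^ 2 := by
        rw [← hu y hy0]
        field_simp
      rw [poleDist, if_neg hn, hs, Real.sqrt_div hy.le, Real.sqrt_sq_eq_abs, abs_mul, inv_div,
        abs_inv, abs_of_nonneg (Real.sqrt_nonneg _)]
      rfl

theorem euclid4_apply (v w : Fin 4 → ℝ) : euclid4 v w = ∑ i, v i * w i := by
  simp [euclid4, Fin.sum_univ_four]

theorem euclid4_pos {v : Fin 4 → ℝ} (hv : v ≠ 0) : 0 < euclid4 v v := by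
  rw [euclid4_apply]
  refine lt_of_le_of_ne (Finset.sum_nonneg fun i _ => mul_self_nonneg _) fun h => hv ?_
  rw [eq_comm, Finset.sum_eq_zero_iff_of_nonneg fun i _ => mul_self_nonneg _] at h
  funext i
  simpa using h i (Finset.mem_univ i)

section

variable {L : PeriodPair} {a : ℝ}

theorem IsPeriodPairFor.poleDist_add_period (hL : IsPeriodPairFor L a) (r : ℝ) (n : ℤ) :
    poleDist L (n * L.ω₁.re + r) = poleDist L r := by
  have h : (∃ m : ℤ, n * L.ω₁.re + r = m * L.ω₁.re) ↔ ∃ m : ℤ, r = m * L.ω₁.re := by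
    constructor
    · rintro ⟨m, hm⟩
      exact ⟨m - n, by push_cast; linarith⟩
    · rintro ⟨m, rfl⟩
      exact ⟨n + m, by push_cast; ring⟩
  rw [poleDist, poleDist, hL.realSlice_add_period]
  classical
  exact if_congr h rfl rfl

theorem notMem_walls {x : Fin 4 → ℝ} : x ∉ walls L.ω₁.re ↔ ∀ n : ℤ, x 0 ≠ n * L.ω₁.re := by
  simp [walls]

/-- Near a pole, the defining function is the absolute value of a smooth function. -/
theorem IsPeriodPairFor.exists_local_defining (hL : IsPeriodPairFor L a) {p : Fin 4 → ℝ}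
    (hp : p ∈ walls L.ω₁.re) : ∃ r : (Fin 4 → ℝ) → ℝ, ContDiffAt ℝ ∞ r p ∧
      (∀ᶠ x in 𝓝 p, poleDist L (x 0) = |r x|) ∧ ∀ w, fderiv ℝ r p w = w 0 := by
  obtain ⟨n, hn⟩ := hp
  obtain ⟨r, hr, hd, he⟩ := exists_poleDist_eq_abs hL.re_pos
  have hlin : HasFDerivAt (fun x : Fin 4 → ℝ => x 0 - n * L.ω₁.re)
      (ContinuousLinearMap.proj 0 : (Fin 4 → ℝ) →L[ℝ] ℝ) p :=
    (ContinuousLinearMap.proj 0 : (Fin 4 → ℝ) →L[ℝ] ℝ).hasFDerivAt.sub_const _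
  have hc : ContDiff ℝ ∞ (fun x : Fin 4 → ℝ => x 0 - n * L.ω₁.re) :=
    (ContinuousLinearMap.proj 0 : (Fin 4 → ℝ) →L[ℝ] ℝ).contDiff.sub contDiff_const
  have h0 : p 0 - n * L.ω₁.re = 0 := by rw [hn, sub_self]
  refine ⟨fun x => r (x 0 - n * L.ω₁.re), ?_, ?_, fun w => ?_⟩
  · exact ContDiffAt.comp (g := r) p (by rw [h0]; exact hr) hc.contDiffAt
  · have ht : Filter.Tendsto (fun x : Fin 4 → ℝ => x 0 - n * L.ω₁.re) (𝓝 p) (𝓝 0) := by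
      have := hlin.continuousAt.tendsto
      rwa [h0] at this
    filter_upwards [ht.eventually he] with x hx
    rw [← hx, ← hL.poleDist_add_period (x 0 - n * L.ω₁.re) n]
    congr 1
    ring
  · rw [← h0] at hd
    have h := (hd.comp_hasFDerivAt p hlin).fderiv
    rw [Function.comp_def] at h
    rw [h]
    simp

/-- With `ρ = 1/√u` the compactified metric `ρ²ḡ_H` is exactly Euclidean. The boundary is therefore
flat, and `|dr| = 1` on it by the leading coefficient of the pole. -/
theorem isConformallyCompactAH {s t : ℝ} {Γ : Subgroup (H5 s t)} (hL : IsPeriodPairFor L a)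
    (ha : 0 < a) (hs : s ≠ 0) (ht : t ≠ 0) (hΓ : IsLattice Γ) (hp : HasPeriod Γ L) :
    IsConformallyCompactAH (baseLattice Γ) L.ω₁.re (baseMetric L) := by
  have hu {x : Fin 4 → ℝ} (hx : x ∉ walls L.ω₁.re) : 0 < realSlice L (x 0) :=
    ha.trans_le (hL.le_realSlice ha (notMem_walls.mp hx))
  have hsmooth {x : Fin 4 → ℝ} (hx : x ∉ walls L.ω₁.re) :
      ContDiffAt ℝ ∞ (fun x : Fin 4 → ℝ => realSlice L (x 0)) x :=
    ContDiffAt.comp (g := realSlice L) x (hL.contDiffAt_realSlice (notMem_walls.mp hx))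
      (ContinuousLinearMap.proj 0 : (Fin 4 → ℝ) →L[ℝ] ℝ).contDiff.contDiffAt
  have hmetric : ContDiffOn ℝ ∞ (baseMetric L) (walls L.ω₁.re)ᶜ :=
    contDiffOn_clm_apply.mpr fun v => contDiffOn_clm_apply.mpr fun w =>
      ContDiffOn.mul (fun x hx => (hsmooth hx).contDiffWithinAt) contDiffOn_const
  have hval {x : Fin 4 → ℝ} (hx : x ∉ walls L.ω₁.re) :
      poleDist L (x 0) = (√(realSlice L (x 0)))⁻¹ := if_neg hx
  refine ⟨isTorusLattice_baseLattice hs ht hΓ,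
    isTorusLattice_boundaryLattice hs ht hΓ hp hL.re_pos, fun b hb x => ?_, fun x hx v hv => ?_,
    hmetric, fun x => poleDist L (x 0),
    fun _ => euclid4, ?_, contDiff_const, fun b hb x => ⟨?_, rfl⟩, fun x => ?_,
    fun x v w => ?_, fun x v hv => euclid4_pos hv, fun x hx => ?_, fun p hp => ?_,
    1, one_pos, fun p hp v w _ _ => (one_mul _).symm⟩
  · obtain ⟨n, hn⟩ := hp.base_exists_int hb
    refine ⟨⟨?_, ?_⟩, fun _ => ?_⟩
    · rintro ⟨m, hm⟩
      refine ⟨m - n, ?_⟩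
      rw [Pi.add_apply, hn] at hm
      push_cast
      linarith
    · rintro ⟨m, hm⟩
      exact ⟨n + m, by rw [Pi.add_apply, hn, hm]; push_cast; ring⟩
    · rw [baseMetric, baseMetric, Pi.add_apply, hn, hL.realSlice_add_period]
  · exact mul_pos (hu hx) (euclid4_pos hv)
  · refine continuous_iff_continuousAt.mpr fun x => ?_
    by_cases hx : x ∈ walls L.ω₁.re
    · obtain ⟨r, hr, he, -⟩ := hL.exists_local_defining hx
      exact hr.continuousAt.abs.congr (he.mono fun y hy => hy.symm)
    · have he : ∀ᶠ y : Fin 4 → ℝ in 𝓝 x, y ∉ walls L.ω₁.re := by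
        filter_upwards [(continuous_apply (0 : Fin 4)).continuousAt.eventually
          (hL.eventually_notMem_lattice (notMem_walls.mp hx))] with y hy using notMem_walls.mpr hy
      refine ((hsmooth hx).continuousAt.sqrt.inv₀ (Real.sqrt_pos.mpr (hu hx)).ne').congr ?_
      filter_upwards [he] with y hy using (hval hy).symm
  · obtain ⟨n, hn⟩ := hp.base_exists_int hb
    beta_reduce
    rw [Pi.add_apply, hn, hL.poleDist_add_period]
  · by_cases hx : x ∈ walls L.ω₁.re
    · have h : poleDist L (x 0) = 0 := if_pos hx
      exact ⟨h.ge, iff_of_true h hx⟩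
    · have h := inv_pos.mpr (Real.sqrt_pos.mpr (hu hx))
      beta_reduce
      rw [hval hx]
      exact ⟨h.le, iff_of_false h.ne' hx⟩
  · rw [euclid4_apply, euclid4_apply]
    exact Finset.sum_congr rfl fun i _ => mul_comm _ _
  · beta_reduce
    rw [hval hx, baseMetric, smul_smul, inv_pow, Real.sq_sqrt (hu hx).le,
      inv_mul_cancel₀ (hu hx).ne', one_smul]
  · obtain ⟨r, hr, he, hd⟩ := hL.exists_local_defining hp
    refine ⟨r, hr, he, Pi.single 0 1, fun w => ?_, ?_⟩
    · rw [hd, euclid4_apply]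
      simp [Fin.sum_univ_four]
    · rw [euclid4_apply]
      simp [Fin.sum_univ_four]

end

end Het
end

noncomputable section

namespace Het

/-! ### Completeness -/

/-- The length of a curve `[0, 1] → ℝ⁶` in the metric of a frame. -/
def Frame.curveLength (B : Frame) (γ : ℝ → V6) : ℝ≥0∞ :=
  ∫⁻ τ in Set.Icc (0 : ℝ) 1, ENNReal.ofReal
    √(B.metric (γ τ) (derivWithin γ (Set.Icc 0 1) τ) (derivWithin γ (Set.Icc 0 1) τ))

theorem Frame.abs_co_le (B : Frame) (x v : V6) (i : Fin 6) : |B.co i x v| ≤ √(B.metric x v v) := by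
  refine Real.abs_le_sqrt ?_
  rw [Frame.metric, sq]
  exact Finset.single_le_sum (f := fun i => B.co i x v * B.co i x v)
    (fun j _ => mul_self_nonneg _) (Finset.mem_univ i)

/-- A gradient bound integrates to a Lipschitz bound along the curve. It is used for the dilaton and
for the coordinate functions. -/
theorem Frame.abs_sub_le_of_curveLength_le (B : Frame) {γ : ℝ → V6}
    (hγ : ContDiffOn ℝ 1 γ (Set.Icc 0 1)) {φ : V6 → ℝ} {C δ : ℝ} (hδ : 0 ≤ δ)
    (hφ : ∀ τ ∈ Set.Icc (0 : ℝ) 1, ContDiffAt ℝ 1 φ (γ τ))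
    (hC : ∀ τ ∈ Set.Icc (0 : ℝ) 1, ∀ v, |fderiv ℝ φ (γ τ) v| ≤ C * √(B.metric (γ τ) v v))
    (hC0 : 0 ≤ C) (hlen : B.curveLength γ ≤ ENNReal.ofReal δ) {τ : ℝ}
    (hτ : τ ∈ Set.Icc (0 : ℝ) 1) : |φ (γ τ) - φ (γ 0)| ≤ C * δ := by
  rcases hτ.1.eq_or_lt with rfl | h0
  · simpa using mul_nonneg hC0 hδ
  have hsub : Set.Icc 0 τ ⊆ Set.Icc (0 : ℝ) 1 := Set.Icc_subset_Icc_right hτ.2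
  have hc : ContDiffOn ℝ 1 (fun τ => φ (γ τ)) (Set.Icc 0 τ) := fun σ hσ =>
    ContDiffAt.comp_contDiffWithinAt (g := φ) σ (hφ σ (hsub hσ)) ((hγ σ (hsub hσ)).mono hsub)
  have h1 := enorm_sub_le_lintegral_derivWithin_Icc_of_contDiffOn_Icc hc h0.le
  have h2 : ∫⁻ σ in Set.Icc 0 τ, ‖derivWithin (fun τ => φ (γ τ)) (Set.Icc 0 τ) σ‖ₑ ≤
      ENNReal.ofReal C * B.curveLength γ := by
    rw [Frame.curveLength, ← MeasureTheory.lintegral_const_mul' _ _ ENNReal.ofReal_ne_top]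
    refine (MeasureTheory.setLIntegral_mono' measurableSet_Icc fun σ hσ => ?_).trans
      (MeasureTheory.lintegral_mono_set hsub)
    have hd : HasDerivWithinAt (fun τ => φ (γ τ))
        (fderiv ℝ φ (γ σ) (derivWithin γ (Set.Icc 0 1) σ)) (Set.Icc 0 τ) σ :=
      ((hφ σ (hsub hσ)).differentiableAt one_ne_zero).hasFDerivAt.comp_hasDerivWithinAt σ
        ((((hγ σ (hsub hσ)).differentiableWithinAt one_ne_zero).hasDerivWithinAt).mono hsub)
    rw [hd.derivWithin (uniqueDiffOn_Icc h0 σ hσ), ← ENNReal.ofReal_mul hC0,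
      ← ofReal_norm, Real.norm_eq_abs]
    exact ENNReal.ofReal_le_ofReal (hC σ (hsub hσ) _)
  have h3 := (h1.trans h2).trans (mul_le_mul_right hlen _)
  rw [← ENNReal.ofReal_mul hC0, ← ofReal_norm, Real.norm_eq_abs] at h3
  exact (ENNReal.ofReal_le_ofReal_iff (mul_nonneg hC0 hδ)).mp h3

section

variable {s t : ℝ} {Γ : Subgroup (H5 s t)} {L : PeriodPair} {B : Frame}

theorem proj_eq_proj_iff {x y : {x : H5 s t // x ∈ (regular L : Set V6)}} :
    proj Γ L x = proj Γ L y ↔ ∃ a : V6, (a : H5 s t) ∈ Γ ∧ h5Mul s t a y.1 = x.1 :=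
  Subtype.ext_iff.trans mk_eq_mk_iff

/-- A curve in `M⁶` lifts to a curve that starts at a given point. -/
theorem CoframeDescends.exists_curve (hB : CoframeDescends Γ L B) {x : V6} (hx : x ∈ regular L)
    {q : M Γ L} {δ : ℝ≥0∞} (h : riemDist Γ L B (proj Γ L ⟨x, hx⟩) q < δ) :
    ∃ γ : ℝ → V6, ContDiffOn ℝ 1 γ (Set.Icc 0 1) ∧ γ 0 = x ∧
      (∃ hr : ∀ τ ∈ Set.Icc (0 : ℝ) 1, γ τ ∈ regular L,
        proj Γ L ⟨γ 1, hr 1 (by simp)⟩ = q) ∧ B.curveLength γ < δ := by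
  obtain ⟨⟨γ, hγ, hr, h0, h1⟩, hlen⟩ := iInf_lt_iff.mp h
  -- A given lift may start at another point of the fibre; the deck transformation `a` moves it and
  -- preserves its length.
  obtain ⟨a, ha, hax⟩ := proj_eq_proj_iff.mp h0.symm
  have hr' : ∀ τ ∈ Set.Icc (0 : ℝ) 1, h5Mul s t a (γ τ) ∈ regular L :=
    fun τ hτ => (hB a ha _ (hr τ hτ)).1
  have hd : ContDiff ℝ 1 (h5Mul s t a) := by
    refine contDiff_pi.mpr fun i => ?_
    fin_cases i <;> simp only [h5Mul, Fin.reduceFinMk, Matrix.cons_val] <;> fun_prop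
  refine ⟨fun τ => h5Mul s t a (γ τ), hd.comp_contDiffOn hγ, hax, ⟨hr', ?_⟩, ?_⟩
  · rw [← h1]
    exact proj_eq_proj_iff.mpr ⟨a, ha, rfl⟩
  · refine lt_of_eq_of_lt (MeasureTheory.setLIntegral_congr_fun measurableSet_Icc
      fun τ hτ => ?_) hlen
    have hdw : derivWithin (fun τ => h5Mul s t a (γ τ)) (Set.Icc 0 1) τ =
        fderiv ℝ (h5Mul s t a) (γ τ) (derivWithin γ (Set.Icc 0 1) τ) :=
      ((hd.differentiable one_ne_zero (γ τ)).hasFDerivAt.comp_hasDerivWithinAt τ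
        ((hγ τ hτ).differentiableWithinAt one_ne_zero).hasDerivWithinAt).derivWithin
        (uniqueDiffOn_Icc zero_lt_one τ hτ)
    simp only [hdw, Frame.metric, (hB a ha _ (hr τ hτ)).2]

end

section

variable {s t α : ℝ} {L : PeriodPair} {Γ : Subgroup (H5 s t)}

/-- Coordinate functions are Lipschitz for the metric on bounded sets. -/
theorem abs_apply_le_sqrt_metric {f : V6 → ℝ} {m D : ℝ} (hm : 0 < m) {x : V6}
    (hf : m ≤ Real.exp (f x)) (hD : ∀ i : Fin 6, i < 4 → |x i| ≤ D) (i : Fin 6) (v : V6) :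
    |v i| ≤ (1 / m + 1 + (4 * |t| + 2 * |t / s|) * (D / m)) *
      √((barFrame s t f).metric x v v) := by
  set G := √((barFrame s t f).metric x v v)
  have hG : 0 ≤ G := Real.sqrt_nonneg _
  have hD0 : 0 ≤ D := (abs_nonneg _).trans (hD 0 (by decide))
  have hmG : 0 ≤ G / m := by positivity
  have hco := (barFrame s t f).abs_co_le x v
  have h1 (j : Fin 6) (hj : j < 4) (hje : e s t j x v = v j) : |v j| ≤ G / m := by
    rw [le_div_iff₀ hm]
    have h := hco j
    simp only [barFrame, weight, hj, if_true, smul_apply, smul_eq_mul, hje, abs_mul,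
      Real.abs_exp] at h
    calc |v j| * m ≤ |v j| * Real.exp (f x) := mul_le_mul_of_nonneg_left hf (abs_nonneg _)
      _ ≤ G := by rw [mul_comm]; exact h
  have e0 := h1 0 (by decide) (by simp [e])
  have e1 := h1 1 (by decide) (by simp [e])
  have e2 := h1 2 (by decide) (by simp [e])
  have e3 := h1 3 (by decide) (by simp [e])
  have e4 : |v 4 + t / s * (x 0 * v 2 + x 1 * v 3)| ≤ G := by
    refine (congrArg abs ?_).trans_le (hco 4)
    simp [barFrame, weight, e, mul_add]
  have e5 : |v 5 - 2 * t * (x 0 * v 1 - x 2 * v 3) - t / s * (x 0 * v 3 - x 1 * v 2)| ≤ G := by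
    refine (congrArg abs ?_).trans_le (hco 5)
    simp [barFrame, weight, e]
  have hp (j k : Fin 6) (hj : j < 4) (hk : |v k| ≤ G / m) : |x j * v k| ≤ D * (G / m) := by
    rw [abs_mul]
    exact mul_le_mul (hD j hj) hk (abs_nonneg _) hD0
  have hexp : (1 / m + 1 + (4 * |t| + 2 * |t / s|) * (D / m)) * G =
      G / m + G + (4 * |t| + 2 * |t / s|) * (D * (G / m)) := by ring
  rw [hexp]
  have hpos : 0 ≤ (4 * |t| + 2 * |t / s|) * (D * (G / m)) := by positivity
  have hpos' : 0 ≤ |t| * (D * (G / m)) := by positivity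
  have h02 := hp 0 2 (by decide) e2
  have h13 := hp 1 3 (by decide) e3
  have h01 := hp 0 1 (by decide) e1
  have h23 := hp 2 3 (by decide) e3
  have h03 := hp 0 3 (by decide) e3
  have h12 := hp 1 2 (by decide) e2
  fin_cases i
  · exact e0.trans (by linarith)
  · exact e1.trans (by linarith)
  · exact e2.trans (by linarith)
  · exact e3.trans (by linarith)
  · have h : |t / s * (x 0 * v 2 + x 1 * v 3)| ≤ 2 * |t / s| * (D * (G / m)) := by
      rw [abs_mul]
      have := mul_le_mul_of_nonneg_left ((abs_add_le (x 0 * v 2) (x 1 * v 3)).trans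
        (add_le_add h02 h13)) (abs_nonneg (t / s))
      linarith
    have h' := abs_sub (v 4 + t / s * (x 0 * v 2 + x 1 * v 3)) (t / s * (x 0 * v 2 + x 1 * v 3))
    rw [add_sub_cancel_right] at h'
    change |v 4| ≤ _
    linarith
  · have h : |t / s * (x 0 * v 3 - x 1 * v 2)| ≤ 2 * |t / s| * (D * (G / m)) := by
      rw [abs_mul]
      have := mul_le_mul_of_nonneg_left ((abs_sub (x 0 * v 3) (x 1 * v 2)).trans
        (add_le_add h03 h12)) (abs_nonneg (t / s))
      linarith
    have h2 : |2 * t * (x 0 * v 1 - x 2 * v 3)| ≤ 4 * |t| * (D * (G / m)) := by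
      rw [abs_mul, abs_mul, abs_two]
      have := mul_le_mul_of_nonneg_left ((abs_sub (x 0 * v 1) (x 2 * v 3)).trans
        (add_le_add h01 h23)) (mul_nonneg zero_le_two (abs_nonneg t))
      linarith
    have h' := abs_add_three (v 5 - 2 * t * (x 0 * v 1 - x 2 * v 3) - t / s * (x 0 * v 3 - x 1 * v 2))
      (2 * t * (x 0 * v 1 - x 2 * v 3)) (t / s * (x 0 * v 3 - x 1 * v 2))
    rw [show v 5 - 2 * t * (x 0 * v 1 - x 2 * v 3) - t / s * (x 0 * v 3 - x 1 * v 2)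
      + 2 * t * (x 0 * v 1 - x 2 * v 3) + t / s * (x 0 * v 3 - x 1 * v 2) = v 5 by ring] at h'
    change |v 5| ≤ _
    linarith

namespace IsPeriodPairFor

theorem le_exp_dilaton (hL : IsPeriodPairFor L (aParam s t α)) (hs : s ≠ 0) (ht : t ≠ 0)
    (hα : 0 < α) {x : V6} (hx : x ∈ regular L) :
    α * √(aParam s t α) ≤ Real.exp (dilaton α L x) := by
  have ha := aParam_pos hs ht hα
  refine le_of_sq_le_sq ?_ (Real.exp_pos _).le
  rw [mul_pow, Real.sq_sqrt ha.le, ← Real.exp_nat_mul]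
  push_cast
  rw [hL.exp_dilaton hs ht hα hx]
  exact mul_le_mul_of_nonneg_left (hL.le_realSlice ha hx) (sq_nonneg α)

/-- The first integral is a sum of squares, so `α²p² ≤ 1`. -/
theorem abs_fderiv_dilaton_le (hL : IsPeriodPairFor L (aParam s t α)) (hs : s ≠ 0) (ht : t ≠ 0)
    (hα : 0 < α) {x : V6} (hx : x ∈ regular L) (v : V6) :
    |fderiv ℝ (dilaton α L) x v| ≤ 1 / α * √((backFrame s t α L).metric x v v) := by
  have h := hL.isDilaton hs ht hα
  have hn := h.norm_sq x hx
  rw [(h.hasFDerivAt x hx).fderiv, smul_apply, smul_eq_mul, abs_mul]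
  refine mul_le_mul ?_ ((backFrame s t α L).abs_co_le x v 0) (abs_nonneg _) (by positivity)
  refine abs_le_of_sq_le_sq ?_ (by positivity)
  rw [div_pow, one_pow, le_div_iff₀ (by positivity), ← hn]
  nlinarith [sq_nonneg (α * fluxA t (dilaton α L) x), sq_nonneg (α * fluxB s t (dilaton α L) x)]

/-- Along curves of bounded length the dilaton is bounded. -/
theorem abs_dilaton_sub_le (hL : IsPeriodPairFor L (aParam s t α)) (hs : s ≠ 0) (ht : t ≠ 0)
    (hα : 0 < α) {γ : ℝ → V6} (hγ : ContDiffOn ℝ 1 γ (Set.Icc 0 1))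
    (hr : ∀ τ ∈ Set.Icc (0 : ℝ) 1, γ τ ∈ regular L) {δ : ℝ} (hδ : 0 ≤ δ)
    (hlen : (backFrame s t α L).curveLength γ ≤ ENNReal.ofReal δ) :
    |dilaton α L (γ 1) - dilaton α L (γ 0)| ≤ 1 / α * δ :=
  (backFrame s t α L).abs_sub_le_of_curveLength_le hγ hδ
    (fun τ hτ => ((hL.contDiffOn_dilaton hs ht hα).contDiffAt
      ((isOpen_regular L).mem_nhds (hr τ hτ))).of_le (by exact_mod_cast le_top))
    (fun τ hτ => hL.abs_fderiv_dilaton_le hs ht hα (hr τ hτ)) (by positivity) hlen (by simp)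

/-- The endpoint of a short curve is close to its starting point, uniformly on bounded sets. -/
theorem exists_norm_sub_le (hL : IsPeriodPairFor L (aParam s t α)) (hs : s ≠ 0) (ht : t ≠ 0)
    (hα : 0 < α) (R : ℝ) : ∃ C > 0, ∀ γ : ℝ → V6, ContDiffOn ℝ 1 γ (Set.Icc 0 1) →
    (∀ τ ∈ Set.Icc (0 : ℝ) 1, γ τ ∈ regular L) → ‖γ 0‖ ≤ R → ∀ δ, 0 ≤ δ → δ ≤ 1 →
    (backFrame s t α L).curveLength γ ≤ ENNReal.ofReal δ → ‖γ 1 - γ 0‖ ≤ C * δ := by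
  have ha := aParam_pos hs ht hα
  have hm : 0 < α * √(aParam s t α) := by positivity
  set m := α * √(aParam s t α)
  have hcd (i : Fin 6) (x : V6) : ContDiffAt ℝ 1 (fun y : V6 => y i) x :=
    (ContinuousLinearMap.proj i : V6 →L[ℝ] ℝ).contDiff.contDiffAt
  have hfd (i : Fin 6) (x v : V6) : fderiv ℝ (fun y : V6 => y i) x v = v i := by
    have h : HasFDerivAt (fun y : V6 => y i) (dx i) x :=
      (ContinuousLinearMap.proj i : V6 →L[ℝ] ℝ).hasFDerivAt
    rw [h.fderiv]
    rfl
  -- The horizontal weights are at least `m`, so a curve of length at most `1` moves the base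
  -- coordinates by at most `1/m`. This bounds the coefficients of `e⁵` and `e⁶`.
  let D := |R| + 1 / m
  refine ⟨1 / m + 1 + (4 * |t| + 2 * |t / s|) * (D / m), by positivity,
    fun γ hγ hr hR δ hδ hδ1 hlen => ?_⟩
  have hbase (i : Fin 6) (hi : i < 4) (τ : ℝ) (hτ : τ ∈ Set.Icc (0 : ℝ) 1) : |γ τ i| ≤ D := by
    have h := (backFrame s t α L).abs_sub_le_of_curveLength_le hγ hδ (φ := fun y => y i)
      (C := 1 / m) (fun τ hτ => hcd i _) (fun τ hτ v => ?_) (by positivity) hlen hτ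
    · have h1 : |γ 0 i| ≤ R := (norm_le_pi_norm (γ 0) i).trans hR
      have h2 : 1 / m * δ ≤ 1 / m := mul_le_of_le_one_right (by positivity) hδ1
      have h3 := abs_add_le (γ τ i - γ 0 i) (γ 0 i)
      rw [sub_add_cancel] at h3
      have := le_abs_self R
      change _ ≤ |R| + 1 / m
      linarith
    · have hco := (backFrame s t α L).abs_co_le (γ τ) v i
      have hle := hL.le_exp_dilaton hs ht hα (hr τ hτ)
      have hv : (backFrame s t α L).co i (γ τ) v = Real.exp (dilaton α L (γ τ)) * v i := by
        fin_cases i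
        on_goal 5 => exact absurd hi (by decide)
        on_goal 5 => exact absurd hi (by decide)
        all_goals simp [barFrame, weight, e]
      rw [hv, abs_mul, Real.abs_exp] at hco
      rw [hfd, one_div, inv_mul_eq_div, le_div_iff₀ hm, mul_comm]
      exact (mul_le_mul_of_nonneg_right hle (abs_nonneg _)).trans hco
  refine (pi_norm_le_iff_of_nonneg (by positivity)).mpr fun i => ?_
  exact (backFrame s t α L).abs_sub_le_of_curveLength_le hγ hδ (φ := fun y => y i)
    (fun τ hτ => hcd i _) (fun τ hτ v => by
      rw [hfd]
      exact abs_apply_le_sqrt_metric hm (hL.le_exp_dilaton hs ht hα (hr τ hτ))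
        (fun j hj => hbase j hj τ hτ) i v) (by positivity) hlen (by simp)

/-- Straight segments to a regular point have length comparable with their Euclidean length. -/
theorem exists_riemDist_le (hL : IsPeriodPairFor L (aParam s t α)) (hs : s ≠ 0) (ht : t ≠ 0)
    (hα : 0 < α) {x : V6} (hx : x ∈ regular L) : ∃ C > 0, ∃ ε > 0, ∀ y,
    ‖y - x‖ < ε → ∃ hy : y ∈ regular L,
      riemDist Γ L (backFrame s t α L) (proj Γ L ⟨y, hy⟩) (proj Γ L ⟨x, hx⟩) ≤
        ENNReal.ofReal (C * ‖y - x‖) := by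
  have h := hL.isDilaton hs ht hα
  have hev : ∀ᶠ z in 𝓝 x, z ∈ regular L ∧
      ∀ i, ‖(backFrame s t α L).co i z‖ ≤ ∑ j, ‖(backFrame s t α L).co j x‖ + 1 := by
    refine Filter.Eventually.and ((isOpen_regular L).mem_nhds hx) (Filter.eventually_all.mpr fun i => ?_)
    refine ((h.differentiableAt_co hx i).continuousAt.norm.eventually
      (gt_mem_nhds (lt_add_one _))).mono fun z hz => hz.le.trans (by
        gcongr
        exact Finset.single_le_sum (f := fun j => ‖(backFrame s t α L).co j x‖)
          (fun j _ => norm_nonneg _) (Finset.mem_univ i))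
  obtain ⟨ε, hε, hball⟩ := Metric.eventually_nhds_iff_ball.mp hev
  have hK : 0 < ∑ j, ‖(backFrame s t α L).co j x‖ + 1 := by positivity
  set K := ∑ j, ‖(backFrame s t α L).co j x‖ + 1
  have hmet (z : V6) (hz : z ∈ Metric.ball x ε) (v : V6) :
      √((backFrame s t α L).metric z v v) ≤ 3 * K * ‖v‖ := by
    -- Six squares, each at most `(K‖v‖)²`, add up to less than `(3K‖v‖)²`.
    refine Real.sqrt_le_iff.mpr ⟨by positivity, ?_⟩
    have h1 (i : Fin 6) (_ : i ∈ Finset.univ) :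
        (backFrame s t α L).co i z v * (backFrame s t α L).co i z v ≤ (K * ‖v‖) ^ 2 := by
      rw [← abs_mul_abs_self, ← sq]
      refine pow_le_pow_left₀ (abs_nonneg _) ?_ 2
      exact (((backFrame s t α L).co i z).le_opNorm v).trans
        (mul_le_mul_of_nonneg_right ((hball z hz).2 i) (norm_nonneg v))
    refine (Finset.sum_le_sum h1).trans ?_
    simp only [Finset.sum_const, Finset.card_univ, Fintype.card_fin, nsmul_eq_mul]
    push_cast
    nlinarith [sq_nonneg (K * ‖v‖)]
  refine ⟨3 * K, by positivity, ε, hε, fun y hy => ?_⟩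
  let γ : ℝ → V6 := fun τ => y + τ • (x - y)
  have hmem (τ : ℝ) (hτ : τ ∈ Set.Icc (0 : ℝ) 1) : γ τ ∈ Metric.ball x ε := by
    have h1 : γ τ - x = (1 - τ) • (y - x) := by
      simp only [γ]; module
    rw [mem_ball_iff_norm, h1, norm_smul, Real.norm_eq_abs, abs_of_nonneg (by linarith [hτ.2])]
    exact (mul_le_of_le_one_left (norm_nonneg _) (by linarith [hτ.1])).trans_lt hy
  have hγ0 : γ 0 = y := by simp [γ]
  have hγ1 : γ 1 = x := by simp [γ]
  have hγd : ContDiffOn ℝ 1 γ (Set.Icc 0 1) :=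
    (contDiff_const.add (contDiff_id.smul contDiff_const)).contDiffOn
  have hder (τ : ℝ) (hτ : τ ∈ Set.Icc (0 : ℝ) 1) : derivWithin γ (Set.Icc 0 1) τ = x - y := by
    have h1 : HasDerivAt γ (x - y) τ := by
      have h2 := ((hasDerivAt_id' τ).smul_const (x - y)).const_add y
      rwa [one_smul] at h2
    exact h1.hasDerivWithinAt.derivWithin (uniqueDiffOn_Icc zero_lt_one τ hτ)
  refine ⟨(hball y (by rwa [mem_ball_iff_norm])).1, ?_⟩
  have hr (τ : ℝ) (hτ : τ ∈ Set.Icc (0 : ℝ) 1) : γ τ ∈ regular L := (hball _ (hmem τ hτ)).1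
  refine (iInf_le _ ⟨γ, hγd, hr, congrArg (proj Γ L) (Subtype.ext hγ0),
    congrArg (proj Γ L) (Subtype.ext hγ1)⟩).trans ?_
  refine (MeasureTheory.setLIntegral_mono' (g := fun _ => ENNReal.ofReal (3 * K * ‖y - x‖))
    measurableSet_Icc fun τ hτ => ?_).trans ?_
  · refine ENNReal.ofReal_le_ofReal ?_
    dsimp only
    rw [hder τ hτ, norm_sub_rev]
    exact hmet _ (hmem τ hτ) _
  · simp

/-- Lifts are chosen in a fixed compact ball and a subsequence converges there. The Lipschitz bound
for the dilaton keeps its limit off the poles, and local comparison with the Euclidean metric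
carries the convergence to the whole Cauchy sequence. -/
theorem isCompleteMetric (hL : IsPeriodPairFor L (aParam s t α)) (hs : s ≠ 0) (ht : t ≠ 0)
    (hα : 0 < α) (hΓ : IsLattice Γ) (hp : HasPeriod Γ L) :
    IsCompleteMetric Γ L (backFrame s t α L) := by
  have := hΓ.2
  have hB := hp.coframeDescends hL α
  intro p hC
  obtain ⟨R, hR⟩ := exists_bound_of_compactSpace (Γ := Γ)
  have hlift (q : M Γ L) : ∃ (x : V6) (hx : x ∈ regular L), ‖x‖ ≤ R ∧ proj Γ L ⟨x, hx⟩ = q := by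
    obtain ⟨_, y, hy, rfl⟩ := q
    obtain ⟨a, ha, haR⟩ := hR y
    exact ⟨_, hp.mul_mem_regular ha hy, haR,
      Subtype.ext (mk_eq_mk_iff.mpr ⟨a, ha, rfl⟩)⟩
  choose x hx hxR hxp using fun n => hlift (p n)
  have hcurve {n m : ℕ} {δ : ℝ≥0∞} (h : riemDist Γ L (backFrame s t α L) (p n) (p m) < δ) :=
    hB.exists_curve (hx n) ((hxp n).symm ▸ h)
  obtain ⟨N₀, hN₀⟩ := hC 1 one_pos
  -- The curve ends at a `Γ`-translate of `x m` rather than at `x m` itself, but the dilaton is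
  -- `Γ`-invariant.
  have hbound (m : ℕ) (hm : N₀ ≤ m) :
      dilaton α L (x m) ≤ dilaton α L (x N₀) + 1 / α * 1 := by
    obtain ⟨γ, hγ, h0, ⟨hr, h1⟩, hlen⟩ := hcurve (hN₀ N₀ le_rfl m hm)
    have h := hL.abs_dilaton_sub_le hs ht hα hγ hr zero_le_one (by simpa using hlen.le)
    obtain ⟨a, ha, hax⟩ := proj_eq_proj_iff.mp (h1.trans (hxp m).symm)
    have hd := hp.descends_dilaton hL α a ha _ (hx m)
    rw [show h5Mul s t a (x m) = γ 1 from hax] at hd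
    rw [h0, hd] at h
    linarith [(abs_le.mp h).2]
  obtain ⟨z, -, φ, hφ, hlim⟩ := (isCompact_closedBall (0 : V6) R).tendsto_subseq
    (x := x) fun n => mem_closedBall_zero_iff.mpr (hxR n)
  -- If the limit lay on a wall, `℘` and with it the dilaton would be unbounded along the
  -- subsequence.
  have hz : z ∈ regular L := by
    intro n hn
    have h1 : Filter.Tendsto (fun k => x (φ k) 0 - n * L.ω₁.re) Filter.atTop (𝓝[≠] 0) := by
      refine tendsto_nhdsWithin_iff.mpr ⟨?_, Filter.Eventually.of_forall fun k =>
        sub_ne_zero.mpr (hx (φ k) n)⟩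
      have h2 := ((continuous_apply (0 : Fin 6)).tendsto z).comp hlim
      simpa [hn] using h2.sub_const (n * L.ω₁.re)
    have h2 := ((tendsto_realSlice_zero L).comp h1).eventually_gt_atTop
      (Real.exp (2 * (dilaton α L (x N₀) + 1 / α * 1)) / α ^ 2)
    obtain ⟨k, hk, hkN⟩ := (h2.and (hφ.tendsto_atTop.eventually_ge_atTop N₀)).exists
    have h3 := hL.exp_dilaton hs ht hα (hx (φ k))
    have h4 := Real.exp_le_exp.mpr (mul_le_mul_of_nonneg_left (hbound (φ k) hkN) zero_le_two)
    have h5 := hL.realSlice_add_period (x (φ k) 0 - n * L.ω₁.re) n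
    rw [add_sub_cancel] at h5
    rw [Function.comp, ← h5, div_lt_iff₀ (by positivity)] at hk
    linarith
  refine ⟨proj Γ L ⟨z, hz⟩, ENNReal.tendsto_atTop_zero.mpr fun η hη => ?_⟩
  obtain ⟨C, hC0, ε, hε, hseg⟩ := hL.exists_riemDist_le (Γ := Γ) hs ht hα hz
  obtain ⟨C', hC'0, hend⟩ := hL.exists_norm_sub_le hs ht hα R
  obtain ⟨η', hη'0, hη'⟩ := ENNReal.lt_iff_exists_nnreal_btwn.mp hη
  have hη'pos : (0 : ℝ) < η' := by exact_mod_cast hη'0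
  -- The radius `r` is split in two: one half for the distance from a term of the subsequence to
  -- `z`, the other for the short curve from that term to a lift of `p m`.
  obtain ⟨r, hr0, hrε, hrη⟩ : ∃ r > 0, r ≤ ε ∧ C * r ≤ η' :=
    ⟨min ε (η' / C), lt_min hε (by positivity), min_le_left _ _, by
      have := min_le_right ε (η' / C)
      rw [le_div_iff₀ hC0] at this
      linarith⟩
  have hδ0 : 0 < min 1 (r / 2 / C') := lt_min one_pos (by positivity)
  obtain ⟨N, hN⟩ := hC (ENNReal.ofReal (min 1 (r / 2 / C'))) (by simpa using hδ0)
  refine ⟨N, fun m hm => ?_⟩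
  obtain ⟨k, hk, hkN⟩ := ((hlim.eventually (Metric.ball_mem_nhds z (half_pos hr0))).and
    (hφ.tendsto_atTop.eventually_ge_atTop N)).exists
  obtain ⟨γ, hγ, h0, ⟨hr, h1⟩, hlen⟩ := hcurve (hN _ hkN m hm)
  have h2 := hend γ hγ hr (h0 ▸ hxR _) _ hδ0.le (min_le_left _ _) hlen.le
  have h3 : C' * min 1 (r / 2 / C') ≤ r / 2 := by
    have := min_le_right 1 (r / 2 / C')
    rw [le_div_iff₀ hC'0] at this
    linarith
  have h4 : ‖γ 1 - z‖ < r := by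
    have h5 := norm_add_le (γ 1 - γ 0) (γ 0 - z)
    rw [sub_add_sub_cancel] at h5
    have h6 : ‖γ 0 - z‖ < r / 2 := by
      rw [h0]
      exact mem_ball_iff_norm.mp hk
    linarith
  obtain ⟨hy, h5⟩ := hseg (γ 1) (h4.trans_le hrε)
  rw [h1] at h5
  refine h5.trans (le_trans ?_ hη'.le)
  rw [← ENNReal.ofReal_coe_nnreal]
  exact ENNReal.ofReal_le_ofReal ((mul_le_mul_of_nonneg_left h4.le hC0.le).trans hrη)

end IsPeriodPairFor

end

end Het
end

/-! ### The main theorem -/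

open Het in
theorem theoremt (s t α : ℝ) (hs : s ≠ 0) (ht : t ≠ 0) (hα : 0 < α) (l : Fin 3 → ℝ)
    (hl : 4 * kappaSq s = α ^ 2 * (1 + kappaSq s) * ∑ i, l i ^ 2) :
    -- the Weierstrass function and the lattices exist
    (∃ L : PeriodPair, IsPeriodPairFor L (aParam s t α)) ∧
    ∀ L : PeriodPair, IsPeriodPairFor L (aParam s t α) →
      (∃ Γ : Subgroup (H5 s t), IsLattice Γ ∧ HasPeriod Γ L) ∧
      ((∃ q : ℚ, s = q) → ∃ Γ : Subgroup (H5 s t), IsLattice Γ ∧ HasPeriod Γ L ∧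
        ∀ v : Fin 4 → ℝ, v ∈ baseLattice Γ ↔ ∀ i, ∃ n : ℤ, v i = n * L.ω₁.re) ∧
      ∀ Γ : Subgroup (H5 s t), IsLattice Γ → HasPeriod Γ L →
        -- the manifold and the fields on it
        IsCoveringMap (proj Γ L) ∧ T2Space (M Γ L) ∧
        CoframeDescends Γ L (backFrame s t α L) ∧ Descends Γ L (dilaton α L) ∧
        (∀ r : ℝ, (∀ n : ℤ, r ≠ n * L.ω₁.re) →
          L.weierstrassP r = (realSlice L r : ℂ) ∧ 0 < realSlice L r) ∧
        ContDiffOn ℝ ∞ (dilaton α L) (regular L) ∧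
        (backFrame s t α L).IsHermitian (regular L) ∧
        (backFrame s t α L).IsHermitianConn (regular L) (backFrame s t α L).nablaPlus ∧
        -- the Strominger system, with `α' = -α²`
        (∃ ε : V6 → Spinor, Descends Γ L ε ∧
          (backFrame s t α L).IsKillingSpinor (regular L) (dilaton α L)
            (backInstanton s t α L l) ε ∧
          ∀ x ∈ regular L, ∀ v, (backFrame s t α L).cliffordVec x ((backFrame s t α L).J x v) (ε x)
            = Complex.I • (backFrame s t α L).cliffordVec x v (ε x)) ∧
        (∀ x ∈ regular L, ∀ v i j,
          backInstanton s t α L l i j x v = -backInstanton s t α L l j i x v) ∧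
        (backFrame s t α L).IsInstanton (regular L) (backInstanton s t α L l) ∧
        (backFrame s t α L).Anomaly (regular L) (backFrame s t α L).nablaMinus
          (backInstanton s t α L l) (-α ^ 2) ∧
        -- non-triviality
        (¬ ∃ c : ℝ, ∀ x ∈ regular L, dilaton α L x = c) ∧
        (∃ x ∈ regular L, (backFrame s t α L).flux x ≠ 0) ∧
        (∃ x ∈ regular L, ∃ i j, curvature (backInstanton s t α L l) i j x ≠ 0) ∧
        -α ^ 2 < 0 ∧
        -- the equations of motion
        (backFrame s t α L).SolvesMotionFirstOrder (regular L) (dilaton α L)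
          (backInstanton s t α L l) (-α ^ 2) ∧
        -- completeness and conformal compactness
        IsCompleteMetric Γ L (backFrame s t α L) ∧
        IsTorusLattice (fibreLattice Γ) ∧
        IsConformallyCompactAH (baseLattice Γ) L.ω₁.re (baseMetric L) ∧
        ∀ x ∈ regular L, ∀ v w, (backFrame s t α L).metric x v w =
          α ^ 2 * baseMetric L ![x 0, x 1, x 2, x 3] ![v 0, v 1, v 2, v 3] ![w 0, w 1, w 2, w 3]
            + e s t 4 x v * e s t 4 x w + e s t 5 x v * e s t 5 x w := by
  refine ⟨exists_isPeriodPairFor (aParam_pos hs ht hα), fun L hL =>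
    ⟨exists_lattice_hasPeriod hs ht hL.re_pos, exists_lattice_of_rat hs ht hL.re_pos,
      fun Γ hΓ hp => ?_⟩⟩
  have := hΓ.1
  have hd := hL.isDilaton hs ht hα
  exact ⟨hp.isCoveringMap_proj, t2Space_M, hp.coframeDescends hL α, hp.descends_dilaton hL α,
    fun r hr => ⟨hL.weierstrassP_ofReal r, hL.realSlice_pos hs ht hα hr⟩,
    hL.contDiffOn_dilaton hs ht hα, barFrame_isHermitian (isOpen_regular L),
    hd.isHermitianConn_nablaPlus,
    ⟨fun _ => vacuum, fun _ _ _ _ => rfl, hd.isKillingSpinor l,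
      fun x _ v => (backFrame s t α L).cliffordVec_J_vacuum x v⟩,
    fun x _ v i j => instanton_skew _ _ _ _ _ _, hd.isInstanton l, hd.anomaly hs hl,
    hL.dilaton_not_constant hs ht hα, hL.flux_ne_zero hs ht hα, hL.curvature_ne_zero hs ht hα hl,
    neg_neg_of_pos (by positivity), hd.solvesMotionFirstOrder hs hl,
    hL.isCompleteMetric hs ht hα hΓ hp, isTorusLattice_fibreLattice hs ht hΓ,
    isConformallyCompactAH hL (aParam_pos hs ht hα) hs ht hΓ hp,
    fun x hx v w => hL.backFrame_metric hs ht hα hx v w⟩
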